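/- **Setup.** *The desingularized multiple zeta function.* For $s=(s_1,\dots,s_r)\in(\mathbb C\setminus\mathbb Z)^r$ put $$\zeta^{\rm des}_r(s):=\lim_{c\to1,\,c\neq1}\frac1{(1-c)^r}\prod_{k=1}^r\frac1{(e^{2\pi i s_k}-1)\Gamma(s_k)}\int_{\mathcal C^r}\prod_{j=1}^r\Big(\frac1{e^{t_j+\cdots+t_r}-1}-\frac{c}{e^{c(t_j+\cdots+t_r)}-1}\Big)\prod_{k=1}^r t_k^{s_k-1}\,dt_k ,$$ with $c$ real and $\mathcal C$ the Hankel contour: the positive real axis from $+\infty$ to $\varepsilon$ (argument $0$), the circle of radius $\varepsilon$ around $0$ counterclockwise, and the positive real axis from $\varepsilon$ to $+\infty$ (argument $2\pi$), for all sufficiently small $\varepsilon>0$. This function extends (uniquely) to an entire function $\zeta^{\rm des}_r$ on $\mathbb C^r$. *The functions $L^{\rm des}$.* For functions on $(0,1)$ put $J[f](t)=\int_0^t f(z)\frac{dz}z$, $D[f](t)=t f'(t)$ and $J^{-n}:=D^n$ for $n\ge 0$. Put $L^{\rm des}(0)(t)=\frac t{1-t}+\frac{t\log t}{(1-t)^2}$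 and, for $k_1,\dots,k_r\in\mathbb Z$, $$L^{\rm des}(k_1,\dots,k_r)(t)=J^{k_r}\big[L^{\rm des}(0)\,J^{k_{r-1}}[L^{\rm des}(0)\cdots J^{k_1}[L^{\rm des}(0)]\cdots]\big](t),\qquad 0<t<1 .$$ For $r=0$ (empty index) both $L^{\rm des}$ and $\zeta^{\rm des}_0$ are $1$. *The algebra $\mathcal H$.* Let $\mathbb Q\langle d,j,y\rangle$ be the non-commutative polynomial ring in $d,j,y$ with $dj=jd=1$ (so $j^{-k}=d^k$); it has as basis the reduced words $j^{k_1}yj^{k_2}y\cdots yj^{k_n}$, $n\ge1$, $k_i\in\mathbb Z$. The bilinear product $\mathbin{\sqcup\!\sqcup}_0 $ is defined recursively on reduced words by $1\mathbin{\sqcup\!\sqcup}_0 w=w\mathbin{\sqcup\!\sqcup}_0 1=w$, $yu\mathbin{\sqcup\!\sqcup}_0 v=u\mathbin{\sqcup\!\sqcup}_0 yv=y(u\mathbin{\sqcup\!\sqcup}_0 v)$, $ju\mathbin{\sqcup\!\sqcup}_0 jv=j(u\mathbin{\sqcup\!\sqcup}_0 jv)+j(ju\mathbin{\sqcup\!\sqcup}_0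 v)$, $du\mathbin{\sqcup\!\sqcup}_0 dv=d(u\mathbin{\sqcup\!\sqcup}_0 dv)-u\mathbin{\sqcup\!\sqcup}_0 d^2v$, $du\mathbin{\sqcup\!\sqcup}_0 jv=d(u\mathbin{\sqcup\!\sqcup}_0 jv)-u\mathbin{\sqcup\!\sqcup}_0 v$, $ju\mathbin{\sqcup\!\sqcup}_0 dv=d(ju\mathbin{\sqcup\!\sqcup}_0 v)-u\mathbin{\sqcup\!\sqcup}_0 v$. Let $\mathcal T$ be the span of the words $j^{k_1}y\cdots yj^{k_n}$ with $k_n\ne0$, and let $\mathcal B$ be its complement, the span of $1$ and of the words ending in $y$. $\mathcal B$ is closed under $\mathbin{\sqcup\!\sqcup}_0 $. Let $\mathcal L\subset\mathcal B$ be the two-sided ideal of $(\mathcal B,\mathbin{\sqcup\!\sqcup}_0 )$ generated by all $$j^k\{d(u\mathbin{\sqcup\!\sqcup}_0 v)-du\mathbin{\sqcup\!\sqcup}_0 v-u\mathbin{\sqcup\!\sqcup}_0 dv\}\qquad(k\in\mathbb Z,\ u,v\text{ words ending in }y),$$ and put $\mathcal H:=\mathcal B/\mathcal L$ with the product induced by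 $\mathbin{\sqcup\!\sqcup}_0 $. (As a vector space, $\mathcal H=\mathbb Q\langle d,j,y\rangle/(\mathcal T+\mathcal L)$.) **Theorem.** For all $r\ge0$ and $k_1,\dots,k_r\in\mathbb Z$ the limit $\lim_{t\to1-0}L^{\rm des}(k_1,\dots,k_r)(t)$ exists and equals $\zeta^{\rm des}_r(k_1,\dots,k_r)$. There is a unique well-defined $\mathbb Q$-linear map $\zeta^{\rm des}_{\sqcup\!\sqcup}:\mathcal H\to\mathbb R$ with $\zeta^{\rm des}_{\sqcup\!\sqcup}(1)=1$ and $$\zeta^{\rm des}_{\sqcup\!\sqcup}(j^{k_r}y\cdots j^{k_1}y)=\lim_{t\to1-0}L^{\rm des}(k_1,\dots,k_r)(t)=\zeta^{\rm des}_r(k_1,\dots,k_r)$$ for all integers $k_1,\dots,k_r$, and it is a $\mathbb Q$-algebra homomorphism: $\zeta^{\rm des}_{\sqcup\!\sqcup}(xz)=\zeta^{\rm des}_{\sqcup\!\sqcup}(x)\,\zeta^{\rm des}_{\sqcup\!\sqcup}(z)$ for all $x,z\in\mathcal H$. Consequently the shuffle-type formula holds at all integer points: if $j^{k_r}y\cdots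 j^{k_1}y\mathbin{\sqcup\!\sqcup}_0 j^{l_q}y\cdots j^{l_1}y=\sum_m c_m\, j^{m_p}y\cdots j^{m_1}y$ (a finite sum over indices $m=(m_1,\dots,m_p)$), then $$\zeta^{\rm des}_r(k_1,\dots,k_r)\,\zeta^{\rm des}_q(l_1,\dots,l_q)=\sum_m c_m\,\zeta^{\rm des}_p(m_1,\dots,m_p).$$ -/

import Mathlib

open Filter Topology MeasureTheory

noncomputable section

namespace DesMZV

/-! ### The words in `d, j, y` and the ring `ℚ⟨d, j, y⟩` with `dj = jd = 1` -/

/-- The words in the letters `d, j, y` subject to `dj = jd = 1`, in reduced form: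
`j^{k₁} y j^{k₂} y ⋯ y j^{kₙ}` with integers `k₁, …, kₙ` and `n ≥ 1`, where `j^{-k} = d^k`. -/
inductive Word : Type
  /-- The word `j^k`. -/
  | pow (k : ℤ) : Word
  /-- The word `j^k y w`. -/
  | powY (k : ℤ) (w : Word) : Word

namespace Word

/-- `j^a w` in reduced form. -/
def shift (a : ℤ) : Word → Word
  | pow b => pow (a + b)
  | powY b w => powY (a + b) w

/-- Concatenation of words (followed by reduction). -/
def concat : Word → Word → Word
  | pow a, v => shift a v
  | powY a u, v => powY a (concat u v)

instance : One Word := ⟨pow 0⟩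

instance : Mul Word := ⟨concat⟩

theorem one_def : (1 : Word) = pow 0 := rfl

theorem pow_mul (a : ℤ) (v : Word) : pow a * v = shift a v := rfl

theorem powY_mul (a : ℤ) (u v : Word) : powY a u * v = powY a (u * v) := rfl

theorem shift_mul (a : ℤ) (u v : Word) : shift a u * v = shift a (u * v) := by
  cases u with
  | pow b => cases v <;> simp [shift, pow_mul, add_assoc]
  | powY b u => simp [shift, powY_mul]

instance : Monoid Word where
  mul_assoc u v w := by
    induction u with
    | pow a => simp only [pow_mul, shift_mul]
    | powY a u ih => simp only [powY_mul, ih]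
  one_mul u := by cases u <;> simp [one_def, pow_mul, shift]
  mul_one u := by
    induction u with
    | pow a => simp [one_def, pow_mul, shift]
    | powY a u ih => rw [powY_mul, ih]

/-- The letter `j`. -/
def j : Word := pow 1

/-- The letter `d`. -/
def d : Word := pow (-1)

/-- The letter `y`. -/
def y : Word := powY 0 1

theorem d_mul_j : d * j = 1 := rfl

theorem j_mul_d : j * d = 1 := rfl

/-- The exponent `k₁` of `j^{k₁} y ⋯`: the word begins with `j` if it is positive, with `d` if it is
negative, and is `1` or begins with `y` if it is zero. -/
def lead : Word → ℤ
  | pow k => k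
  | powY k _ => k

/-- The number of letters `y`. -/
def depth : Word → ℕ
  | pow _ => 0
  | powY _ w => depth w + 1

/-- The word `j^{k₁} y j^{k₂} y ⋯ j^{kᵣ} y` (the empty word if `r = 0`). -/
def ofList : List ℤ → Word
  | [] => 1
  | k :: l => powY k (ofList l)

/-- The exponents `k₁, …, kᵣ` of `j^{k₁} y ⋯ j^{kᵣ} y j^{k}`. -/
def exponents : Word → List ℤ
  | pow _ => []
  | powY k w => k :: exponents w

/-- The exponent `k` of the last power in `j^{k₁} y ⋯ j^{kᵣ} y j^{k}`. -/
def last : Word → ℤ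
  | pow k => k
  | powY _ w => last w

theorem depth_shift (a : ℤ) (u : Word) : depth (shift a u) = depth u := by
  cases u <;> rfl

theorem depth_mul_j (u : Word) : depth (j * u) = depth u := depth_shift _ _

theorem depth_mul_d (u : Word) : depth (d * u) = depth u := depth_shift _ _

theorem lead_mul_j (u : Word) : lead (j * u) = lead u + 1 := by
  cases u <;> simp [j, pow_mul, shift, lead, add_comm]

theorem lead_mul_d (u : Word) : lead (d * u) = lead u - 1 := by
  cases u <;> simp [d, pow_mul, shift, lead] <;> ring

end Word

/-- The ring `ℚ⟨d, j, y⟩` with `dj = jd = 1`; its multiplication `*` is concatenation. -/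
abbrev QDJY : Type := MonoidAlgebra ℚ Word

/-- A word as an element of `ℚ⟨d, j, y⟩`. -/
def wd (w : Word) : QDJY := MonoidAlgebra.single w 1

/-! ### The product `⧢₀` -/

/-- Auxiliary quantity for the termination of the recursion that defines `⧢₀`. -/
def shMeasure (a b : ℤ) : ℕ :=
  if a = 0 ∨ b = 0 then 0 else if a < 0 ∧ b < 0 then a.natAbs else a.natAbs + b.natAbs

/-- The product `u ⧢₀ v` of two words, by recursion on reduced words:
* `1 ⧢₀ w = w ⧢₀ 1 = w`,
* `yu ⧢₀ v = u ⧢₀ yv = y(u ⧢₀ v)`,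
* `ju ⧢₀ jv = j(u ⧢₀ jv) + j(ju ⧢₀ v)`,
* `ju ⧢₀ dv = d(ju ⧢₀ v) - u ⧢₀ v`,
* `du ⧢₀ jv = d(u ⧢₀ jv) - u ⧢₀ v`,
* `du ⧢₀ dv = d(u ⧢₀ dv) - u ⧢₀ d²v`.

In the last four rules the two factors are called `U` and `V` below. So `u = dU` if `U = ju`, and
`u = jU` if `U = du`; likewise for `v`. In the last two rules the subtracted term is
`jU ⧢₀ dV`, whether `V = jv` or `V = dv`. -/
def shWord (U V : Word) : QDJY :=
  if _lead_U : U.lead = 0 then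
    match U with
    | .pow _ => wd V
    | .powY _ u => wd .y * shWord u V
  else if _lead_V : V.lead = 0 then
    match V with
    | .pow _ => wd U
    | .powY _ v => wd .y * shWord U v
  else if _pos_U : 0 < U.lead then
    if _pos_V : 0 < V.lead then
      wd .j * shWord (.d * U) V + wd .j * shWord U (.d * V)
    else
      wd .d * shWord U (.j * V) - shWord (.d * U) (.j * V)
  else
    wd .d * shWord (.j * U) V - shWord (.j * U) (.d * V)
  termination_by (U.depth + V.depth, shMeasure U.lead V.lead)
  decreasing_by
    all_goals simp only [Word.depth, Word.depth_mul_d, Word.depth_mul_j, Word.lead_mul_d,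
      Word.lead_mul_j]
    all_goals first
      | (apply Prod.Lex.left; omega)
      | (apply Prod.Lex.right; unfold shMeasure; split_ifs <;> omega)

/-- The coefficients of an element of `ℚ⟨d, j, y⟩` with respect to the words. -/
def coeffs : QDJY →ₗ[ℚ] (Word →₀ ℚ) where
  toFun x := x.coeff
  map_add' _ _ := rfl
  map_smul' _ _ := rfl

/-- The `ℚ`-bilinear product `⧢₀` on `ℚ⟨d, j, y⟩`. -/
def sh : QDJY →ₗ[ℚ] QDJY →ₗ[ℚ] QDJY :=
  (Finsupp.linearCombination ℚ fun u : Word =>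
    (Finsupp.linearCombination ℚ (shWord u)).comp coeffs).comp coeffs

theorem sh_wd (u v : Word) : sh (wd u) (wd v) = shWord u v := by
  have h (w : Word) : coeffs (wd w) = Finsupp.single w 1 := rfl
  rw [sh, LinearMap.comp_apply, h, Finsupp.linearCombination_single, one_smul,
    LinearMap.comp_apply, h, Finsupp.linearCombination_single, one_smul]

theorem wd_mul (u v : Word) : wd u * wd v = wd (u * v) := by
  simp [wd, MonoidAlgebra.single_mul_single]

/-! ### The algebra `𝓗` -/

/-- The word ends in `y`. -/
def Word.EndsInY (w : Word) : Prop := w.depth ≠ 0 ∧ w.last = 0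

/-- The span of the words `j^{k₁} y ⋯ y j^{kᵣ}` with `kᵣ ≠ 0`. -/
def T : Submodule ℚ QDJY := Submodule.span ℚ (wd '' {w | w.last ≠ 0})

/-- The span of the words that end in `y`. -/
def endsInYSpan : Submodule ℚ QDJY := Submodule.span ℚ (wd '' {w | w.EndsInY})

/-- The span of the empty word `1` and the words that end in `y`, that is, of the words
`j^{k₁} y ⋯ j^{kᵣ} y` with `r ≥ 0`. -/
def admissible : Submodule ℚ QDJY := Submodule.span ℚ (wd '' {w | w = 1 ∨ w.EndsInY})

theorem Word.eq_one_or_endsInY_iff (w : Word) : (w = 1 ∨ w.EndsInY) ↔ w.last = 0 := by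
  cases w with
  | pow k => simp [Word.EndsInY, Word.one_def, Word.depth, Word.last]
  | powY k w => simp [Word.EndsInY, Word.one_def, Word.depth]

theorem endsInYSpan_le : endsInYSpan ≤ admissible :=
  Submodule.span_mono (Set.image_mono fun _ hw => Or.inr hw)

theorem wd_mem_admissible {w : Word} (hw : w.last = 0) : wd w ∈ admissible :=
  Submodule.subset_span ⟨w, (Word.eq_one_or_endsInY_iff w).2 hw, rfl⟩

theorem mul_mem_of_forall {S S' : Set Word} {a : Word} (h : ∀ w ∈ S, a * w ∈ S') {x : QDJY}
    (hx : x ∈ Submodule.span ℚ (wd '' S)) : wd a * x ∈ Submodule.span ℚ (wd '' S') := by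
  induction hx using Submodule.span_induction with
  | mem x hx =>
    obtain ⟨w, hw, rfl⟩ := hx
    rw [wd_mul]
    exact Submodule.subset_span ⟨_, h w hw, rfl⟩
  | zero => simp
  | add x z _ _ hx hz => rw [mul_add]; exact add_mem hx hz
  | smul c x _ hx => rw [mul_smul_comm]; exact Submodule.smul_mem _ _ hx

theorem Word.last_shift (a : ℤ) {w : Word} (hw : w.depth ≠ 0) :
    (Word.shift a w).last = w.last := by
  cases w with
  | pow k => simp [Word.depth] at hw
  | powY k w => rfl

theorem pow_mul_mem (a : ℤ) {x : QDJY} (hx : x ∈ endsInYSpan) :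
    wd (.pow a) * x ∈ endsInYSpan := by
  refine mul_mem_of_forall (fun w hw => ?_) hx
  exact ⟨by rw [Word.pow_mul, Word.depth_shift]; exact hw.1,
    by rw [Word.pow_mul, Word.last_shift a hw.1]; exact hw.2⟩

theorem y_mul_mem {x : QDJY} (hx : x ∈ admissible) : wd .y * x ∈ endsInYSpan := by
  refine mul_mem_of_forall (fun w hw => ?_) hx
  have : Word.y * w = Word.powY 0 w := by rw [Word.y, Word.powY_mul, one_mul]
  rw [this]
  exact ⟨by simp [Word.depth], (Word.eq_one_or_endsInY_iff w).1 hw⟩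

theorem Word.depth_ne_zero {w : Word} (h : w.last = 0) (h' : w.lead ≠ 0) : w.depth ≠ 0 := by
  cases w with
  | pow k => exact absurd h h'
  | powY k w => simp [Word.depth]

theorem shWord_mem (U V : Word) : U.last = 0 → V.last = 0 →
    shWord U V ∈ admissible ∧ (U.depth ≠ 0 ∨ V.depth ≠ 0 → shWord U V ∈ endsInYSpan) := by
  induction U, V using shWord.induct with
  | case1 V k hk =>
    intro hU hV
    rw [shWord, dif_pos hk]
    refine ⟨wd_mem_admissible hV, fun h => Submodule.subset_span ⟨V, ⟨?_, hV⟩, rfl⟩⟩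
    simpa [Word.depth] using h
  | case2 V k u hk ih =>
    intro hU hV
    rw [shWord, dif_pos hk]
    have := y_mul_mem (ih hU hV).1
    exact ⟨endsInYSpan_le this, fun _ => this⟩
  | case3 U hU0 k hk =>
    intro hU hV
    rw [shWord, dif_neg hU0, dif_pos hk]
    refine ⟨wd_mem_admissible hU, fun h => Submodule.subset_span ⟨U, ⟨?_, hU⟩, rfl⟩⟩
    simpa [Word.depth] using h
  | case4 U hU0 k v hk ih =>
    intro hU hV
    rw [shWord, dif_neg hU0, dif_pos hk]
    have := y_mul_mem (ih hU hV).1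
    exact ⟨endsInYSpan_le this, fun _ => this⟩
  | case5 U V hU0 hV0 hU1 hV1 ih1 ih2 =>
    intro hU hV
    have dU := Word.depth_ne_zero hU hU0
    have dV := Word.depth_ne_zero hV hV0
    have := add_mem
      (pow_mul_mem 1 ((ih1 ((Word.last_shift _ dU).trans hU) hV).2 (Or.inr dV)))
      (pow_mul_mem 1 ((ih2 hU ((Word.last_shift _ dV).trans hV)).2 (Or.inl dU)))
    rw [shWord, dif_neg hU0, dif_neg hV0, dif_pos hU1, dif_pos hV1]
    exact ⟨endsInYSpan_le this, fun _ => this⟩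
  | case6 U V hU0 hV0 hU1 hV1 ih1 ih2 =>
    intro hU hV
    have dU := Word.depth_ne_zero hU hU0
    have dV := Word.depth_ne_zero hV hV0
    have dU' : (Word.d * U).depth ≠ 0 := by rwa [Word.depth_mul_d]
    have := sub_mem
      (pow_mul_mem (-1) ((ih1 hU ((Word.last_shift _ dV).trans hV)).2 (Or.inl dU)))
      ((ih2 ((Word.last_shift _ dU).trans hU) ((Word.last_shift _ dV).trans hV)).2 (Or.inl dU'))
    rw [shWord, dif_neg hU0, dif_neg hV0, dif_pos hU1, dif_neg hV1]
    exact ⟨endsInYSpan_le this, fun _ => this⟩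
  | case7 U V hU0 hV0 hU1 ih1 ih2 =>
    intro hU hV
    have dU := Word.depth_ne_zero hU hU0
    have dV := Word.depth_ne_zero hV hV0
    have dU' : (Word.j * U).depth ≠ 0 := by rwa [Word.depth_mul_j]
    have := sub_mem
      (pow_mul_mem (-1) ((ih1 ((Word.last_shift _ dU).trans hU) hV).2 (Or.inr dV)))
      ((ih2 ((Word.last_shift _ dU).trans hU) ((Word.last_shift _ dV).trans hV)).2 (Or.inl dU'))
    rw [shWord, dif_neg hU0, dif_neg hV0, dif_neg hU1]
    exact ⟨endsInYSpan_le this, fun _ => this⟩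

theorem sh_mem {x z : QDJY} (hx : x ∈ admissible) (hz : z ∈ admissible) :
    sh x z ∈ admissible := by
  induction hx using Submodule.span_induction with
  | mem x hx =>
    obtain ⟨u, hu, rfl⟩ := hx
    induction hz using Submodule.span_induction with
    | mem z hz =>
      obtain ⟨v, hv, rfl⟩ := hz
      rw [sh_wd]
      exact (shWord_mem u v ((Word.eq_one_or_endsInY_iff u).1 hu)
        ((Word.eq_one_or_endsInY_iff v).1 hv)).1
    | zero => simp
    | add z z' _ _ hz hz' => rw [map_add]; exact add_mem hz hz'
    | smul c z _ hz => rw [map_smul]; exact Submodule.smul_mem _ _ hz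
  | zero => simp
  | add x x' _ _ hx hx' => rw [map_add, LinearMap.add_apply]; exact add_mem hx hx'
  | smul c x _ hx => rw [map_smul, LinearMap.smul_apply]; exact Submodule.smul_mem _ _ hx

theorem shWord_one_left (v : Word) : shWord 1 v = wd v := by
  rw [Word.one_def, shWord, dif_pos (show (Word.pow 0).lead = 0 from rfl)]

theorem shWord_one_right (u : Word) : shWord u 1 = wd u := by
  induction u with
  | pow k =>
    rw [Word.one_def, shWord]
    by_cases hk : (Word.pow k).lead = 0
    · rw [dif_pos hk]
      exact congrArg (fun k => wd (Word.pow k)) (Eq.symm hk)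
    · rw [dif_neg hk, dif_pos (show (Word.pow 0).lead = 0 from rfl)]
  | powY k u ih =>
    rw [Word.one_def, shWord]
    by_cases hk : (Word.powY k u).lead = 0
    · rw [dif_pos hk]
      have hk' : k = 0 := hk
      change wd Word.y * shWord u 1 = _
      rw [ih, wd_mul, Word.y, Word.powY_mul, one_mul, hk']
    · rw [dif_neg hk, dif_pos (show (Word.pow 0).lead = 0 from rfl)]

theorem one_sh (x : QDJY) : sh (wd 1) x = x := by
  induction x using MonoidAlgebra.induction_linear with
  | zero => simp
  | add x z hx hz => rw [map_add, hx, hz]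
  | single u c =>
    have : MonoidAlgebra.single u c = c • wd u := by simp [wd]
    rw [this, map_smul, sh_wd, shWord_one_left]

theorem sh_one (x : QDJY) : sh x (wd 1) = x := by
  induction x using MonoidAlgebra.induction_linear with
  | zero => simp
  | add x z hx hz => rw [map_add, LinearMap.add_apply, hx, hz]
  | single u c =>
    have : MonoidAlgebra.single u c = c • wd u := by simp [wd]
    rw [this, map_smul, LinearMap.smul_apply, sh_wd, shWord_one_right]

/-- As a vector space, `ℚ⟨d, j, y⟩` is the direct sum of `T` and the admissible part. -/
theorem isCompl_T_admissible : IsCompl T admissible := by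
  have hT : ∀ x ∈ T, ∀ w : Word, w.last = 0 → coeffs x w = 0 := by
    intro x hx w hw
    induction hx using Submodule.span_induction with
    | mem x hx =>
      obtain ⟨v, hv, rfl⟩ := hx
      exact Finsupp.single_eq_of_ne (fun h => hv (h ▸ hw))
    | zero => simp
    | add x z _ _ hx hz => rw [map_add, Finsupp.add_apply, hx, hz, add_zero]
    | smul c x _ hx => rw [map_smul, Finsupp.smul_apply, hx, smul_zero]
  have hA : ∀ x ∈ admissible, ∀ w : Word, w.last ≠ 0 → coeffs x w = 0 := by
    intro x hx w hw
    induction hx using Submodule.span_induction with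
    | mem x hx =>
      obtain ⟨v, hv, rfl⟩ := hx
      exact Finsupp.single_eq_of_ne
        (fun h => hw (h ▸ (Word.eq_one_or_endsInY_iff v).1 hv))
    | zero => simp
    | add x z _ _ hx hz => rw [map_add, Finsupp.add_apply, hx, hz, add_zero]
    | smul c x _ hx => rw [map_smul, Finsupp.smul_apply, hx, smul_zero]
  refine IsCompl.of_eq ?_ ?_
  · refine (Submodule.eq_bot_iff _).2 fun x hx => MonoidAlgebra.coeff_injective ?_
    ext w
    by_cases hw : w.last = 0
    · exact hT x hx.1 w hw
    · exact hA x hx.2 w hw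
  · refine Submodule.eq_top_iff'.2 fun x => ?_
    induction x using MonoidAlgebra.induction_linear with
    | zero => exact zero_mem _
    | add x z hx hz => exact add_mem hx hz
    | single u c =>
      have : MonoidAlgebra.single u c = c • wd u := by simp [wd]
      rw [this]
      refine Submodule.smul_mem _ _ ?_
      by_cases hw : u.last = 0
      · exact Submodule.mem_sup_right (wd_mem_admissible hw)
      · exact Submodule.mem_sup_left (Submodule.subset_span ⟨u, hw, rfl⟩)

/-- The algebra `(admissible, ⧢₀)`; here `*` is the product `⧢₀`. -/
def Adm : Type := admissible

instance : AddCommGroup Adm := inferInstanceAs (AddCommGroup admissible)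

instance : Module ℚ Adm := inferInstanceAs (Module ℚ admissible)

/-- The underlying element of `ℚ⟨d, j, y⟩`. -/
def Adm.val (x : Adm) : QDJY := Subtype.val x

instance : Mul Adm := ⟨fun x z => ⟨sh x.val z.val, sh_mem x.2 z.2⟩⟩

instance : One Adm := ⟨⟨wd 1, wd_mem_admissible rfl⟩⟩

instance : NonAssocRing Adm where
  left_distrib x z w := Subtype.ext (map_add (sh x.val) z.val w.val)
  right_distrib x z w := Subtype.ext (by
    change sh (x.val + z.val) w.val = sh x.val w.val + sh z.val w.val
    rw [map_add, LinearMap.add_apply])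
  zero_mul x := Subtype.ext (by
    change sh (0 : QDJY) x.val = 0
    rw [map_zero, LinearMap.zero_apply])
  mul_zero x := Subtype.ext (map_zero (sh x.val))
  one_mul x := Subtype.ext (one_sh x.val)
  mul_one x := Subtype.ext (sh_one x.val)

instance : IsScalarTower ℚ Adm Adm where
  smul_assoc c x z := Subtype.ext (by
    change sh (c • x.val) z.val = c • sh x.val z.val
    rw [map_smul, LinearMap.smul_apply])

/-- The two-sided ideal (for `⧢₀`) generated by the elements
`j^k (d(u ⧢₀ v) - du ⧢₀ v - u ⧢₀ dv)` with `k` an integer and `u, v` words that end in `y`. -/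
def L : TwoSidedIdeal Adm :=
  TwoSidedIdeal.span {x | ∃ (k : ℤ) (u v : Word), u.EndsInY ∧ v.EndsInY ∧
    x.val = wd (.pow k) *
      (wd .d * sh (wd u) (wd v) - sh (wd .d * wd u) (wd v) - sh (wd u) (wd .d * wd v))}

/-- All the generators of `L` are admissible. -/
theorem generator_mem (k : ℤ) (u v : Word) (hu : u.EndsInY) (hv : v.EndsInY) :
    wd (.pow k) *
      (wd .d * sh (wd u) (wd v) - sh (wd .d * wd u) (wd v) - sh (wd u) (wd .d * wd v))
      ∈ admissible := by
  have hd {w : Word} (hw : w.EndsInY) : (Word.d * w).EndsInY :=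
    ⟨by rw [Word.depth_mul_d]; exact hw.1, (Word.last_shift _ hw.1).trans hw.2⟩
  have h {u v : Word} (hu : u.EndsInY) (hv : v.EndsInY) :
      sh (wd u) (wd v) ∈ endsInYSpan := by
    rw [sh_wd]
    exact (shWord_mem u v hu.2 hv.2).2 (Or.inl hu.1)
  rw [wd_mul, wd_mul]
  exact endsInYSpan_le (pow_mul_mem k (sub_mem (sub_mem (pow_mul_mem (-1) (h hu hv))
    (h (hd hu) hv)) (h hu (hd hv))))

/-- The algebra `𝓗`, with the product induced by `⧢₀`. -/
abbrev H : Type := L.ringCon.Quotient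

instance : Module ℚ H where
  add_smul a b x := by
    induction x using Quotient.inductionOn' with
    | h x => exact congrArg (fun z : Adm => (z : H)) (add_smul a b x)
  zero_smul x := by
    induction x using Quotient.inductionOn' with
    | h x => exact congrArg (fun z : Adm => (z : H)) (zero_smul ℚ x)

theorem Word.last_ofList (l : List ℤ) : (Word.ofList l).last = 0 := by
  induction l with
  | nil => rfl
  | cons k l ih => exact ih

/-- The word `j^{kᵣ} y ⋯ j^{k₁} y`, for the index `(k₁, …, kᵣ)`. -/
def Adm.word (k : List ℤ) : Adm :=
  ⟨wd (Word.ofList k.reverse), wd_mem_admissible (Word.last_ofList _)⟩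

/-- The class in `𝓗` of the word `j^{kᵣ} y ⋯ j^{k₁} y`, for the index `(k₁, …, kᵣ)`. -/
def H.word (k : List ℤ) : H := (Adm.word k : H)

/-! ### The functions `L^des(k₁, …, kᵣ)(t)` -/

/-- `J[f](t) = ∫₀ᵗ f(z) dz/z`. -/
def opJ (f : ℝ → ℝ) (t : ℝ) : ℝ := ∫ z in (0 : ℝ)..t, f z / z

/-- `D[f](t) = t f'(t)`. -/
def opD (f : ℝ → ℝ) (t : ℝ) : ℝ := t * deriv f t

/-- `J^k` for an integer `k`, where `J^{-1} = D`. -/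
def opJPow : ℤ → (ℝ → ℝ) → ℝ → ℝ
  | .ofNat n => opJ^[n]
  | .negSucc n => opD^[n + 1]

/-- `L^des(0)(t) = t/(1-t) + t log t/(1-t)²`. -/
def desLiZero (t : ℝ) : ℝ := t / (1 - t) + t * Real.log t / (1 - t) ^ 2

/-- `J^{m₁}[L^des(0) J^{m₂}[L^des(0) ⋯ J^{mᵣ}[L^des(0)] ⋯ ]]` for the list `m₁, …, mᵣ`. -/
def desLiAux : List ℤ → ℝ → ℝ
  | [] => fun _ => 1
  | m :: l => opJPow m fun t => desLiZero t * desLiAux l t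

/-- `L^des(k₁, …, kᵣ)(t) = J^{kᵣ}[L^des(0) J^{kᵣ₋₁}[L^des(0) ⋯ J^{k₁}[L^des(0)] ⋯ ]](t)`,
a function of `0 < t < 1`. -/
def desLi (k : List ℤ) : ℝ → ℝ := desLiAux k.reverse

/-! ### The desingularized multiple zeta functions -/

/-- The logarithm along the Hankel contour with a circle of radius `ε`, which is parametrized by
`u ∈ ℝ`: the positive real axis from `+∞` to `ε` (`u ≤ 0`, argument `0`), the circle of radius `ε`
around `0`, counterclockwise (`0 ≤ u ≤ 2π`), and the positive real axis from `ε` to `+∞` (`u ≥ 2π`,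
argument `2π`). -/
def hankelLog (ε u : ℝ) : ℂ :=
  if u ≤ 0 then Real.log (ε - u)
  else if u ≤ 2 * Real.pi then Real.log ε + u * Complex.I
  else Real.log (ε + (u - 2 * Real.pi)) + 2 * Real.pi * Complex.I

/-- The Hankel contour. -/
def hankelPath (ε u : ℝ) : ℂ := Complex.exp (hankelLog ε u)

/-- The function `∏ⱼ (1/(exp(tⱼ+⋯+tᵣ) - 1) - c/(exp(c(tⱼ+⋯+tᵣ)) - 1))`. -/
def genH (r : ℕ) (c : ℝ) (t : Fin r → ℂ) : ℂ :=
  ∏ j : Fin r,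
    (1 / (Complex.exp (∑ k ∈ Finset.Ici j, t k) - 1)
      - c / (Complex.exp (c * ∑ k ∈ Finset.Ici j, t k) - 1))

/-- The integrand of `∫_{𝒞^r} genH(t₁, …, tᵣ; c) ∏ₖ tₖ^{sₖ-1} dtₖ` in the parameters of the
contours. -/
def desIntegrand (r : ℕ) (s : Fin r → ℂ) (c ε : ℝ) (u : Fin r → ℝ) : ℂ :=
  genH r c (fun k => hankelPath ε (u k)) *
    ∏ k : Fin r, (Complex.exp ((s k - 1) * hankelLog ε (u k)) * deriv (hankelPath ε) (u k))

/-- `C(s) = ∏ₖ 1/((e^{2πi sₖ} - 1) Γ(sₖ))`. -/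
def desCoeff (r : ℕ) (s : Fin r → ℂ) : ℂ :=
  ∏ k : Fin r,
    1 / ((Complex.exp (2 * Real.pi * Complex.I * s k) - 1) * Complex.Gamma (s k))

/-- `Z` is the desingularized multiple zeta function of depth `r`: it is entire on `ℂ^r`, and for
`s ∈ (ℂ ∖ ℤ)^r` and all sufficiently small `ε > 0` it is the limit, for real `c → 1`, `c ≠ 1`, of
`(1-c)^{-r} C(s) ∫_{𝒞^r} genH(t; c) ∏ₖ tₖ^{sₖ-1} dtₖ`, where the integral converges absolutely for
`c` close to `1`. -/
structure IsDesMZF (r : ℕ) (Z : (Fin r → ℂ) → ℂ) : Prop where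
  entire : Differentiable ℂ Z
  eventually : ∀ᶠ ε in 𝓝[>] (0 : ℝ), ∀ s : Fin r → ℂ, (∀ k, ∀ n : ℤ, s k ≠ n) →
    (∀ᶠ c in 𝓝[≠] (1 : ℝ), Integrable (desIntegrand r s c ε)) ∧
    Tendsto (fun c : ℝ => 1 / (1 - (c : ℂ)) ^ r * desCoeff r s * ∫ u, desIntegrand r s c ε u)
      (𝓝[≠] 1) (𝓝 (Z s))

theorem IsDesMZF.unique {r : ℕ} {Z Z' : (Fin r → ℂ) → ℂ} (h : IsDesMZF r Z)
    (h' : IsDesMZF r Z') : Z = Z' := by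
  obtain ⟨ε, hε, hε'⟩ := (h.eventually.and h'.eventually).exists
  have hd : Dense ((Set.range ((↑) : ℤ → ℂ))ᶜ) :=
    (Set.countable_range _).dense_compl ℝ
  have hD : Dense (Set.univ.pi fun _ : Fin r => (Set.range ((↑) : ℤ → ℂ))ᶜ) :=
    dense_pi _ fun _ _ => hd
  refine Continuous.ext_on hD h.entire.continuous h'.entire.continuous fun s hs => ?_
  have hs' : ∀ k, ∀ n : ℤ, s k ≠ n := fun k n e => hs k (Set.mem_univ k) ⟨n, e.symm⟩
  exact tendsto_nhds_unique (hε s hs').2 (hε' s hs').2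

open Classical in
/-- The desingularized multiple zeta function `ζ^des_r` on `ℂ^r` (the value `0` is used only if it
did not exist). -/
def desMZF (r : ℕ) : (Fin r → ℂ) → ℂ :=
  if h : ∃ Z, IsDesMZF r Z then h.choose else 0

/-- The special value `ζ^des_r(k₁, …, kᵣ)` at an integer point. -/
def desZeta (k : List ℤ) : ℂ := desMZF k.length fun i => (k.get i : ℂ)

end DesMZV

end

noncomputable section

namespace DesMZV

/-! ### Holomorphic dependence of integrals on parameters -/

section Parametric

variable {P : Type*} [NormedAddCommGroup P] [NormedSpace ℂ P] [FiniteDimensional ℂ P]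
  {T : Type*} [MeasurableSpace T] {μ : Measure T}

/-! The substitution `t = exp(-z)` turns `L^des(0)` into `G(z) = d/dz (z / (exp z - 1))` (`desG`),
the operator `D` into `-d/dz` and `J` into `F ↦ ∫_z^∞ F`. The function `G` is holomorphic on a half
strip around the positive axis that contains `0`, and it decays exponentially there. Products,
derivatives and integrals `∫_z^∞` of such functions are again of this kind (`Decaying`). So every
`L^des(k₁, …, kᵣ)` with `r ≥ 1` is such a function of `z`, and its limit for `t → 1-0` exists and is
the value at `z = 0`.

The integral operator has complex powers `J^s F(z) = 1/Γ(s) ∫₀^∞ F(z + t) t^{s-1} dt`, continued to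
all `s` by `J^s = J^{s+n} D^n` (`weyl`). They depend holomorphically on `s`, and the Hankel integral
of `F(x + t) t^{s-1}` is `(e^{2πis} - 1) Γ(s) J^s F(x)` (`integral_hankel`). As `c → 1`, each factor
of the integrand divided by `1 - c` tends to `G(tⱼ + ⋯ + tᵣ)`, with a uniform integrable bound. The
variable `tᵣ` occurs in all these sums, so integrating the other variables first leaves a
one-variable Hankel integral of `G` times the same expression in depth `r - 1`, and by induction
`ζ^des_r(s) = J^{sᵣ}[G J^{sᵣ₋₁}[G ⋯ J^{s₁}[G] ⋯ ]](0)` (`integral_limIntegrand`, `isDesMZF_desRec`).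
This is entire in `s`, and at integer points it is the limit of `L^des` just described.

For the algebra, send a word to its function of `z`. The rules of `⧢₀` are the product rule for `D`,
rewritten with `DJ = JD = 1`, so `⧢₀` becomes the pointwise product (`evalFun_shWord`). The
generators of `L` go to `0` because they measure the failure of the product rule
(`evalFun_leibniz`). Evaluation at `z = 0` is then a ring homomorphism on `𝓗`. Its values are real,
being limits of real functions, and words span, which gives uniqueness. -/

theorem aestronglyMeasurable_of_hasFDerivAt {f : P → T → ℂ} {f' : T → P →L[ℂ] ℂ} {p₀ : P}
    (hm : ∀ᶠ p in 𝓝 p₀, AEStronglyMeasurable (f p) μ)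
    (hd : ∀ᵐ t ∂μ, HasFDerivAt (fun p => f p t) (f' t) p₀) : AEStronglyMeasurable f' μ := by
  -- Each directional derivative is a pointwise limit of the measurable difference quotients along
  -- `p₀ + v / (n + 1)`; the start is moved to `N` so that these points lie where `f p` is known to
  -- be measurable.
  have hv : ∀ v : P, AEStronglyMeasurable (fun t => f' t v) μ := by
    intro v
    have hc : Tendsto (fun n : ℕ => p₀ + ((n : ℂ) + 1)⁻¹ • v) atTop (𝓝 p₀) := by
      have h : Tendsto (fun n : ℕ => ((n : ℂ) + 1)⁻¹) atTop (𝓝 0) := by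
        have := tendsto_one_div_add_atTop_nhds_zero_nat (𝕜 := ℂ)
        simpa using this
      simpa using tendsto_const_nhds.add (h.smul_const v)
    obtain ⟨N, hN⟩ := (hc.eventually hm).exists_forall_of_atTop
    refine aestronglyMeasurable_of_tendsto_ae (f := fun n : ℕ => fun t =>
      (((n + N : ℕ) : ℂ) + 1) • (f (p₀ + (((n + N : ℕ) : ℂ) + 1)⁻¹ • v) t - f p₀ t)) atTop
      (fun n => (((hN (n + N) (Nat.le_add_left _ _)).sub hm.self_of_nhds).const_smul
        (((n + N : ℕ) : ℂ) + 1))) ?_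
    filter_upwards [hd] with t ht
    have h1 : Tendsto (fun n : ℕ => ‖(n : ℂ) + 1‖) atTop atTop := by
      have : (fun n : ℕ => ‖(n : ℂ) + 1‖) = fun n : ℕ => (n : ℝ) + 1 := by
        funext n
        rw [show (n : ℂ) + 1 = ((n + 1 : ℕ) : ℂ) by push_cast; rfl, Complex.norm_natCast]
        push_cast; rfl
      rw [this]
      exact tendsto_atTop_add_const_right _ _ tendsto_natCast_atTop_atTop
    have h2 := ht.lim v h1
    exact (h2.comp (tendsto_add_atTop_nat N))
  let b := Module.finBasis ℂ P
  have : f' = fun t => ∑ i, f' t (b i) • LinearMap.toContinuousLinearMap (b.coord i) := by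
    funext t
    ext v
    simp only [sum_apply, smul_apply, smul_eq_mul,
      LinearMap.coe_toContinuousLinearMap', Module.Basis.coord_apply]
    conv_lhs => rw [← b.sum_repr v]
    rw [map_sum]
    refine Finset.sum_congr rfl fun i _ => ?_
    rw [map_smul, smul_eq_mul, mul_comm]
  rw [this]
  exact Finset.aestronglyMeasurable_fun_sum _ fun i _ => (hv (b i)).smul_const _

/-- For holomorphic families a bound on the functions is enough and none on the derivatives is
needed. On a ball of radius `ρ`, `f p t` stays within `2 b t` of `f p₀ t`, so the Schwarz lemma
gives the Lipschitz constant `2 b t / ρ` at `p₀`. -/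
theorem differentiableAt_integral_of_bound {f : P → T → ℂ} {p₀ : P} {b : T → ℝ}
    (hm : ∀ᶠ p in 𝓝 p₀, AEStronglyMeasurable (f p) μ) (hb : Integrable b μ) {U : Set P}
    (hU : U ∈ 𝓝 p₀) (hd : ∀ᵐ t ∂μ, DifferentiableOn ℂ (fun p => f p t) U)
    (hle : ∀ᵐ t ∂μ, ∀ p ∈ U, ‖f p t‖ ≤ b t) :
    DifferentiableAt ℂ (fun p => ∫ t, f p t ∂μ) p₀ := by
  obtain ⟨ρ, ρ0, hρ⟩ := Metric.mem_nhds_iff.1 hU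
  obtain ⟨ρ', ρ0', hρ'⟩ := Metric.eventually_nhds_iff_ball.1 hm
  have hD : ∀ᵐ t ∂μ, HasFDerivAt (fun p => f p t) (fderiv ℂ (fun p => f p t) p₀) p₀ := by
    filter_upwards [hd] with t ht
    exact (ht.differentiableAt hU).hasFDerivAt
  refine (hasFDerivAt_integral_of_dominated_loc_of_lip' (𝕜 := ℂ) (s := Metric.ball p₀ (min ρ ρ'))
    (bound := fun t => 2 * b t / ρ) (Metric.ball_mem_nhds _ (lt_min ρ0 ρ0'))
    (fun p hp => hρ' p (Metric.ball_subset_ball (min_le_right _ _) hp)) ?_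
    (aestronglyMeasurable_of_hasFDerivAt hm hD) ?_ ((hb.const_mul 2).div_const ρ) hD).2.differentiableAt
  · refine hb.mono' hm.self_of_nhds ?_
    filter_upwards [hle] with t ht using ht p₀ (mem_of_mem_nhds hU)
  · filter_upwards [hd, hle] with t h1 h2 p hp
    have := Complex.dist_le_div_mul_dist_of_mapsTo_ball (f := fun p => f p t) (c := p₀) (z := p)
      (R₁ := ρ) (R₂ := 2 * b t) (h1.mono hρ) (fun q hq => ?_)
      (Metric.ball_subset_ball (min_le_left _ _) hp)
    · simpa [dist_eq_norm] using this
    · rw [Metric.mem_closedBall, dist_eq_norm]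
      have := norm_sub_le (f q t) (f p₀ t)
      linarith [h2 q (hρ hq), h2 p₀ (mem_of_mem_nhds hU)]

end Parametric

/-! ### Holomorphic functions on a half strip with exponential decay -/

/-- The half strip `{z : Re z > -η, |Im z| < η}`. -/
def strip (η : ℝ) : Set ℂ := {z | -η < z.re ∧ |z.im| < η}

theorem isOpen_strip (η : ℝ) : IsOpen (strip η) :=
  (isOpen_lt continuous_const Complex.continuous_re).inter
    (isOpen_lt (continuous_abs.comp Complex.continuous_im) continuous_const)

theorem strip_mono {η η' : ℝ} (h : η ≤ η') : strip η ⊆ strip η' :=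
  fun _ hz => ⟨by linarith [hz.1], hz.2.trans_le h⟩

/-- Bounds are uniform only on the strips with `η < 1`. Arguments at a point of `strip 1` therefore
move to a smaller open strip first. -/
theorem exists_mem_strip {z : ℂ} (hz : z ∈ strip 1) : ∃ η, 0 < η ∧ η < 1 ∧ z ∈ strip η := by
  obtain ⟨h1, h2⟩ := hz
  have h3 := abs_nonneg z.im
  obtain ⟨η, hη, hη'⟩ := exists_between (max_lt (by linarith : -z.re < 1) h2)
  rw [max_lt_iff] at hη
  exact ⟨η, by linarith, hη', by linarith, hη.2⟩

theorem add_mem_strip {z w : ℂ} {η ε : ℝ} (hz : z ∈ strip η) (h : -ε ≤ w.re) (h' : |w.im| ≤ ε) :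
    z + w ∈ strip (η + ε) := by
  refine ⟨?_, ?_⟩
  · rw [Complex.add_re]; linarith [hz.1]
  · rw [Complex.add_im]; linarith [abs_add_le z.im w.im, hz.2]

theorem add_ofReal_mem_strip {z : ℂ} {η t : ℝ} (hz : z ∈ strip η) (ht : 0 ≤ t) :
    z + t ∈ strip η := by
  simpa using add_mem_strip (w := t) (ε := 0) hz (by simpa using ht) (by simp)

theorem closedBall_subset_strip {z : ℂ} {η R : ℝ} (hz : z ∈ strip η) :
    Metric.closedBall z R ⊆ strip (η + R) := by
  intro w hw
  rw [Metric.mem_closedBall, dist_eq_norm] at hw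
  have := add_mem_strip (w := w - z) hz
    (by linarith [neg_abs_le (w - z).re, Complex.abs_re_le_norm (w - z)])
    ((Complex.abs_im_le_norm (w - z)).trans hw)
  simpa using this

theorem ofReal_mem_strip {x η : ℝ} (hη : 0 < η) (hx : -η < x) : (x : ℂ) ∈ strip η :=
  ⟨by simpa using hx, by simpa using hη⟩

theorem zero_mem_strip {η : ℝ} (hη : 0 < η) : (0 : ℂ) ∈ strip η := ⟨by simpa, by simpa⟩

/-- The function `F` is holomorphic on `strip 1` and is `O(exp(-Re z / 2))` on the smaller
half strips. -/
structure Decaying (F : ℂ → ℂ) : Prop where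
  diff : DifferentiableOn ℂ F (strip 1)
  bound : ∀ η < 1, ∃ C, ∀ z ∈ strip η, ‖F z‖ ≤ C * Real.exp (-z.re / 2)

section Family

variable {P : Type*} [NormedAddCommGroup P] [NormedSpace ℂ P]

/-- A family of functions as in `Decaying`, depending holomorphically on a parameter near `p₀`. -/
def DecayingFamilyAt (F : P → ℂ → ℂ) (p₀ : P) : Prop :=
  ∃ U : Set P, IsOpen U ∧ p₀ ∈ U ∧
    (∀ p ∈ U, ∀ z ∈ strip 1, DifferentiableAt ℂ (fun q : P × ℂ => F q.1 q.2) (p, z)) ∧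
    ∀ η < 1, ∃ C, ∀ p ∈ U, ∀ z ∈ strip η, ‖F p z‖ ≤ C * Real.exp (-z.re / 2)

theorem differentiableAt_of_prod {F : P → ℂ → ℂ} {p : P} {z : ℂ}
    (h : DifferentiableAt ℂ (fun q : P × ℂ => F q.1 q.2) (p, z)) : DifferentiableAt ℂ (F p) z :=
  DifferentiableAt.comp (f := fun w : ℂ => (p, w)) z h
    ((differentiableAt_const p).prodMk differentiableAt_id)

theorem DecayingFamilyAt.decaying {F : P → ℂ → ℂ} {p₀ : P} (h : DecayingFamilyAt F p₀) :
    Decaying (F p₀) := by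
  obtain ⟨U, -, hp, hd, hb⟩ := h
  refine ⟨fun z hz => (differentiableAt_of_prod (hd p₀ hp z hz)).differentiableWithinAt,
    fun η hη => ?_⟩
  obtain ⟨C, hC⟩ := hb η hη
  exact ⟨C, hC p₀ hp⟩

theorem Decaying.differentiableAt {F : ℂ → ℂ} (h : Decaying F) {z : ℂ} (hz : z ∈ strip 1) :
    DifferentiableAt ℂ F z :=
  h.diff.differentiableAt ((isOpen_strip 1).mem_nhds hz)

theorem Decaying.family {F : ℂ → ℂ} (h : Decaying F) (p₀ : P) :
    DecayingFamilyAt (fun _ => F) p₀ := by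
  refine ⟨Set.univ, isOpen_univ, trivial, fun p _ z hz => ?_, fun η hη => ?_⟩
  · exact DifferentiableAt.comp (f := Prod.snd) (p, z) (h.differentiableAt hz)
      differentiableAt_snd
  · obtain ⟨C, hC⟩ := h.bound η hη
    exact ⟨C, fun _ _ => hC⟩

theorem DecayingFamilyAt.congr {F F' : P → ℂ → ℂ} {p₀ : P} (h : DecayingFamilyAt F p₀)
    (hF : ∀ᶠ p in 𝓝 p₀, Set.EqOn (F p) (F' p) (strip 1)) : DecayingFamilyAt F' p₀ := by
  obtain ⟨U, hU, hp, hd, hb⟩ := h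
  obtain ⟨V, hV, hV', hpV⟩ := eventually_nhds_iff.1 hF
  refine ⟨U ∩ V, hU.inter hV', ⟨hp, hpV⟩, fun p hp z hz => ?_, fun η hη => ?_⟩
  · refine (hd p hp.1 z hz).congr_of_eventuallyEq ?_
    filter_upwards [(hV'.prod (isOpen_strip 1)).mem_nhds (show (p, z) ∈ V ×ˢ strip 1 from
      ⟨hp.2, hz⟩)] with q hq using (hV q.1 hq.1 hq.2).symm
  · obtain ⟨C, hC⟩ := hb η hη
    refine ⟨C, fun p hp z hz => ?_⟩
    rw [← hV p hp.2 (strip_mono hη.le hz)]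
    exact hC p hp.1 z hz

theorem Decaying.congr {F F' : ℂ → ℂ} (h : Decaying F) (hF : Set.EqOn F F' (strip 1)) :
    Decaying F' :=
  ((h.family (0 : ℂ)).congr (Eventually.of_forall fun _ => hF)).decaying

theorem DecayingFamilyAt.mul {F F' : P → ℂ → ℂ} {p₀ : P} (h : DecayingFamilyAt F p₀)
    (h' : DecayingFamilyAt F' p₀) : DecayingFamilyAt (fun p => F p * F' p) p₀ := by
  obtain ⟨U, hU, hp, hd, hb⟩ := h
  obtain ⟨U', hU', hp', hd', hb'⟩ := h'
  refine ⟨U ∩ U', hU.inter hU', ⟨hp, hp'⟩, fun p hp z hz => ?_, fun η hη => ?_⟩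
  · exact (hd p hp.1 z hz).mul (hd' p hp.2 z hz)
  · obtain ⟨C, hC⟩ := hb η hη
    obtain ⟨C', hC'⟩ := hb' η hη
    refine ⟨|C| * |C'| * Real.exp (1 / 2), fun p hp z hz => ?_⟩
    have h1 := (hC p hp.1 z hz).trans (mul_le_mul_of_nonneg_right (le_abs_self C) (Real.exp_nonneg _))
    have h2 := (hC' p hp.2 z hz).trans
      (mul_le_mul_of_nonneg_right (le_abs_self C') (Real.exp_nonneg _))
    calc ‖F p z * F' p z‖ = ‖F p z‖ * ‖F' p z‖ := norm_mul _ _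
      _ ≤ _ := mul_le_mul h1 h2 (norm_nonneg _) (by positivity)
      _ = |C| * |C'| * (Real.exp (-z.re / 2) * Real.exp (-z.re / 2)) := by ring
      -- One of the two decay factors is given up: it is at most `exp (1/2)` because `Re z > -1`.
      _ ≤ |C| * |C'| * (Real.exp (1 / 2) * Real.exp (-z.re / 2)) := by
        gcongr; linarith [hz.1]
      _ = _ := by ring

theorem Decaying.mul {F F' : ℂ → ℂ} (h : Decaying F) (h' : Decaying F') : Decaying (F * F') :=
  ((h.family (0 : ℂ)).mul (h'.family 0)).decaying

theorem Decaying.add {F F' : ℂ → ℂ} (h : Decaying F) (h' : Decaying F') : Decaying (F + F') := by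
  refine ⟨h.diff.add h'.diff, fun η hη => ?_⟩
  obtain ⟨C, hC⟩ := h.bound η hη
  obtain ⟨C', hC'⟩ := h'.bound η hη
  refine ⟨C + C', fun z hz => ?_⟩
  rw [add_mul]
  exact (norm_add_le _ _).trans (add_le_add (hC z hz) (hC' z hz))

theorem Decaying.const_mul {F : ℂ → ℂ} (h : Decaying F) (c : ℂ) : Decaying (fun z => c * F z) := by
  refine ⟨h.diff.const_mul c, fun η hη => ?_⟩
  obtain ⟨C, hC⟩ := h.bound η hη
  refine ⟨‖c‖ * C, fun z hz => ?_⟩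
  rw [norm_mul, mul_assoc]
  exact mul_le_mul_of_nonneg_left (hC z hz) (norm_nonneg _)

theorem decaying_zero : Decaying 0 :=
  ⟨differentiableOn_const 0, fun _ _ => ⟨0, fun _ _ => by simp⟩⟩

theorem Decaying.neg {F : ℂ → ℂ} (h : Decaying F) : Decaying (-F) := by
  have := h.const_mul (-1)
  exact this.congr fun z _ => by simp

/-! ### Differentiation -/

/-- The operator `-d/dz`. -/
def negDeriv (F : ℂ → ℂ) : ℂ → ℂ := fun z => -deriv F z

/-- Cauchy's estimate on the circle of radius `R`; the decay factor changes by at most `exp (R/2)`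
on it. The price is the passage from `strip (η + R)` to `strip η`, which is why `Decaying` asks for
a bound for every `η < 1`. -/
theorem norm_deriv_le_of_strip {F : ℂ → ℂ} {η R C : ℝ} (hR : 0 < R) (hη : η + R < 1)
    (hd : DifferentiableOn ℂ F (strip 1))
    (hC : ∀ z ∈ strip (η + R), ‖F z‖ ≤ C * Real.exp (-z.re / 2)) {z : ℂ} (hz : z ∈ strip η) :
    ‖deriv F z‖ ≤ |C| * Real.exp (R / 2) / R * Real.exp (-z.re / 2) := by
  have hsub := closedBall_subset_strip (R := R) hz
  have := Complex.norm_deriv_le_of_forall_mem_sphere_norm_le (c := z) (R := R) (f := F)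
    (C := |C| * Real.exp (R / 2) * Real.exp (-z.re / 2)) hR
    ((hd.mono (hsub.trans (strip_mono hη.le))).diffContOnCl_ball subset_rfl) ?_
  · convert this using 1; ring
  · intro w hw
    have hw' := hsub (Metric.sphere_subset_closedBall hw)
    refine (hC w hw').trans ?_
    rw [mul_assoc, ← Real.exp_add]
    rw [mem_sphere_iff_norm] at hw
    have h1 := (Complex.abs_re_le_norm (w - z)).trans hw.le
    rw [Complex.sub_re] at h1
    have h2 := neg_abs_le (w.re - z.re)
    refine mul_le_mul (le_abs_self C) (Real.exp_le_exp.2 (by linarith)) (Real.exp_nonneg _)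
      (abs_nonneg _)

/-- Joint holomorphy in `(p, z)` comes from Cauchy's formula for the derivative, written as an
integral over a circle of fixed radius that moves with `z`; holomorphy of parametric integrals then
applies. -/
theorem DecayingFamilyAt.negDeriv [FiniteDimensional ℂ P] {F : P → ℂ → ℂ} {p₀ : P}
    (h : DecayingFamilyAt F p₀) : DecayingFamilyAt (fun p => negDeriv (F p)) p₀ := by
  obtain ⟨U, hU, hp, hd, hb⟩ := h
  have hd' : ∀ p ∈ U, DifferentiableOn ℂ (F p) (strip 1) := fun p hp z hz =>
    (differentiableAt_of_prod (hd p hp z hz)).differentiableWithinAt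
  refine ⟨U, hU, hp, fun p hp z hz => ?_, fun η hη => ?_⟩
  · obtain ⟨η, h0, h1, hzη⟩ := exists_mem_strip hz
    -- Half of the distance left: circles of radius `R` around points of `strip η` stay in `strip (η
    -- + R)` with `η + R < 1`.
    set R := (1 - η) / 2 with hRdef
    have hR : 0 < R := by linarith
    have hlt : η + R < 1 := by linarith
    obtain ⟨C, hC⟩ := hb (η + R) hlt
    have hO : U ×ˢ strip η ∈ 𝓝 (p, z) :=
      (hU.prod (isOpen_strip η)).mem_nhds ⟨hp, hzη⟩
    have hmem : ∀ w ∈ strip η, ∀ θ, circleMap w R θ ∈ strip (η + R) := fun w hw θ =>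
      closedBall_subset_strip hw (circleMap_mem_closedBall w hR.le θ)
    have key : DifferentiableAt ℂ (fun q : P × ℂ => ∫ θ in Set.Ioc 0 (2 * Real.pi),
        deriv (circleMap 0 R) θ * (((circleMap 0 R θ) ^ 2)⁻¹ * F q.1 (circleMap q.2 R θ)))
        (p, z) := by
      refine differentiableAt_integral_of_bound (U := U ×ˢ strip η)
        (b := fun _ => R⁻¹ * (|C| * Real.exp ((η + R) / 2))) ?_ (integrable_const _) hO ?_ ?_
      · filter_upwards [hO] with q hq
        refine Continuous.aestronglyMeasurable ?_
        have h2 : Continuous fun θ => F q.1 (circleMap q.2 R θ) :=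
          (hd' q.1 hq.1).continuousOn.comp_continuous (continuous_circleMap _ _)
            fun θ => strip_mono hlt.le (hmem q.2 hq.2 θ)
        have h3 : Continuous fun θ => deriv (circleMap 0 R) θ := by
          simp only [deriv_circleMap]
          exact (continuous_circleMap 0 R).mul continuous_const
        refine h3.mul (Continuous.mul (((continuous_circleMap 0 R).pow 2).inv₀ fun θ => ?_) h2)
        exact pow_ne_zero 2 (circleMap_ne_center hR.ne')
      · refine Eventually.of_forall fun θ q hq => DifferentiableAt.differentiableWithinAt ?_
        refine DifferentiableAt.const_mul (DifferentiableAt.const_mul ?_ _) _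
        have := hd q.1 hq.1 _ (strip_mono hlt.le (hmem q.2 hq.2 θ))
        refine DifferentiableAt.comp (f := fun q : P × ℂ => (q.1, circleMap q.2 R θ)) q this ?_
        unfold circleMap
        fun_prop
      · refine Eventually.of_forall fun θ q hq => ?_
        have h1 := hmem q.2 hq.2 θ
        have h2 := hC q.1 hq.1 _ h1
        rw [norm_mul, norm_mul, deriv_circleMap, norm_mul, Complex.norm_I, norm_inv, norm_pow,
          norm_circleMap_zero, abs_of_pos hR, mul_one, ← mul_assoc,
          show R * (R ^ 2)⁻¹ = R⁻¹ by field_simp]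
        gcongr
        refine h2.trans (mul_le_mul (le_abs_self C) (Real.exp_le_exp.2 ?_) (Real.exp_nonneg _)
          (abs_nonneg _))
        linarith [h1.1]
    have e : (fun q : P × ℂ => DesMZV.negDeriv (F q.1) q.2) =ᶠ[𝓝 (p, z)] fun q =>
        -((2 * Real.pi * Complex.I : ℂ)⁻¹ * ∫ θ in Set.Ioc 0 (2 * Real.pi),
        deriv (circleMap 0 R) θ * (((circleMap 0 R θ) ^ 2)⁻¹ * F q.1 (circleMap q.2 R θ))) := by
      filter_upwards [hO] with q hq
      rw [DesMZV.negDeriv, ← Complex.two_pi_I_inv_smul_circleIntegral_sub_sq_inv_smul_of_differentiable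
        (isOpen_strip 1) (c := q.2) (w₀ := q.2) (R := R) ((closedBall_subset_strip hq.2).trans
          (strip_mono hlt.le)) (hd' q.1 hq.1) (Metric.mem_ball_self hR), smul_eq_mul,
        circleIntegral, intervalIntegral.integral_of_le (by positivity)]
      simp only [smul_eq_mul, circleMap_sub_center, deriv_circleMap]
    exact ((key.const_mul _).neg).congr_of_eventuallyEq e
  · obtain ⟨R, hR, hR'⟩ := exists_between (sub_pos.2 hη)
    obtain ⟨C, hC⟩ := hb (η + R) (by linarith)
    refine ⟨|C| * Real.exp (R / 2) / R, fun p hp z hz => ?_⟩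
    refine (norm_neg _).trans_le ?_
    exact norm_deriv_le_of_strip hR (by linarith) (hd' p hp) (hC p hp) hz

theorem Decaying.negDeriv {F : ℂ → ℂ} (h : Decaying F) : Decaying (negDeriv F) :=
  (h.family (0 : ℂ)).negDeriv.decaying

theorem DecayingFamilyAt.negDeriv_iterate [FiniteDimensional ℂ P] {F : P → ℂ → ℂ} {p₀ : P}
    (h : DecayingFamilyAt F p₀) (n : ℕ) :
    DecayingFamilyAt (fun p => DesMZV.negDeriv^[n] (F p)) p₀ := by
  induction n with
  | zero => exact h
  | succ n ih => simpa only [Function.iterate_succ_apply'] using ih.negDeriv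

theorem Decaying.negDeriv_iterate {F : ℂ → ℂ} (h : Decaying F) (n : ℕ) :
    Decaying (DesMZV.negDeriv^[n] F) :=
  ((h.family (0 : ℂ)).negDeriv_iterate n).decaying

theorem negDeriv_congr {F F' : ℂ → ℂ} (h : Set.EqOn F F' (strip 1)) :
    Set.EqOn (negDeriv F) (negDeriv F') (strip 1) := fun z hz => by
  rw [negDeriv, negDeriv, (h.eventuallyEq_of_mem ((isOpen_strip 1).mem_nhds hz)).deriv_eq]

theorem negDeriv_iterate_congr {F F' : ℂ → ℂ} (h : Set.EqOn F F' (strip 1)) (n : ℕ) :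
    Set.EqOn (negDeriv^[n] F) (negDeriv^[n] F') (strip 1) := by
  induction n with
  | zero => exact h
  | succ n ih => simpa only [Function.iterate_succ_apply'] using negDeriv_congr ih

end Family

/-! ### Complex powers of the integration operator -/

/-- The integral `1/Γ(s) ∫₀^∞ F(z + t) t^{s-1} dt`, for `Re s > 0`. -/
def weylBase (s : ℂ) (F : ℂ → ℂ) (z : ℂ) : ℂ :=
  (Complex.Gamma s)⁻¹ * ∫ t in Set.Ioi (0 : ℝ), F (z + t) * (t : ℂ) ^ (s - 1)

/-- The power `J^s` of the operator `J F(z) = ∫_z^∞ F`, for a complex exponent `s`. -/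
def weyl (s : ℂ) (F : ℂ → ℂ) : ℂ → ℂ :=
  weylBase (s + (⌊-s.re⌋₊ + 1 : ℕ)) (negDeriv^[⌊-s.re⌋₊ + 1] F)

theorem integrableOn_rpow_mul_exp {a : ℝ} (ha : 0 < a) :
    IntegrableOn (fun t : ℝ => t ^ (a - 1) * Real.exp (-t / 2)) (Set.Ioi 0) := by
  have := integrableOn_rpow_mul_exp_neg_mul_rpow (p := 1) (s := a - 1) (b := 1 / 2) (by linarith)
    one_pos (by norm_num)
  refine this.congr_fun (fun t _ => ?_) measurableSet_Ioi
  simp only [Real.rpow_one]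
  congr 2; ring

theorem continuousOn_shift {F : ℂ → ℂ} (h : Decaying F) {z : ℂ} (hz : z ∈ strip 1) :
    ContinuousOn (fun t : ℝ => F (z + t)) (Set.Ici 0) :=
  h.diff.continuousOn.comp (by fun_prop) fun _ ht => add_ofReal_mem_strip hz ht

theorem continuousOn_cpow_Ioi (s : ℂ) :
    ContinuousOn (fun t : ℝ => (t : ℂ) ^ s) (Set.Ioi 0) := fun t ht =>
  (Complex.continuousAt_ofReal_cpow_const t s (Or.inr ht.ne')).continuousWithinAt

/-- Bounding `t^{Re s - 1}` by the sum of the powers with exponents `m - 1` (which wins for `t ≤ 1`)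
and `M - 1` (for `t ≥ 1`) gives one dominating function for all `s` with `m ≤ Re s ≤ M`. The factor
`exp(-Re z / 2)` is kept apart, so that the decay in `z` survives integration. -/
theorem norm_weyl_integrand_le {F : ℂ → ℂ} {C η m M : ℝ}
    (hC : ∀ z ∈ strip η, ‖F z‖ ≤ C * Real.exp (-z.re / 2)) {z s : ℂ} (hz : z ∈ strip η)
    (hm : m ≤ s.re) (hM : s.re ≤ M) {t : ℝ} (ht : 0 < t) :
    ‖F (z + t) * (t : ℂ) ^ (s - 1)‖ ≤ |C| * Real.exp (-z.re / 2) *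
      (t ^ (m - 1) * Real.exp (-t / 2) + t ^ (M - 1) * Real.exp (-t / 2)) := by
  have h1 := (hC _ (add_ofReal_mem_strip hz ht.le)).trans
    (mul_le_mul_of_nonneg_right (le_abs_self C) (Real.exp_nonneg _))
  have h2 : t ^ (s.re - 1) ≤ t ^ (m - 1) + t ^ (M - 1) := by
    rcases le_total 1 t with h | h
    · exact (Real.rpow_le_rpow_of_exponent_le h (by linarith)).trans
        (le_add_of_nonneg_left (by positivity))
    · exact (Real.rpow_le_rpow_of_exponent_ge ht h (by linarith)).trans
        (le_add_of_nonneg_right (by positivity))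
  rw [norm_mul, Complex.norm_cpow_eq_rpow_re_of_pos ht]
  calc _ ≤ (|C| * Real.exp (-(z + t).re / 2)) * (t ^ (m - 1) + t ^ (M - 1)) := by
        gcongr
        simpa using h2
    _ = _ := by
        rw [show -(z + t).re / 2 = -z.re / 2 + -t / 2 by simp; ring, Real.exp_add]; ring

theorem Decaying.integrableOn {F : ℂ → ℂ} (h : Decaying F) {z s : ℂ} (hz : z ∈ strip 1)
    (hs : 0 < s.re) :
    IntegrableOn (fun t : ℝ => F (z + t) * (t : ℂ) ^ (s - 1)) (Set.Ioi 0) := by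
  obtain ⟨η, -, h1, hzη⟩ := exists_mem_strip hz
  obtain ⟨C, hC⟩ := h.bound η h1
  refine Integrable.mono' (((integrableOn_rpow_mul_exp hs).add
    (integrableOn_rpow_mul_exp hs)).const_mul (|C| * Real.exp (-z.re / 2))) ?_ ?_
  · exact (((continuousOn_shift h hz).mono Set.Ioi_subset_Ici_self).mul
      (continuousOn_cpow_Ioi _)).aestronglyMeasurable measurableSet_Ioi
  · exact ae_restrict_of_forall_mem measurableSet_Ioi fun t ht =>
      norm_weyl_integrand_le hC hzη le_rfl le_rfl ht

theorem Decaying.integrableOn_shift {F : ℂ → ℂ} (h : Decaying F) {z : ℂ} (hz : z ∈ strip 1) :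
    IntegrableOn (fun t : ℝ => F (z + t)) (Set.Ioi 0) := by
  simpa using h.integrableOn (s := 1) hz one_pos

theorem weylBase_congr {F F' : ℂ → ℂ} (s : ℂ) (h : Set.EqOn F F' (strip 1)) :
    Set.EqOn (weylBase s F) (weylBase s F') (strip 1) := fun z hz => by
  rw [weylBase, weylBase, setIntegral_congr_fun measurableSet_Ioi fun t (ht : 0 < t) => ?_]
  simp only [h (add_ofReal_mem_strip hz ht.le)]

theorem weyl_congr {F F' : ℂ → ℂ} (s : ℂ) (h : Set.EqOn F F' (strip 1)) :
    Set.EqOn (weyl s F) (weyl s F') (strip 1) :=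
  weylBase_congr _ (negDeriv_iterate_congr h _)

/-- The parameter set is shrunk so that `Re σ(p)` stays between two positive constants and
`1/Γ(σ(p))` stays bounded. The integrals then have a common dominating function, and `1/Γ` is
entire. -/
theorem DecayingFamilyAt.weylBase {P : Type*} [NormedAddCommGroup P] [NormedSpace ℂ P]
    [FiniteDimensional ℂ P] {F : P → ℂ → ℂ} {p₀ : P} (h : DecayingFamilyAt F p₀) {σ : P → ℂ}
    (hσ : Differentiable ℂ σ) (hσ0 : 0 < (σ p₀).re) :
    DecayingFamilyAt (fun p => weylBase (σ p) (F p)) p₀ := by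
  obtain ⟨U, hU, hp, hd, hb⟩ := h
  set m := (σ p₀).re / 2
  set M := (σ p₀).re + 1
  set K := ‖(Complex.Gamma (σ p₀))⁻¹‖ + 1
  have hΓ : Differentiable ℂ fun p => (Complex.Gamma (σ p))⁻¹ :=
    Complex.differentiable_one_div_Gamma.comp hσ
  set V := U ∩ {p | m < (σ p).re ∧ (σ p).re < M ∧ ‖(Complex.Gamma (σ p))⁻¹‖ < K} with hVdef
  have hre : Continuous fun p => (σ p).re := Complex.continuous_re.comp hσ.continuous
  have hV : IsOpen V := hU.inter ((isOpen_lt continuous_const hre).inter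
    ((isOpen_lt hre continuous_const).inter (isOpen_lt hΓ.continuous.norm continuous_const)))
  have hm : 0 < m := by positivity
  have hM : 0 < M := by positivity
  have hInt := (integrableOn_rpow_mul_exp hm).add (integrableOn_rpow_mul_exp hM)
  have hD : ∀ p ∈ U, DifferentiableOn ℂ (F p) (strip 1) := fun p hp z hz =>
    (differentiableAt_of_prod (hd p hp z hz)).differentiableWithinAt
  refine ⟨V, hV, ⟨hp, ?_, ?_, ?_⟩, fun p hp z hz => ?_, fun η hη => ?_⟩
  · simp only [m]; linarith
  · simp only [M]; linarith
  · simp only [K]; linarith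
  · obtain ⟨η, -, h1, hzη⟩ := exists_mem_strip hz
    obtain ⟨C, hC⟩ := hb η h1
    have hO : V ×ˢ strip η ∈ 𝓝 (p, z) := (hV.prod (isOpen_strip η)).mem_nhds ⟨hp, hzη⟩
    refine DifferentiableAt.mul (DifferentiableAt.comp (f := Prod.fst) (p, z)
      (hΓ p) differentiableAt_fst) ?_
    refine differentiableAt_integral_of_bound (U := V ×ˢ strip η) (b := fun t =>
      |C| * Real.exp (η / 2) *
      (t ^ (m - 1) * Real.exp (-t / 2) + t ^ (M - 1) * Real.exp (-t / 2)))
      ?_ (hInt.const_mul _) hO ?_ ?_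
    · filter_upwards [hO] with q hq
      refine ContinuousOn.aestronglyMeasurable ?_ measurableSet_Ioi
      refine ContinuousOn.mul ?_ (continuousOn_cpow_Ioi _)
      exact (hD q.1 hq.1.1).continuousOn.comp (by fun_prop)
        fun t ht => add_ofReal_mem_strip (strip_mono h1.le hq.2) (le_of_lt ht)
    · refine ae_restrict_of_forall_mem measurableSet_Ioi fun t (ht : 0 < t) q hq =>
        DifferentiableAt.differentiableWithinAt ?_
      have h2 : DifferentiableAt ℂ (fun q : P × ℂ => F q.1 (q.2 + t)) q := by
        have := hd q.1 hq.1.1 _ (add_ofReal_mem_strip (strip_mono h1.le hq.2) ht.le)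
        refine DifferentiableAt.comp (f := fun q : P × ℂ => (q.1, q.2 + (t : ℂ))) q this ?_
        fun_prop
      refine h2.mul ?_
      refine DifferentiableAt.const_cpow ?_ (Or.inl (by exact_mod_cast ht.ne'))
      exact ((hσ q.1).comp q differentiableAt_fst).sub_const 1
    · refine ae_restrict_of_forall_mem measurableSet_Ioi fun t (ht : 0 < t) q hq => ?_
      refine (norm_weyl_integrand_le (hC q.1 hq.1.1) hq.2 hq.1.2.1.le hq.1.2.2.1.le ht).trans ?_
      gcongr
      linarith [hq.2.1]
  · obtain ⟨C, hC⟩ := hb η hη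
    set A := ∫ t in Set.Ioi (0 : ℝ),
      (t ^ (m - 1) * Real.exp (-t / 2) + t ^ (M - 1) * Real.exp (-t / 2))
    have hA : 0 ≤ A := setIntegral_nonneg measurableSet_Ioi fun t (ht : 0 < t) => by positivity
    refine ⟨K * (|C| * A), fun p hp z hz => ?_⟩
    refine (norm_mul _ _).trans_le ?_
    rw [mul_assoc]
    refine mul_le_mul hp.2.2.2.le ?_ (norm_nonneg _) (by positivity)
    have := norm_integral_le_of_norm_le (hInt.const_mul (|C| * Real.exp (-z.re / 2)))
      (ae_restrict_of_forall_mem measurableSet_Ioi fun t (ht : 0 < t) =>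
        norm_weyl_integrand_le (hC p hp.1) hz hp.2.1.le hp.2.2.1.le ht)
    refine this.trans (le_of_eq ?_)
    rw [integral_const_mul]
    simp only [A, Pi.add_apply]
    ring

theorem Decaying.tendsto_zero {F : ℂ → ℂ} (h : Decaying F) {z : ℂ} (hz : z ∈ strip 1) (a : ℂ) :
    Tendsto (fun t : ℝ => F (z + t) * (t : ℂ) ^ a) atTop (𝓝 0) := by
  obtain ⟨η, -, h1, hzη⟩ := exists_mem_strip hz
  obtain ⟨C, hC⟩ := h.bound η h1
  have hlim : Tendsto (fun t : ℝ => |C| * Real.exp (-z.re / 2) *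
      (t ^ a.re * Real.exp (-(1 / 2) * t) + t ^ a.re * Real.exp (-(1 / 2) * t))) atTop (𝓝 0) := by
    have := tendsto_rpow_mul_exp_neg_mul_atTop_nhds_zero a.re (1 / 2) (by norm_num)
    simpa using (this.add this).const_mul (|C| * Real.exp (-z.re / 2))
  refine squeeze_zero_norm' ?_ hlim
  filter_upwards [eventually_gt_atTop 0] with t ht
  have := norm_weyl_integrand_le hC hzη (s := a + 1) le_rfl le_rfl ht
  rw [add_sub_cancel_right] at this
  refine this.trans (le_of_eq ?_)
  rw [show -t / 2 = -(1 / 2) * t by ring, Complex.add_re, Complex.one_re, add_sub_cancel_right]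

theorem Decaying.hasDerivAt_shift {F : ℂ → ℂ} (h : Decaying F) {z : ℂ} (hz : z ∈ strip 1) {t : ℝ}
    (ht : 0 ≤ t) : HasDerivAt (fun t : ℝ => F (z + t)) (-DesMZV.negDeriv F (z + t)) t := by
  rw [DesMZV.negDeriv, neg_neg]
  have h1 := (h.differentiableAt (add_ofReal_mem_strip hz ht)).hasDerivAt
  have h2 : HasDerivAt (fun t : ℝ => z + (t : ℂ)) 1 t :=
    (Complex.ofRealCLM.hasDerivAt (x := t)).const_add z
  exact (h1.comp t h2).congr_deriv (mul_one _)

/-- Integration by parts against `t^s`: the boundary term vanishes at `0` because `Re s > 0` and at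
infinity by decay, and `Γ(s + 1) = s Γ(s)` absorbs the factor `s`. This identity makes the
continuation in `s` consistent. -/
theorem weylBase_eq_negDeriv {F : ℂ → ℂ} (h : Decaying F) {s : ℂ} (hs : 0 < s.re) :
    Set.EqOn (weylBase s F) (weylBase (s + 1) (negDeriv F)) (strip 1) := fun z hz => by
  have hs0 : s ≠ 0 := fun e => by simp [e] at hs
  have hs1 : 0 < (s + 1).re := by simp; linarith
  have hd : ∀ t ∈ Set.Ioi (0 : ℝ), HasDerivAt (fun t : ℝ => F (z + t) * (t : ℂ) ^ s)
      (-(negDeriv F (z + t) * (t : ℂ) ^ (s + 1 - 1)) + s * (F (z + t) * (t : ℂ) ^ (s - 1))) t := by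
    intro t ht
    have h1 : HasDerivAt (fun t : ℝ => (t : ℂ) ^ s) (s * (t : ℂ) ^ (s - 1)) t := by
      simpa using ((hasDerivAt_id (t : ℂ)).cpow_const (c := s)
        (Or.inl (by simpa using ht))).comp_ofReal
    refine ((h.hasDerivAt_shift hz (le_of_lt ht)).mul h1).congr_deriv ?_
    rw [add_sub_cancel_right]; ring
  have hi1 : IntegrableOn (fun t : ℝ => -(negDeriv F (z + t) * (t : ℂ) ^ (s + 1 - 1))) (Set.Ioi 0) :=
    (h.negDeriv.integrableOn hz hs1).neg
  have hi2 := (h.integrableOn hz hs).const_mul s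
  have hcont : ContinuousWithinAt (fun t : ℝ => F (z + t) * (t : ℂ) ^ s) (Set.Ici 0) 0 := by
    refine ((continuousOn_shift h hz) 0 Set.self_mem_Ici).mul ?_
    exact (Complex.continuousAt_ofReal_cpow_const 0 s (Or.inl hs)).continuousWithinAt
  have := integral_Ioi_of_hasDerivAt_of_tendsto hcont hd (hi1.add hi2) (h.tendsto_zero hz s)
  rw [integral_add hi1 hi2, integral_neg, integral_const_mul] at this
  simp only [Complex.ofReal_zero, add_zero, Complex.zero_cpow hs0, mul_zero, sub_zero] at this
  rw [weylBase, weylBase, Complex.Gamma_add_one s hs0, mul_inv]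
  have h3 := Complex.Gamma_ne_zero_of_re_pos hs
  rw [neg_add_eq_zero] at this
  rw [this]
  field_simp

theorem negDeriv_weylBase {F : ℂ → ℂ} (h : Decaying F) {s : ℂ} (hs : 0 < s.re) :
    Set.EqOn (negDeriv (weylBase s F)) (weylBase s (negDeriv F)) (strip 1) := fun z hz => by
  obtain ⟨η, -, h1, hzη⟩ := exists_mem_strip hz
  obtain ⟨C, hC⟩ := h.negDeriv.bound η h1
  have hO : strip η ∈ 𝓝 z := (isOpen_strip η).mem_nhds hzη
  have key := (hasDerivAt_integral_of_dominated_loc_of_deriv_le (𝕜 := ℂ)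
    (μ := volume.restrict (Set.Ioi (0 : ℝ))) (x₀ := z) (s := strip η)
    (F := fun w (t : ℝ) => F (w + t) * (t : ℂ) ^ (s - 1))
    (F' := fun w (t : ℝ) => -(negDeriv F (w + t) * (t : ℂ) ^ (s - 1)))
    (bound := fun t => |C| * Real.exp (η / 2) * (t ^ (s.re - 1) * Real.exp (-t / 2) +
      t ^ (s.re - 1) * Real.exp (-t / 2))) hO ?_ (h.integrableOn hz hs)
      (h.negDeriv.integrableOn hz hs).neg.1 ?_ ?_ ?_).2
  · have h2 := (key.const_mul (Complex.Gamma s)⁻¹).deriv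
    change -deriv (fun w => (Complex.Gamma s)⁻¹ * ∫ t in Set.Ioi (0 : ℝ),
      F (w + t) * (t : ℂ) ^ (s - 1)) z = _
    rw [h2, integral_neg, weylBase]
    ring
  · filter_upwards [hO] with w hw using (h.integrableOn (strip_mono h1.le hw) hs).1
  · refine ae_restrict_of_forall_mem measurableSet_Ioi fun t (ht : 0 < t) w hw => ?_
    rw [norm_neg]
    refine (norm_weyl_integrand_le hC hw le_rfl le_rfl ht).trans ?_
    gcongr
    linarith [hw.1]
  · exact ((integrableOn_rpow_mul_exp hs).add (integrableOn_rpow_mul_exp hs)).const_mul _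
  · refine ae_restrict_of_forall_mem measurableSet_Ioi fun t (ht : 0 < t) w hw => ?_
    have h3 := (h.differentiableAt
      (add_ofReal_mem_strip (strip_mono h1.le hw) ht.le)).hasDerivAt.comp_add_const w (t : ℂ)
    refine (h3.mul_const ((t : ℂ) ^ (s - 1))).congr_deriv ?_
    rw [negDeriv]; ring

theorem weylBase_one_negDeriv {F : ℂ → ℂ} (h : Decaying F) :
    Set.EqOn (weylBase 1 (negDeriv F)) F (strip 1) := fun z hz => by
  have := integral_Ioi_of_hasDerivAt_of_tendsto (f := fun t : ℝ => F (z + t))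
    (f' := fun t : ℝ => -negDeriv F (z + t)) ((continuousOn_shift h hz) 0 Set.self_mem_Ici)
    (fun t ht => h.hasDerivAt_shift hz (le_of_lt ht)) (h.negDeriv.integrableOn_shift hz).neg
    (by simpa using h.tendsto_zero hz 0)
  rw [integral_neg] at this
  simp only [weylBase, Complex.Gamma_one, sub_self, Complex.cpow_zero, mul_one, inv_one, one_mul]
  simpa using this

theorem weylBase_iterate {F : ℂ → ℂ} (h : Decaying F) {s : ℂ} (hs : 0 < s.re) (n : ℕ) :
    Set.EqOn (weylBase s F) (weylBase (s + n) (negDeriv^[n] F)) (strip 1) := by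
  induction n with
  | zero => simp [Set.eqOn_refl]
  | succ n ih =>
    refine ih.trans ?_
    have : 0 < (s + n).re := by simp; positivity
    have h1 := weylBase_eq_negDeriv (h.negDeriv_iterate n) this
    rw [Function.iterate_succ_apply', Nat.cast_succ, ← add_assoc]
    exact h1

/-- Any sufficiently large number of derivatives can be used to compute `weyl s F`. -/
theorem weyl_eq {F : ℂ → ℂ} (h : Decaying F) {s : ℂ} {n : ℕ} (hn : 0 < s.re + n) :
    Set.EqOn (weyl s F) (weylBase (s + n) (negDeriv^[n] F)) (strip 1) := by
  -- Any two admissible numbers of derivatives agree, since the larger one results from the smaller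
  -- by repeated integration by parts.
  have aux : ∀ {a b : ℕ}, 0 < s.re + a → a ≤ b →
      Set.EqOn (weylBase (s + a) (negDeriv^[a] F)) (weylBase (s + b) (negDeriv^[b] F))
        (strip 1) := by
    intro a b ha hab
    obtain ⟨c, rfl⟩ := Nat.exists_eq_add_of_le hab
    have := weylBase_iterate (h.negDeriv_iterate a) (s := s + a) (by simpa using ha) c
    rw [← Function.iterate_add_apply, add_comm c a] at this
    convert this using 2
    push_cast; ring
  -- The number of derivatives in the definition of `weyl` is itself admissible.
  have hfl : 0 < s.re + (⌊-s.re⌋₊ + 1 : ℕ) := by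
    have := Nat.lt_floor_add_one (-s.re)
    push_cast; linarith
  rcases le_total n (⌊-s.re⌋₊ + 1) with h1 | h1
  · exact (aux hn h1).symm
  · exact aux hfl h1

/-- The number of derivatives used by `weyl` jumps with `Re s`. Near `p₀` it is replaced by a fixed
`n`, which `weyl_eq` allows as long as `Re σ(p) + n > 0`. -/
theorem DecayingFamilyAt.weyl {P : Type*} [NormedAddCommGroup P] [NormedSpace ℂ P]
    [FiniteDimensional ℂ P] {F : P → ℂ → ℂ} {p₀ : P} (h : DecayingFamilyAt F p₀) {σ : P → ℂ}
    (hσ : Differentiable ℂ σ) : DecayingFamilyAt (fun p => weyl (σ p) (F p)) p₀ := by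
  obtain ⟨n, hn⟩ := exists_nat_gt (-(σ p₀).re)
  have hn' : 0 < (σ p₀ + n).re := by simp; linarith
  refine ((h.negDeriv_iterate n).weylBase (hσ.add_const (n : ℂ)) hn').congr ?_
  have hre : Continuous fun p => (σ p).re := Complex.continuous_re.comp hσ.continuous
  have hU : ∀ᶠ p in 𝓝 p₀, DecayingFamilyAt F p := by
    obtain ⟨U, hU, hp, hd, hb⟩ := h
    filter_upwards [hU.mem_nhds hp] with p hp using ⟨U, hU, hp, hd, hb⟩
  filter_upwards [hre.continuousAt.eventually_const_lt (show -(n : ℝ) < (σ p₀).re by linarith), hU]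
    with p h1 h2
  exact (weyl_eq h2.decaying (by linarith)).symm

theorem Decaying.weyl {F : ℂ → ℂ} (h : Decaying F) (s : ℂ) : Decaying (weyl s F) :=
  ((h.family (0 : ℂ)).weyl (differentiable_const s)).decaying

/-! ### Laws of the operators: `J^0 = 1`, `D J^s = J^s D = J^{s-1}`, `J J^s = J^{s+1}` -/

theorem weyl_zero {F : ℂ → ℂ} (h : Decaying F) : Set.EqOn (weyl 0 F) F (strip 1) := by
  have := weyl_eq h (s := 0) (n := 1) (by simp)
  rw [Nat.cast_one, zero_add] at this
  exact this.trans (weylBase_one_negDeriv h)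

theorem negDeriv_weyl {F : ℂ → ℂ} (h : Decaying F) (s : ℂ) :
    Set.EqOn (negDeriv (weyl s F)) (weyl s (negDeriv F)) (strip 1) := by
  obtain ⟨n, hn⟩ := exists_nat_gt (-s.re)
  have hn' : 0 < s.re + n := by linarith
  refine (negDeriv_congr (weyl_eq h hn')).trans ?_
  refine (negDeriv_weylBase (h.negDeriv_iterate n) (by simpa using hn')).trans ?_
  rw [← Function.iterate_succ_apply' negDeriv, Function.iterate_succ_apply]
  exact (weyl_eq h.negDeriv hn').symm

theorem weyl_negDeriv {F : ℂ → ℂ} (h : Decaying F) (s : ℂ) :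
    Set.EqOn (weyl s (negDeriv F)) (weyl (s - 1) F) (strip 1) := by
  obtain ⟨n, hn⟩ := exists_nat_gt (-s.re)
  have hn' : 0 < s.re + n := by linarith
  refine (weyl_eq h.negDeriv hn').trans ?_
  have := weyl_eq h (s := s - 1) (n := n + 1) (by simp; linarith)
  rw [Function.iterate_succ_apply] at this
  convert this.symm using 2
  push_cast; ring

theorem negDeriv_weyl_eq {F : ℂ → ℂ} (h : Decaying F) (s : ℂ) :
    Set.EqOn (negDeriv (weyl s F)) (weyl (s - 1) F) (strip 1) :=
  (negDeriv_weyl h s).trans (weyl_negDeriv h s)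

theorem weyl_one_negDeriv {F : ℂ → ℂ} (h : Decaying F) :
    Set.EqOn (weyl 1 (negDeriv F)) F (strip 1) := by
  have := weyl_negDeriv h 1
  rw [sub_self] at this
  exact this.trans (weyl_zero h)

theorem negDeriv_weyl_one {F : ℂ → ℂ} (h : Decaying F) :
    Set.EqOn (negDeriv (weyl 1 F)) F (strip 1) :=
  (negDeriv_weyl h 1).trans (weyl_one_negDeriv h)

/-- Obtained without an interchange of integrals: write `J^s F` as `D J^{s+1} F` and cancel `J D`.
-/
theorem weyl_one_weyl {F : ℂ → ℂ} (h : Decaying F) (s : ℂ) :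
    Set.EqOn (weyl 1 (weyl s F)) (weyl (s + 1) F) (strip 1) := by
  have h1 := negDeriv_weyl_eq h (s + 1)
  rw [add_sub_cancel_right] at h1
  exact (weyl_congr 1 h1).symm.trans (weyl_one_negDeriv (h.weyl _))

theorem weyl_one_eq {F : ℂ → ℂ} (h : Decaying F) {z : ℂ} (hz : z ∈ strip 1) :
    weyl 1 F z = ∫ t in Set.Ioi (0 : ℝ), F (z + t) := by
  have := weyl_eq h (s := 1) (n := 0) (by simp) hz
  simpa [weylBase] using this

/-! ### The Hankel contour -/

theorem measurable_hankelLog (ε : ℝ) : Measurable (hankelLog ε) := by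
  unfold hankelLog
  refine Measurable.ite measurableSet_Iic ?_ (Measurable.ite measurableSet_Iic ?_ ?_)
  · exact Complex.measurable_ofReal.comp (Real.measurable_log.comp (measurable_const.sub measurable_id))
  · fun_prop
  · exact (Complex.measurable_ofReal.comp (Real.measurable_log.comp
      (measurable_const.add (measurable_id.sub measurable_const)))).add measurable_const

theorem measurable_hankelPath (ε : ℝ) : Measurable (hankelPath ε) :=
  Complex.measurable_exp.comp (measurable_hankelLog ε)

/-- The density `t^{s-1} dt` on the Hankel contour. -/
def hankelWeight (s : ℂ) (ε u : ℝ) : ℂ :=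
  Complex.exp ((s - 1) * hankelLog ε u) * deriv (hankelPath ε) u

theorem measurable_hankelWeight (s : ℂ) (ε : ℝ) : Measurable (hankelWeight s ε) :=
  (Complex.measurable_exp.comp ((measurable_hankelLog ε).const_mul _)).mul (measurable_deriv _)

/-- The point of the circular part of the Hankel contour on a logarithmic scale. -/
def circleLog (ε θ : ℝ) : ℂ := Real.log ε + θ * Complex.I

theorem continuous_circleLog (ε : ℝ) : Continuous (circleLog ε) := by
  unfold circleLog; fun_prop

theorem norm_exp_circleLog {ε : ℝ} (hε : 0 < ε) (θ : ℝ) : ‖Complex.exp (circleLog ε θ)‖ = ε := by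
  rw [Complex.norm_exp, circleLog]
  simp [Real.exp_log hε]

theorem hankelLog_of_neg {ε u : ℝ} (hu : u < 0) : hankelLog ε u = Real.log (ε - u) := by
  rw [hankelLog, if_pos hu.le]

theorem hankelLog_of_mem {ε u : ℝ} (hu : u ∈ Set.Ioo 0 (2 * Real.pi)) :
    hankelLog ε u = circleLog ε u := by
  rw [hankelLog, if_neg (not_le.2 hu.1), if_pos hu.2.le, circleLog]

theorem hankelLog_of_gt {ε u : ℝ} (hu : 2 * Real.pi < u) :
    hankelLog ε u = Real.log (ε + (u - 2 * Real.pi)) + 2 * Real.pi * Complex.I := by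
  rw [hankelLog, if_neg (not_le.2 (Real.two_pi_pos.trans hu)), if_neg (not_le.2 hu)]

theorem hankelPath_of_neg {ε u : ℝ} (hε : 0 < ε) (hu : u < 0) :
    hankelPath ε u = (ε - u : ℝ) := by
  rw [hankelPath, hankelLog_of_neg hu, ← Complex.ofReal_exp, Real.exp_log (by linarith)]

theorem hankelPath_of_gt {ε u : ℝ} (hε : 0 < ε) (hu : 2 * Real.pi < u) :
    hankelPath ε u = (ε + (u - 2 * Real.pi) : ℝ) := by
  rw [hankelPath, hankelLog_of_gt hu, Complex.exp_add, Complex.exp_two_pi_mul_I, mul_one,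
    ← Complex.ofReal_exp, Real.exp_log (by linarith)]

/-- A point of the contour is a nonnegative real number or has modulus `ε`. Hence adding it to a
point of `strip η` leads at worst to `strip (η + ε)`. -/
theorem hankelPath_bounds {ε : ℝ} (hε : 0 < ε) (u : ℝ) :
    -ε ≤ (hankelPath ε u).re ∧ |(hankelPath ε u).im| ≤ ε := by
  have key : (∃ t : ℝ, 0 ≤ t ∧ hankelPath ε u = t) ∨ ‖hankelPath ε u‖ = ε := by
    rcases lt_or_ge u 0 with h | h
    · exact Or.inl ⟨ε - u, by linarith, hankelPath_of_neg hε h⟩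
    rcases lt_or_ge (2 * Real.pi) u with h' | h'
    · exact Or.inl ⟨ε + (u - 2 * Real.pi), by linarith, hankelPath_of_gt hε h'⟩
    · right
      rw [hankelPath, hankelLog]
      split_ifs with h1
      · rw [le_antisymm h1 h, sub_zero, ← Complex.ofReal_exp, Real.exp_log hε, Complex.norm_real,
          Real.norm_of_nonneg hε.le]
      · exact norm_exp_circleLog hε u
  rcases key with ⟨t, ht, e⟩ | h
  · rw [e]; simp; constructor <;> linarith
  · have h1 := Complex.abs_re_le_norm (hankelPath ε u)
    have h2 := Complex.abs_im_le_norm (hankelPath ε u)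
    rw [h] at h1 h2
    exact ⟨(abs_le.1 h1).1, h2⟩

theorem exp_mul_log {t : ℝ} (ht : 0 < t) (s : ℂ) :
    Complex.exp (s * (Real.log t : ℝ)) = (t : ℂ) ^ s := by
  rw [Complex.cpow_def_of_ne_zero (by exact_mod_cast ht.ne'), Complex.ofReal_log ht.le, mul_comm]

theorem hankelWeight_of_neg {s : ℂ} {ε u : ℝ} (hε : 0 < ε) (hu : u < 0) :
    hankelWeight s ε u = -((ε - u : ℝ) : ℂ) ^ (s - 1) := by
  have : deriv (hankelPath ε) u = -1 := by
    have h1 : hankelPath ε =ᶠ[𝓝 u] fun u => ((ε - u : ℝ) : ℂ) := by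
      filter_upwards [gt_mem_nhds hu] with v hv using hankelPath_of_neg hε hv
    rw [h1.deriv_eq]
    have := ((hasDerivAt_id u).const_sub ε).ofReal_comp
    simpa using this.deriv
  rw [hankelWeight, this, hankelLog_of_neg hu, exp_mul_log (by linarith), mul_neg_one]

theorem exp_two_pi_sub_one (s : ℂ) :
    Complex.exp ((s - 1) * (2 * Real.pi * Complex.I)) =
      Complex.exp (2 * Real.pi * Complex.I * s) := by
  rw [show (s - 1) * (2 * Real.pi * Complex.I) = 2 * Real.pi * Complex.I * s
    - 2 * Real.pi * Complex.I by ring, Complex.exp_sub, Complex.exp_two_pi_mul_I, div_one]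

theorem hankelWeight_of_gt {s : ℂ} {ε u : ℝ} (hε : 0 < ε) (hu : 2 * Real.pi < u) :
    hankelWeight s ε u = Complex.exp (2 * Real.pi * Complex.I * s) *
      ((ε + (u - 2 * Real.pi) : ℝ) : ℂ) ^ (s - 1) := by
  have : deriv (hankelPath ε) u = 1 := by
    have h1 : hankelPath ε =ᶠ[𝓝 u] fun u => ((ε + (u - 2 * Real.pi) : ℝ) : ℂ) := by
      filter_upwards [lt_mem_nhds hu] with v hv using hankelPath_of_gt hε hv
    rw [h1.deriv_eq]
    have := (((hasDerivAt_id u).sub_const (2 * Real.pi)).const_add ε).ofReal_comp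
    simpa using this.deriv
  rw [hankelWeight, this, hankelLog_of_gt hu, mul_add, Complex.exp_add, exp_mul_log (by linarith),
    exp_two_pi_sub_one, mul_one, mul_comm]

theorem hankelWeight_of_mem {s : ℂ} {ε u : ℝ} (hu : u ∈ Set.Ioo 0 (2 * Real.pi)) :
    hankelWeight s ε u = Complex.I * Complex.exp (s * circleLog ε u) := by
  have : deriv (hankelPath ε) u = Complex.I * Complex.exp (circleLog ε u) := by
    have h1 : hankelPath ε =ᶠ[𝓝 u] fun u => Complex.exp (circleLog ε u) := by
      filter_upwards [Ioo_mem_nhds hu.1 hu.2] with v hv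
      rw [hankelPath, hankelLog_of_mem hv]
    rw [h1.deriv_eq]
    have h2 : HasDerivAt (circleLog ε) Complex.I u := by
      unfold circleLog
      simpa using ((hasDerivAt_id u).ofReal_comp.mul_const Complex.I).const_add
        (Real.log ε : ℂ)
    simpa [mul_comm] using h2.cexp.deriv
  rw [hankelWeight, this, hankelLog_of_mem hu, mul_left_comm, ← Complex.exp_add]
  ring_nf

theorem integrableOn_rpow_mul_exp_Ioi {ε a : ℝ} (hε : 0 < ε) (ha : 0 < a) (σ : ℝ) :
    IntegrableOn (fun t : ℝ => Real.exp (-(a * t)) * t ^ σ) (Set.Ioi ε) := by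
  rcases lt_or_ge (-1) σ with h | h
  · have := integrableOn_rpow_mul_exp_neg_mul_rpow (p := 1) h one_pos ha
    refine (this.congr_fun (fun t _ => ?_) measurableSet_Ioi).mono_set (Set.Ioi_subset_Ioi hε.le)
    simp only [Real.rpow_one, neg_mul]
    ring
  · have h1 := (integrableOn_exp_mul_Ioi (a := -a) (by linarith) ε).const_mul (ε ^ σ)
    refine Integrable.mono' h1 ?_ ?_
    · refine ContinuousOn.aestronglyMeasurable ?_ measurableSet_Ioi
      refine ContinuousOn.mul (by fun_prop) ?_
      exact continuousOn_id.rpow_const fun t ht => Or.inl (hε.trans ht).ne'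
    · refine ae_restrict_of_forall_mem measurableSet_Ioi fun t (ht : ε < t) => ?_
      have h0 := hε.trans ht
      rw [Real.norm_of_nonneg (by positivity), mul_comm, neg_mul]
      exact mul_le_mul_of_nonneg_right (Real.rpow_le_rpow_of_nonpos hε ht.le (by linarith))
        (Real.exp_nonneg _)

/-- Integrability along the Hankel contour, from its three parts. -/
theorem integrable_of_hankel {E : Type*} [NormedAddCommGroup E] {h g₁ g₂ g₃ : ℝ → E} {ε : ℝ}
    (h1 : ∀ u < 0, h u = g₁ (ε - u)) (h2 : ∀ u ∈ Set.Ioo 0 (2 * Real.pi), h u = g₂ u)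
    (h3 : ∀ u, 2 * Real.pi < u → h u = g₃ (u + (ε - 2 * Real.pi)))
    (i1 : IntegrableOn g₁ (Set.Ioi ε)) (i2 : IntegrableOn g₂ (Set.Ioc 0 (2 * Real.pi)))
    (i3 : IntegrableOn g₃ (Set.Ioi ε)) :
    IntegrableOn h (Set.Iic 0) ∧ IntegrableOn h (Set.Ioc 0 (2 * Real.pi)) ∧
      IntegrableOn h (Set.Ioi (2 * Real.pi)) := by
  refine ⟨?_, ?_, ?_⟩
  · rw [integrableOn_Iic_iff_integrableOn_Iio]
    have := ((Measure.measurePreserving_sub_left volume ε).integrableOn_comp_preimage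
      (MeasurableEquiv.subLeft ε).measurableEmbedding).2 i1
    have e : (fun u : ℝ => ε - u) ⁻¹' Set.Ioi ε = Set.Iio 0 := by ext u; simp
    rw [e] at this
    exact this.congr_fun (fun u hu => (h1 u hu).symm) measurableSet_Iio
  · rw [integrableOn_Ioc_iff_integrableOn_Ioo] at i2 ⊢
    exact i2.congr_fun (fun u hu => (h2 u hu).symm) measurableSet_Ioo
  · have := ((measurePreserving_add_right volume (ε - 2 * Real.pi)).integrableOn_comp_preimage
      (MeasurableEquiv.addRight _).measurableEmbedding).2 i3
    have e : (fun u : ℝ => u + (ε - 2 * Real.pi)) ⁻¹' Set.Ioi ε = Set.Ioi (2 * Real.pi) := by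
      ext u; simp only [Set.mem_preimage, Set.mem_Ioi]; constructor <;> intro h <;> linarith
    rw [e] at this
    exact this.congr_fun (fun u hu => (h3 u hu).symm) measurableSet_Ioi

theorem integrable_of_three {E : Type*} [NormedAddCommGroup E] {h : ℝ → E}
    (H : IntegrableOn h (Set.Iic 0) ∧ IntegrableOn h (Set.Ioc 0 (2 * Real.pi)) ∧
      IntegrableOn h (Set.Ioi (2 * Real.pi))) : Integrable h := by
  have := (H.1.union H.2.1).union H.2.2
  rwa [Set.Iic_union_Ioc_eq_Iic Real.two_pi_pos.le, Set.Iic_union_Ioi, integrableOn_univ] at this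

/-- The three pieces are described only away from `u = 0` and `u = 2π`. The contour has corners
there, and these two points form a null set. -/
theorem integral_of_hankel {E : Type*} [NormedAddCommGroup E] [NormedSpace ℝ E]
    {h g₁ g₂ g₃ : ℝ → E} {ε : ℝ}
    (h1 : ∀ u < 0, h u = g₁ (ε - u)) (h2 : ∀ u ∈ Set.Ioo 0 (2 * Real.pi), h u = g₂ u)
    (h3 : ∀ u, 2 * Real.pi < u → h u = g₃ (u + (ε - 2 * Real.pi)))
    (i1 : IntegrableOn g₁ (Set.Ioi ε)) (i2 : IntegrableOn g₂ (Set.Ioc 0 (2 * Real.pi)))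
    (i3 : IntegrableOn g₃ (Set.Ioi ε)) :
    ∫ u, h u = (∫ t in Set.Ioi ε, g₁ t) + (∫ θ in (0 : ℝ)..(2 * Real.pi), g₂ θ) +
      ∫ t in Set.Ioi ε, g₃ t := by
  obtain ⟨H1, H2, H3⟩ := integrable_of_hankel h1 h2 h3 i1 i2 i3
  have H12 := H1.union H2
  rw [Set.Iic_union_Ioc_eq_Iic Real.two_pi_pos.le] at H12
  rw [← intervalIntegral.integral_Iic_add_Ioi H12 H3, ← Set.Iic_union_Ioc_eq_Iic Real.two_pi_pos.le,
    setIntegral_union (Set.Iic_disjoint_Ioc le_rfl) measurableSet_Ioc H1 H2]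
  congr 1
  congr 1
  · have e : (fun u : ℝ => ε - u) ⁻¹' Set.Ioi ε = Set.Iio 0 := by ext u; simp
    rw [← (Measure.measurePreserving_sub_left volume ε).setIntegral_preimage_emb
      (MeasurableEquiv.subLeft ε).measurableEmbedding g₁ (Set.Ioi ε), e, integral_Iic_eq_integral_Iio]
    exact setIntegral_congr_fun measurableSet_Iio h1
  · rw [intervalIntegral.integral_of_le Real.two_pi_pos.le, integral_Ioc_eq_integral_Ioo,
      integral_Ioc_eq_integral_Ioo]
    exact setIntegral_congr_fun measurableSet_Ioo h2
  · have e : (fun u : ℝ => u + (ε - 2 * Real.pi)) ⁻¹' Set.Ioi ε = Set.Ioi (2 * Real.pi) := by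
      ext u; simp only [Set.mem_preimage, Set.mem_Ioi]; constructor <;> intro h <;> linarith
    rw [← (measurePreserving_add_right volume (ε - 2 * Real.pi)).setIntegral_preimage_emb
      (MeasurableEquiv.addRight _).measurableEmbedding g₃ (Set.Ioi ε), e]
    exact setIntegral_congr_fun measurableSet_Ioi h3

/-- Integrability holds for every complex `s`, since the contour keeps the distance `ε` from the
singularity of `t^{s-1}`. Products of these functions dominate the integrands in several variables.
-/
theorem integrable_exp_mul_hankelWeight {ε a : ℝ} (hε : 0 < ε) (ha : 0 < a) (s : ℂ) :
    Integrable fun u => Real.exp (-(a * (hankelPath ε u).re)) * ‖hankelWeight s ε u‖ := by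
  refine integrable_of_three (integrable_of_hankel (ε := ε)
    (g₁ := fun t => Real.exp (-(a * t)) * t ^ (s - 1).re)
    (g₂ := fun θ => Real.exp (-(a * (Complex.exp (circleLog ε θ)).re)) *
      ‖Complex.I * Complex.exp (s * circleLog ε θ)‖)
    (g₃ := fun t => ‖Complex.exp (2 * Real.pi * Complex.I * s)‖ *
      (Real.exp (-(a * t)) * t ^ (s - 1).re)) ?_ ?_ ?_
    (integrableOn_rpow_mul_exp_Ioi hε ha _) ?_
    ((integrableOn_rpow_mul_exp_Ioi hε ha _).const_mul _))
  · intro u hu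
    rw [hankelPath_of_neg hε hu, hankelWeight_of_neg hε hu, norm_neg,
      Complex.norm_cpow_eq_rpow_re_of_pos (by linarith), Complex.ofReal_re]
  · intro u hu
    rw [hankelPath, hankelLog_of_mem hu, hankelWeight_of_mem hu]
  · intro u hu
    rw [hankelPath_of_gt hε hu, hankelWeight_of_gt hε hu, norm_mul,
      Complex.norm_cpow_eq_rpow_re_of_pos (by linarith), Complex.ofReal_re,
      show u + (ε - 2 * Real.pi) = ε + (u - 2 * Real.pi) by ring]
    ring
  · refine Continuous.integrableOn_Ioc ?_
    have := continuous_circleLog ε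
    fun_prop

/-! ### Hankel integrals and the operators `J^s` -/

/-- The integral of `F(x + t) t^{s-1} dt` over the Hankel contour, split into its straight and its
circular part. -/
def hankelSplit (ε : ℝ) (s : ℂ) (F : ℂ → ℂ) (x : ℂ) : ℂ :=
  (Complex.exp (2 * Real.pi * Complex.I * s) - 1) *
      (∫ t in Set.Ioi ε, F (x + t) * (t : ℂ) ^ (s - 1)) +
    Complex.I * ∫ θ in (0 : ℝ)..(2 * Real.pi),
      F (x + Complex.exp (circleLog ε θ)) * Complex.exp (s * circleLog ε θ)

section

variable {F : ℂ → ℂ} {η ε : ℝ} {x : ℂ}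

theorem add_exp_circleLog_mem (hε : 0 < ε) (hx : x ∈ strip η) (θ : ℝ) :
    x + Complex.exp (circleLog ε θ) ∈ strip (η + ε) := by
  refine closedBall_subset_strip hx ?_
  rw [mem_closedBall_iff_norm, add_sub_cancel_left, norm_exp_circleLog hε]

theorem continuous_circle_integrand (h : Decaying F) (hε : 0 < ε) (hη : η + ε < 1)
    (hx : x ∈ strip η) (s : ℂ) :
    Continuous fun θ => F (x + Complex.exp (circleLog ε θ)) * Complex.exp (s * circleLog ε θ) := by
  have h1 := continuous_circleLog ε
  refine Continuous.mul ?_ (by fun_prop)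
  exact h.diff.continuousOn.comp_continuous (by fun_prop)
    fun θ => strip_mono hη.le (add_exp_circleLog_mem hε hx θ)

theorem integrableOn_Ioi_of_pos (h : Decaying F) (hε : 0 < ε) (hη : η < 1) (hx : x ∈ strip η)
    (s : ℂ) : IntegrableOn (fun t : ℝ => F (x + t) * (t : ℂ) ^ (s - 1)) (Set.Ioi ε) := by
  obtain ⟨C, hC⟩ := h.bound η hη
  have hsub : Set.Ioi ε ⊆ Set.Ioi 0 := Set.Ioi_subset_Ioi hε.le
  refine Integrable.mono' ((integrableOn_rpow_mul_exp_Ioi hε (a := 1 / 2) (by norm_num)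
    (s.re - 1)).const_mul (2 * (|C| * Real.exp (-x.re / 2)))) ?_ ?_
  · exact ((continuousOn_shift h (strip_mono hη.le hx)).mono
      (hsub.trans Set.Ioi_subset_Ici_self)).mul ((continuousOn_cpow_Ioi _).mono hsub)
      |>.aestronglyMeasurable measurableSet_Ioi
  · refine ae_restrict_of_forall_mem measurableSet_Ioi fun t ht => ?_
    refine (norm_weyl_integrand_le hC hx le_rfl le_rfl (hsub ht)).trans (le_of_eq ?_)
    rw [show -t / 2 = -(1 / 2 * t) by ring]
    ring

theorem integral_hankel_eq (h : Decaying F) (hε : 0 < ε) (hη : η + ε < 1) (hx : x ∈ strip η)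
    (s : ℂ) : ∫ u, F (x + hankelPath ε u) * hankelWeight s ε u = hankelSplit ε s F x := by
  have i1 := integrableOn_Ioi_of_pos h hε (by linarith) hx s
  rw [integral_of_hankel (ε := ε) (g₁ := fun t : ℝ => -(F (x + t) * (t : ℂ) ^ (s - 1)))
    (g₂ := fun θ => Complex.I *
      (F (x + Complex.exp (circleLog ε θ)) * Complex.exp (s * circleLog ε θ)))
    (g₃ := fun t : ℝ => Complex.exp (2 * Real.pi * Complex.I * s) *
      (F (x + t) * (t : ℂ) ^ (s - 1))) ?_ ?_ ?_ i1.neg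
      ((continuous_circle_integrand h hε hη hx s).const_mul Complex.I).integrableOn_Ioc
      (i1.const_mul _), hankelSplit, integral_neg, intervalIntegral.integral_const_mul,
      integral_const_mul]
  · ring
  · intro u hu
    rw [hankelPath_of_neg hε hu, hankelWeight_of_neg hε hu, mul_neg]
  · intro u hu
    rw [hankelPath, hankelLog_of_mem hu, hankelWeight_of_mem hu]
    ring
  · intro u hu
    rw [hankelPath_of_gt hε hu, hankelWeight_of_gt hε hu,
      show u + (ε - 2 * Real.pi) = ε + (u - 2 * Real.pi) by ring]
    ring

theorem exp_mul_circleLog_zero (hε : 0 < ε) (s : ℂ) :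
    Complex.exp (s * circleLog ε 0) = (ε : ℂ) ^ s := by
  rw [circleLog, Complex.ofReal_zero, zero_mul, add_zero, exp_mul_log hε]

theorem exp_mul_circleLog_two_pi (hε : 0 < ε) (s : ℂ) :
    Complex.exp (s * circleLog ε (2 * Real.pi)) =
      Complex.exp (2 * Real.pi * Complex.I * s) * (ε : ℂ) ^ s := by
  rw [circleLog, mul_add, Complex.exp_add, exp_mul_log hε, mul_comm]
  congr 2
  push_cast; ring

theorem exp_circleLog_zero (hε : 0 < ε) : Complex.exp (circleLog ε 0) = ε := by
  have := exp_mul_circleLog_zero hε 1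
  rwa [one_mul, Complex.cpow_one] at this

theorem exp_circleLog_two_pi (hε : 0 < ε) : Complex.exp (circleLog ε (2 * Real.pi)) = ε := by
  have := exp_mul_circleLog_two_pi hε 1
  rwa [one_mul, Complex.cpow_one, mul_one, Complex.exp_two_pi_mul_I, one_mul] at this

/-- Integration by parts along the Hankel contour. -/
theorem hankelSplit_add_one (h : Decaying F) (hε : 0 < ε) (hη : η + ε < 1) (hx : x ∈ strip η)
    (s : ℂ) : hankelSplit ε (s + 1) (negDeriv F) x = s * hankelSplit ε s F x := by
  have hx1 := strip_mono (by linarith : η ≤ 1) hx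
  have i1 := integrableOn_Ioi_of_pos h hε (by linarith) hx s
  have i2 := integrableOn_Ioi_of_pos h.negDeriv hε (by linarith) hx (s + 1)
  have c1 := continuous_circle_integrand h hε hη hx s
  have c2 := continuous_circle_integrand h.negDeriv hε hη hx (s + 1)
  have e1 : (∫ t in Set.Ioi ε, negDeriv F (x + t) * (t : ℂ) ^ (s + 1 - 1)) =
      s * (∫ t in Set.Ioi ε, F (x + t) * (t : ℂ) ^ (s - 1)) + F (x + ε) * (ε : ℂ) ^ s := by
    have hd : ∀ t ∈ Set.Ici ε, HasDerivAt (fun t : ℝ => F (x + t) * (t : ℂ) ^ s)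
        (s * (F (x + t) * (t : ℂ) ^ (s - 1)) - negDeriv F (x + t) * (t : ℂ) ^ (s + 1 - 1)) t := by
      intro t ht
      have ht0 : 0 < t := hε.trans_le ht
      have h1 : HasDerivAt (fun t : ℝ => (t : ℂ) ^ s) (s * (t : ℂ) ^ (s - 1)) t := by
        simpa using ((hasDerivAt_id (t : ℂ)).cpow_const (c := s)
          (Or.inl (by simpa using ht0))).comp_ofReal
      refine ((h.hasDerivAt_shift hx1 ht0.le).mul h1).congr_deriv ?_
      rw [add_sub_cancel_right]; ring
    have := integral_Ioi_of_hasDerivAt_of_tendsto' hd ((i1.const_mul s).sub i2)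
      (h.tendsto_zero hx1 s)
    rw [integral_sub (i1.const_mul s) i2, integral_const_mul] at this
    linear_combination -this
  have e2 : (∫ θ in (0 : ℝ)..(2 * Real.pi), negDeriv F (x + Complex.exp (circleLog ε θ)) *
        Complex.exp ((s + 1) * circleLog ε θ)) * Complex.I =
      s * Complex.I * (∫ θ in (0 : ℝ)..(2 * Real.pi), F (x + Complex.exp (circleLog ε θ)) *
        Complex.exp (s * circleLog ε θ)) -
      (Complex.exp (2 * Real.pi * Complex.I * s) - 1) * (F (x + ε) * (ε : ℂ) ^ s) := by
    have hd : ∀ θ ∈ Set.uIcc 0 (2 * Real.pi), HasDerivAt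
        (fun θ : ℝ => F (x + Complex.exp (circleLog ε θ)) * Complex.exp (s * circleLog ε θ))
        (s * Complex.I * (F (x + Complex.exp (circleLog ε θ)) * Complex.exp (s * circleLog ε θ)) -
          Complex.I * (negDeriv F (x + Complex.exp (circleLog ε θ)) *
            Complex.exp ((s + 1) * circleLog ε θ))) θ := by
      intro θ _
      have h2 : HasDerivAt (circleLog ε) Complex.I θ := by
        unfold circleLog
        simpa using ((hasDerivAt_id θ).ofReal_comp.mul_const Complex.I).const_add
          (Real.log ε : ℂ)
      have h3 := (h.differentiableAt (strip_mono hη.le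
        (add_exp_circleLog_mem hε hx θ))).hasDerivAt.comp θ (h2.cexp.const_add x)
      refine (h3.mul (h2.const_mul s).cexp).congr_deriv ?_
      rw [add_mul, one_mul, Complex.exp_add, negDeriv, Function.comp_apply]
      ring
    have := intervalIntegral.integral_eq_sub_of_hasDerivAt hd
      (((c1.const_mul (s * Complex.I)).sub (c2.const_mul Complex.I)).intervalIntegrable _ _)
    rw [intervalIntegral.integral_sub ((c1.const_mul _).intervalIntegrable _ _)
      ((c2.const_mul _).intervalIntegrable _ _), intervalIntegral.integral_const_mul,
      intervalIntegral.integral_const_mul, exp_mul_circleLog_zero hε, exp_mul_circleLog_two_pi hε,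
      exp_circleLog_zero hε, exp_circleLog_two_pi hε] at this
    linear_combination -this
  rw [hankelSplit, hankelSplit, e1, mul_comm Complex.I, e2, mul_add (2 * Real.pi * Complex.I),
    mul_one, Complex.exp_add, Complex.exp_two_pi_mul_I]
  ring

/-- Cauchy's theorem in the coordinate `w = log t`, where the slit annulus between the two circles
becomes the rectangle `[log δ, log ε] × [0, 2π]` and no branch of the power is needed. The vertical
sides are the circles; the horizontal sides are the segment from `δ` to `ε`, taken with the factors
`1` and `e^{2πis}`. -/
theorem hankelSplit_eq_of_lt (h : Decaying F) (hε : 0 < ε) (hη : η + ε < 1) (hx : x ∈ strip η)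
    (s : ℂ) {δ : ℝ} (hδ : 0 < δ) (hδε : δ ≤ ε) : hankelSplit ε s F x = hankelSplit δ s F x := by
  have hlog : Real.log δ ≤ Real.log ε := Real.log_le_log hδ hδε
  set f : ℂ → ℂ := fun w => F (x + Complex.exp w) * Complex.exp (s * w)
  have hf : DifferentiableOn ℂ f
      ((Set.uIcc (Real.log δ : ℂ).re (Real.log ε + 2 * Real.pi * Complex.I : ℂ).re) ×ℂ
        (Set.uIcc (Real.log δ : ℂ).im (Real.log ε + 2 * Real.pi * Complex.I : ℂ).im)) := by
    intro w hw
    refine DifferentiableAt.differentiableWithinAt (DifferentiableAt.mul ?_ (by fun_prop))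
    refine DifferentiableAt.comp w (h.differentiableAt (strip_mono hη.le ?_)) (by fun_prop)
    refine closedBall_subset_strip hx ?_
    rw [mem_closedBall_iff_norm, add_sub_cancel_left, Complex.norm_exp]
    have h1 := hw.1
    simp only [Complex.ofReal_re, Complex.add_re, Complex.mul_re, Complex.re_ofNat, Complex.I_re,
      Complex.ofReal_im, mul_zero, Complex.I_im, Complex.mul_im, Complex.im_ofNat, zero_mul,
      add_zero, sub_self, mul_one, Set.mem_preimage] at h1
    rw [Set.uIcc_of_le hlog] at h1
    rw [← Real.exp_log hε]
    exact Real.exp_le_exp.2 h1.2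
  have key := Complex.integral_boundary_rect_eq_zero_of_differentiableOn f _ _ hf
  have r1 : (Real.log ε + 2 * Real.pi * Complex.I : ℂ).re = Real.log ε := by simp
  have r2 : (Real.log ε + 2 * Real.pi * Complex.I : ℂ).im = 2 * Real.pi := by simp
  rw [r1, r2, Complex.ofReal_re, Complex.ofReal_im] at key
  have cov : (∫ v in Real.log δ..Real.log ε, f v) = ∫ t in δ..ε, F (x + t) * (t : ℂ) ^ (s - 1) := by
    have := intervalIntegral.integral_deriv_smul_comp'' (a := Real.log δ) (b := Real.log ε)
      (f := Real.exp) (f' := Real.exp) (g := fun t : ℝ => F (x + t) * (t : ℂ) ^ (s - 1))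
      Real.continuous_exp.continuousOn (fun v _ => (Real.hasDerivAt_exp v).hasDerivWithinAt)
      Real.continuous_exp.continuousOn ?_
    · rw [Real.exp_log hε, Real.exp_log hδ] at this
      rw [← this]
      refine intervalIntegral.integral_congr fun v _ => ?_
      simp only [f, Function.comp_apply, Complex.real_smul, Complex.ofReal_exp]
      rw [Complex.cpow_def_of_ne_zero (Complex.exp_ne_zero _), ← Complex.ofReal_exp,
        ← Complex.ofReal_log (Real.exp_nonneg _), Real.log_exp, Complex.ofReal_exp, mul_left_comm,
        ← Complex.exp_add]
      ring_nf
    · have hsub : Real.exp '' Set.uIcc (Real.log δ) (Real.log ε) ⊆ Set.Ioi 0 := by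
        rintro _ ⟨v, _, rfl⟩; exact Real.exp_pos v
      exact ((continuousOn_shift h (strip_mono (by linarith) hx)).mono
        (hsub.trans Set.Ioi_subset_Ici_self)).mul ((continuousOn_cpow_Ioi _).mono hsub)
  have top : (∫ v in Real.log δ..Real.log ε, f (v + (2 * Real.pi : ℝ) * Complex.I)) =
      Complex.exp (2 * Real.pi * Complex.I * s) * ∫ v in Real.log δ..Real.log ε, f v := by
    rw [← intervalIntegral.integral_const_mul]
    refine intervalIntegral.integral_congr fun v _ => ?_
    simp only [f]
    rw [mul_add s, Complex.exp_add, Complex.exp_add, Complex.ofReal_mul, Complex.ofReal_ofNat,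
      Complex.exp_two_pi_mul_I, mul_one]
    ring_nf
  have bot : (∫ v in Real.log δ..Real.log ε, f (v + (0 : ℝ) * Complex.I)) =
      ∫ v in Real.log δ..Real.log ε, f v := by simp
  have i1 := integrableOn_Ioi_of_pos h hδ (by linarith) hx s
  have split : (∫ t in Set.Ioi δ, F (x + t) * (t : ℂ) ^ (s - 1)) =
      (∫ t in δ..ε, F (x + t) * (t : ℂ) ^ (s - 1)) +
        ∫ t in Set.Ioi ε, F (x + t) * (t : ℂ) ^ (s - 1) := by
    rw [intervalIntegral.integral_of_le hδε, ← setIntegral_union (Set.Ioc_disjoint_Ioi le_rfl)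
      measurableSet_Ioi (i1.mono_set Set.Ioc_subset_Ioi_self)
      (i1.mono_set (Set.Ioi_subset_Ioi hδε)), Set.Ioc_union_Ioi_eq_Ioi hδε]
  rw [top, bot, cov, smul_eq_mul, smul_eq_mul] at key
  rw [hankelSplit, hankelSplit, split]
  simp only [f] at key
  unfold circleLog
  linear_combination key

/-- For `Re s > 0` the circle of radius `δ` contributes `O(δ^{Re s})`, and the straight parts
exhaust the half line. The radii start at `(1 - η)/2` so that all circles around `x` stay inside
`strip 1`. -/
theorem tendsto_hankelSplit (h : Decaying F) (hη : η < 1) (hx : x ∈ strip η) {s : ℂ}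
    (hs : 0 < s.re) : Tendsto (fun n : ℕ => hankelSplit ((1 - η) / 2 / (n + 1)) s F x) atTop
      (𝓝 ((Complex.exp (2 * Real.pi * Complex.I * s) - 1) *
        ∫ t in Set.Ioi (0 : ℝ), F (x + t) * (t : ℂ) ^ (s - 1))) := by
  set ε := (1 - η) / 2
  have hε : 0 < ε := by simp only [ε]; linarith
  have hε1 : η + ε < 1 := by simp only [ε]; linarith
  set δ : ℕ → ℝ := fun n => ε / (n + 1)
  have hδ0 : ∀ n, 0 < δ n := fun n => by positivity
  have hδ : Tendsto δ atTop (𝓝 0) := by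
    have := tendsto_one_div_add_atTop_nhds_zero_nat (𝕜 := ℝ).const_mul ε
    simpa [δ, div_eq_mul_inv] using this
  have hanti : Antitone δ := fun a b hab => by
    simp only [δ]; gcongr
  have hU : ⋃ n, Set.Ioi (δ n) = Set.Ioi 0 := by
    ext t
    simp only [Set.mem_iUnion, Set.mem_Ioi]
    exact ⟨fun ⟨n, hn⟩ => (hδ0 n).trans hn, fun ht => (hδ.eventually_lt_const ht).exists⟩
  have hi := h.integrableOn (strip_mono hη.le hx) hs
  have t1 := tendsto_setIntegral_of_monotone (s := fun n => Set.Ioi (δ n)) (μ := volume)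
    (f := fun t : ℝ => F (x + t) * (t : ℂ) ^ (s - 1)) (fun n => measurableSet_Ioi)
    (fun a b hab => Set.Ioi_subset_Ioi (hanti hab)) (by rwa [hU])
  rw [hU] at t1
  obtain ⟨C, hC⟩ := h.bound (η + ε) hε1
  have t2 : Tendsto (fun n => Complex.I * ∫ θ in (0 : ℝ)..(2 * Real.pi),
      F (x + Complex.exp (circleLog (δ n) θ)) * Complex.exp (s * circleLog (δ n) θ))
      atTop (𝓝 0) := by
    have hlim : Tendsto (fun n => |C| * Real.exp ((η + ε) / 2) *
        (δ n ^ s.re * Real.exp (|s.im| * (2 * Real.pi))) * |2 * Real.pi - 0|) atTop (𝓝 0) := by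
      have := (hδ.rpow_const (p := s.re) (Or.inr hs.le))
      rw [Real.zero_rpow hs.ne'] at this
      simpa using ((this.mul_const (Real.exp (|s.im| * (2 * Real.pi)))).const_mul
        (|C| * Real.exp ((η + ε) / 2))).mul_const |2 * Real.pi - 0|
    refine squeeze_zero_norm (fun n => ?_) hlim
    rw [norm_mul, Complex.norm_I, one_mul]
    refine intervalIntegral.norm_integral_le_of_norm_le_const fun θ hθ => ?_
    rw [Set.uIoc_of_le Real.two_pi_pos.le] at hθ
    have hδε : δ n ≤ ε := div_le_self hε.le (by linarith [n.cast_nonneg (α := ℝ)])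
    have hm := strip_mono (by linarith : η + δ n ≤ η + ε) (add_exp_circleLog_mem (hδ0 n) hx θ)
    rw [norm_mul]
    refine mul_le_mul ?_ ?_ (norm_nonneg _) (by positivity)
    · refine (hC _ hm).trans (mul_le_mul (le_abs_self C) (Real.exp_le_exp.2 ?_) (Real.exp_nonneg _)
        (abs_nonneg _))
      linarith [hm.1]
    · rw [Complex.norm_exp, circleLog, Real.rpow_def_of_pos (hδ0 n), ← Real.exp_add]
      refine Real.exp_le_exp.2 ?_
      have h1 : -s.im * θ ≤ |s.im| * (2 * Real.pi) := by
        refine mul_le_mul (neg_le_abs _) hθ.2 hθ.1.le (abs_nonneg _)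
      simp
      linarith
  have := (t1.const_mul (Complex.exp (2 * Real.pi * Complex.I * s) - 1)).add t2
  rw [add_zero] at this
  exact this

theorem hankelSplit_eq_weyl_of_re_pos (h : Decaying F) (hε : 0 < ε) (hη : η + ε < 1)
    (hx : x ∈ strip η) {s : ℂ} (hs : 0 < s.re) : hankelSplit ε s F x =
      (Complex.exp (2 * Real.pi * Complex.I * s) - 1) * Complex.Gamma s * weyl s F x := by
  have hη1 : η < 1 := by linarith
  have h1 := tendsto_hankelSplit h hη1 hx hs
  have hlim : Tendsto (fun n : ℕ => (1 - η) / 2 / ((n : ℝ) + 1)) atTop (𝓝 0) := by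
    have := tendsto_one_div_add_atTop_nhds_zero_nat (𝕜 := ℝ).const_mul ((1 - η) / 2)
    simpa [div_eq_mul_inv] using this
  have h2 : Tendsto (fun n : ℕ => hankelSplit ((1 - η) / 2 / (n + 1)) s F x) atTop
      (𝓝 (hankelSplit ε s F x)) := by
    refine tendsto_const_nhds.congr' ?_
    filter_upwards [hlim.eventually_lt_const hε] with n hn
    exact hankelSplit_eq_of_lt h hε hη hx s (by
      have : 0 < 1 - η := by linarith
      positivity) hn.le
  rw [tendsto_nhds_unique h2 h1]
  have h3 := weyl_eq h (s := s) (n := 0) (by simpa using hs) (strip_mono hη1.le hx)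
  rw [h3, Nat.cast_zero, add_zero, Function.iterate_zero_apply, weylBase]
  have := Complex.Gamma_ne_zero_of_re_pos hs
  field_simp

/-- Integration by parts moves `s` to `s + 1` until the real part is positive. Both sides obey the
same recursion because `e^{2πis}` has period `1`, `Γ(s + 1) = s Γ(s)` and `J^{s+1} D = J^s`; the
factor `s` can be cancelled since `s` is not an integer. -/
theorem hankelSplit_eq_weyl (hε : 0 < ε) (hη : η + ε < 1) (hx : x ∈ strip η) (n : ℕ) :
    ∀ {s : ℂ} {F : ℂ → ℂ}, Decaying F → (∀ m : ℤ, s ≠ m) → 0 < s.re + n → hankelSplit ε s F x =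
      (Complex.exp (2 * Real.pi * Complex.I * s) - 1) * Complex.Gamma s * weyl s F x := by
  induction n with
  | zero =>
    intro s F h _ hs
    exact hankelSplit_eq_weyl_of_re_pos h hε hη hx (by simpa using hs)
  | succ n ih =>
    intro s F h hs hn
    have hs0 : s ≠ 0 := by simpa using hs 0
    refine mul_left_cancel₀ hs0 ?_
    rw [← hankelSplit_add_one h hε hη hx s, ih h.negDeriv (fun m e => hs (m - 1) ?_) ?_,
      Complex.Gamma_add_one s hs0, weyl_negDeriv h (s + 1) (strip_mono (by linarith) hx),
      add_sub_cancel_right, mul_add, mul_one, Complex.exp_add, Complex.exp_two_pi_mul_I, mul_one]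
    · ring
    · push_cast at hn; simp; linarith
    · push_cast; rw [← e]; ring

/-- The Hankel integral computes `J^s`. -/
theorem integral_hankel (h : Decaying F) (hε : 0 < ε) (hη : η + ε < 1) (hx : x ∈ strip η) {s : ℂ}
    (hs : ∀ m : ℤ, s ≠ m) : ∫ u, F (x + hankelPath ε u) * hankelWeight s ε u =
      (Complex.exp (2 * Real.pi * Complex.I * s) - 1) * Complex.Gamma s * weyl s F x := by
  obtain ⟨n, hn⟩ := exists_nat_gt (-s.re)
  rw [integral_hankel_eq h hε hη hx s, hankelSplit_eq_weyl hε hη hx n h hs (by linarith)]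

end

/-! ### The function `d/dz (z / (exp z - 1))` -/

/-- The function `z / (exp z - 1)`. -/
def bern (z : ℂ) : ℂ := (dslope Complex.exp 0 z)⁻¹

/-- The derivative of `z / (exp z - 1)`. -/
def desG : ℂ → ℂ := deriv bern

theorem bern_of_ne {z : ℂ} (hz : z ≠ 0) : bern z = z / (Complex.exp z - 1) := by
  rw [bern, dslope_of_ne _ hz, slope_def_field, inv_div, Complex.exp_zero, sub_zero]

theorem exp_sub_one_ne_zero {z : ℂ} (hz : |z.im| < 2 * Real.pi) (h0 : z ≠ 0) :
    Complex.exp z - 1 ≠ 0 := by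
  intro h
  obtain ⟨n, hn⟩ := Complex.exp_eq_one_iff.1 (sub_eq_zero.1 h)
  have hi : z.im = n * (2 * Real.pi) := by rw [hn]; simp
  rw [hi, abs_mul, abs_of_pos Real.two_pi_pos] at hz
  have hn1 : |(n : ℝ)| < 1 := by
    by_contra hc
    nlinarith [Real.two_pi_pos]
  have : n = 0 := by
    rw [← Int.abs_lt_one_iff]
    exact_mod_cast hn1
  exact h0 (by rw [hn, this]; simp)

theorem abs_im_lt_two_pi {z : ℂ} (hz : z ∈ strip 1) : |z.im| < 2 * Real.pi := by
  linarith [hz.2, Real.pi_gt_three]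

theorem differentiableAt_bern {z : ℂ} (hz : z ∈ strip 1) : DifferentiableAt ℂ bern z := by
  have h1 : DifferentiableOn ℂ (dslope Complex.exp 0) Set.univ :=
    (Complex.differentiableOn_dslope univ_mem).2 Complex.differentiable_exp.differentiableOn
  refine (h1.differentiableAt univ_mem).inv ?_
  rcases eq_or_ne z 0 with rfl | h0
  · simp [dslope_same]
  · rw [dslope_of_ne _ h0, slope_def_field, Complex.exp_zero, sub_zero]
    exact div_ne_zero (exp_sub_one_ne_zero (abs_im_lt_two_pi hz) h0) h0

/-- The linear numerator is absorbed by half of the decay: `|z| ≤ Re z + 1 ≤ 2 exp(Re z / 2)`, while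
`|exp z - 1| ≥ exp(Re z) / 2` for `Re z ≥ 1`. -/
theorem norm_bern_le {z : ℂ} (hz : z ∈ strip 1) (h1 : 1 ≤ z.re) :
    ‖bern z‖ ≤ 4 * Real.exp (-z.re / 2) := by
  have h0 : z ≠ 0 := fun e => by simp [e] at h1; linarith
  have hn : ‖z‖ ≤ z.re + 1 := by
    have := Complex.norm_le_abs_re_add_abs_im z
    rw [abs_of_pos (by linarith)] at this
    linarith [hz.2]
  have he : Real.exp z.re / 2 ≤ ‖Complex.exp z - 1‖ := by
    have h2 := norm_sub_norm_le (Complex.exp z) 1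
    rw [Complex.norm_exp, norm_one] at h2
    have h3 := Real.add_one_le_exp z.re
    linarith
  have h4 := Real.add_one_le_exp (z.re / 2)
  rw [bern_of_ne h0, norm_div, div_le_iff₀ (lt_of_lt_of_le (by positivity) he)]
  have h5 : Real.exp (-z.re / 2) * Real.exp z.re = Real.exp (z.re / 2) := by
    rw [← Real.exp_add]; ring_nf
  calc ‖z‖ ≤ 2 * Real.exp (z.re / 2) := by linarith
    _ = 4 * Real.exp (-z.re / 2) * (Real.exp z.re / 2) := by rw [← h5]; ring
    _ ≤ _ := by gcongr

theorem decaying_bern : Decaying bern := by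
  refine ⟨fun z hz => (differentiableAt_bern hz).differentiableWithinAt, fun η hη => ?_⟩
  -- To the left of `Re z = 1` the half strip lies in a compact rectangle inside `strip 1`, where
  -- continuity gives the bound.
  have hc : IsCompact (Set.Icc (-η) 1 ×ℂ Set.Icc (-η) η) := isCompact_Icc.reProdIm isCompact_Icc
  have hsub : Set.Icc (-η) 1 ×ℂ Set.Icc (-η) η ⊆ strip 1 := fun z hz =>
    ⟨by linarith [hz.1.1], (abs_le.2 hz.2).trans_lt hη⟩
  obtain ⟨C, hC⟩ := hc.exists_bound_of_continuousOn (f := bern) fun z hz =>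
    (differentiableAt_bern (hsub hz)).continuousAt.continuousWithinAt
  refine ⟨max 4 (|C| * Real.exp (1 / 2)), fun z hz => ?_⟩
  rcases le_total 1 z.re with h | h
  · exact (norm_bern_le (strip_mono hη.le hz) h).trans
      (mul_le_mul_of_nonneg_right (le_max_left _ _) (Real.exp_nonneg _))
  · calc ‖bern z‖ ≤ |C| * 1 :=
          (hC z ⟨⟨hz.1.le, h⟩, abs_le.1 hz.2.le⟩).trans (by simpa using le_abs_self C)
      _ ≤ |C| * Real.exp (1 / 2 + -z.re / 2) := by
          gcongr
          exact Real.one_le_exp (by linarith)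
      _ = |C| * Real.exp (1 / 2) * Real.exp (-z.re / 2) := by rw [Real.exp_add]; ring
      _ ≤ _ := mul_le_mul_of_nonneg_right (le_max_right _ _) (Real.exp_nonneg _)

theorem decaying_desG : Decaying desG := by
  have := decaying_bern.negDeriv.neg
  convert this using 1
  funext z
  simp [negDeriv, desG]

theorem hasDerivAt_bern {z : ℂ} (hz : z ∈ strip 1) : HasDerivAt bern (desG z) z :=
  (differentiableAt_bern hz).hasDerivAt

theorem desG_of_ne {z : ℂ} (hz : z ∈ strip 1) (h0 : z ≠ 0) :
    desG z = 1 / (Complex.exp z - 1) - z * Complex.exp z / (Complex.exp z - 1) ^ 2 := by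
  have h1 := exp_sub_one_ne_zero (abs_im_lt_two_pi hz) h0
  have h2 : bern =ᶠ[𝓝 z] fun w => w / (Complex.exp w - 1) := by
    filter_upwards [isOpen_ne.mem_nhds h0] with w hw using bern_of_ne hw
  have h3 : HasDerivAt (fun w => w / (Complex.exp w - 1))
      ((1 * (Complex.exp z - 1) - z * Complex.exp z) / (Complex.exp z - 1) ^ 2) z :=
    (hasDerivAt_id' z).fun_div ((Complex.hasDerivAt_exp z).sub_const 1) h1
  rw [desG, h2.deriv_eq, h3.deriv]
  field_simp

theorem measurable_desG : Measurable desG := measurable_deriv _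

/-- A factor of the integrand of the desingularized multiple zeta function. -/
def genFactor (c : ℝ) (T : ℂ) : ℂ :=
  1 / (Complex.exp T - 1) - c / (Complex.exp (c * T) - 1)

theorem smul_mem_strip {T : ℂ} {η c : ℝ} (hT : T ∈ strip η) (hc : 0 < c) (hc2 : c ≤ 2) :
    (c : ℂ) * T ∈ strip (2 * η) := by
  obtain ⟨h1, h2⟩ := hT
  have h0 := (abs_nonneg T.im).trans_lt h2
  constructor
  · rw [Complex.re_ofReal_mul]; nlinarith
  · rw [Complex.im_ofReal_mul, abs_mul, abs_of_pos hc]; nlinarith [abs_nonneg T.im]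

theorem genFactor_eq {T : ℂ} {c : ℝ} (hc : 0 < c) (hT : T ≠ 0) :
    genFactor c T = (bern T - bern (c * T)) / T := by
  have hc' : (c : ℂ) ≠ 0 := by exact_mod_cast hc.ne'
  rw [genFactor, bern_of_ne hT, bern_of_ne (mul_ne_zero hc' hT)]
  field_simp

/-- Since `T` times the factor equals `bern T - bern (c T)`, the mean value inequality for `θ ↦ bern
(θ T)` produces `|1 - c|`, which later cancels `1/(1 - c)`. The strip of width `1/4` keeps `θ T` in
`strip (1/2)` for `θ ≤ 2`, and `θ ≥ 1/2` halves the rate of decay. -/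
theorem exists_norm_genFactor_le : ∃ C : ℝ, 0 ≤ C ∧ ∀ c ∈ Set.Ioo (1 / 2 : ℝ) 2,
    ∀ T ∈ strip (1 / 4), ‖genFactor c T‖ ≤ C * Real.exp (-T.re / 4) * |1 - c| := by
  obtain ⟨C, hC⟩ := decaying_desG.bound (1 / 2) (by norm_num)
  refine ⟨|C| * Real.exp (1 / 2), by positivity, fun c hc T hT => ?_⟩
  rcases eq_or_ne T 0 with rfl | h0
  -- At `T = 0` both fractions have denominator `0`, so the factor takes the default value `0`.
  · simp only [genFactor, Complex.exp_zero, sub_self, div_zero, mul_zero, norm_zero]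
    positivity
  have hc0 : 0 < c := by linarith [hc.1]
  rw [genFactor_eq hc0 h0, norm_div, div_le_iff₀ (norm_pos_iff.2 h0)]
  have key : ∀ θ ∈ Set.Icc (1 / 2 : ℝ) 2, (θ : ℂ) * T ∈ strip (1 / 2) ∧
      ‖desG (θ * T) * T‖ ≤ |C| * Real.exp (1 / 2) * Real.exp (-T.re / 4) * ‖T‖ := by
    intro θ hθ
    have hm : (θ : ℂ) * T ∈ strip (1 / 2) := by
      have := smul_mem_strip hT (by linarith [hθ.1] : 0 < θ) hθ.2
      norm_num at this
      exact this
    refine ⟨hm, ?_⟩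
    rw [norm_mul]
    refine mul_le_mul_of_nonneg_right ?_ (norm_nonneg _)
    rw [mul_assoc, ← Real.exp_add]
    refine (hC _ hm).trans (mul_le_mul (le_abs_self C) (Real.exp_le_exp.2 ?_) (Real.exp_nonneg _)
      (abs_nonneg _))
    rw [Complex.re_ofReal_mul]
    have h1 := hT.1
    rcases le_total 0 T.re with h | h
    · nlinarith [hθ.1]
    · nlinarith [hθ.2]
  have hd : ∀ θ ∈ Set.Icc (1 / 2 : ℝ) 2, HasDerivWithinAt (fun θ : ℝ => bern (θ * T))
      (desG (θ * T) * T) (Set.Icc (1 / 2 : ℝ) 2) θ := by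
    intro θ hθ
    have h1 := hasDerivAt_bern (strip_mono (by norm_num) (key θ hθ).1)
    have h2 : HasDerivAt (fun θ : ℝ => (θ : ℂ) * T) T θ := by
      simpa using (hasDerivAt_id θ).ofReal_comp.mul_const T
    exact (h1.comp θ h2).hasDerivWithinAt
  have := (convex_Icc (1 / 2 : ℝ) 2).norm_image_sub_le_of_norm_hasDerivWithin_le hd
    (fun θ hθ => (key θ hθ).2) (Set.Ioo_subset_Icc_self hc)
    (show (1 : ℝ) ∈ Set.Icc (1 / 2 : ℝ) 2 by norm_num)
  rw [Complex.ofReal_one, one_mul, Real.norm_eq_abs] at this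
  linarith

/-- The quotient is the slope of `c ↦ bern (c T)` at `1`, divided by `T`. At `T = 0` the claim would
fail: the factor is `0` by default, whereas `desG 0 = -1/2`. -/
theorem tendsto_genFactor {T : ℂ} (hT : T ∈ strip 1) (h0 : T ≠ 0) :
    Tendsto (fun c : ℝ => 1 / (1 - (c : ℂ)) * genFactor c T) (𝓝[≠] 1) (𝓝 (desG T)) := by
  have h1 : HasDerivAt (fun c : ℝ => bern (c * T)) (desG T * T) 1 := by
    have h2 : HasDerivAt (fun θ : ℝ => (θ : ℂ) * T) T 1 := by
      simpa using (hasDerivAt_id (1 : ℝ)).ofReal_comp.mul_const T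
    have h3 : HasDerivAt bern (desG T) (((1 : ℝ) : ℂ) * T) := by
      simpa using hasDerivAt_bern hT
    exact HasDerivAt.comp (h₂ := bern) (h := fun θ : ℝ => (θ : ℂ) * T) 1 h3 h2
  have h2 := (hasDerivAt_iff_tendsto_slope.1 h1).div_const T
  rw [mul_div_cancel_right₀ _ h0] at h2
  refine h2.congr' ?_
  filter_upwards [self_mem_nhdsWithin, nhdsWithin_le_nhds (lt_mem_nhds one_pos)] with c hc hc0
  have hc1 : (c : ℂ) - 1 ≠ 0 := by
    rw [sub_ne_zero]; exact_mod_cast hc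
  have hc2 : 1 - (c : ℂ) ≠ 0 := by rw [← neg_sub]; exact neg_ne_zero.2 hc1
  rw [genFactor_eq hc0 h0, slope_def_module, Complex.real_smul]
  push_cast
  rw [one_mul]
  field_simp
  ring

/-! ### The iterated operators -/

/-- The function `J^{sᵣ}[G J^{sᵣ₋₁}[G ⋯ J^{s₁}[G] ⋯ ]]` for complex exponents. -/
def desRec : (r : ℕ) → (Fin r → ℂ) → ℂ → ℂ
  | 0, _ => 1
  | r + 1, s => weyl (s (Fin.last r)) (desG * desRec r fun i => s i.castSucc)

/-- The factor `desG` in front is needed in the induction, because `desRec` in depth `0` is the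
constant `1`, which does not decay. -/
theorem decayingFamilyAt_desRec {P : Type*} [NormedAddCommGroup P] [NormedSpace ℂ P]
    [FiniteDimensional ℂ P] (r : ℕ) : ∀ {σ : P → Fin r → ℂ}, Differentiable ℂ σ → ∀ p₀ : P,
    DecayingFamilyAt (fun p => desG * desRec r (σ p)) p₀ := by
  induction r with
  | zero =>
    intro σ _ p₀
    simpa only [desRec, mul_one] using decaying_desG.family p₀
  | succ r ih =>
    intro σ hσ p₀
    have h := ih (σ := fun p i => σ p i.castSucc)
      (differentiable_pi.2 fun i => differentiable_pi.1 hσ i.castSucc) p₀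
    exact (decaying_desG.family p₀).mul (h.weyl (differentiable_pi.1 hσ (Fin.last r)))

theorem decaying_desG_mul_desRec (r : ℕ) (s : Fin r → ℂ) : Decaying (desG * desRec r s) :=
  (decayingFamilyAt_desRec (P := ℂ) r (differentiable_const s) 0).decaying

theorem differentiable_desRec (r : ℕ) : Differentiable ℂ fun s : Fin r → ℂ => desRec r s 0 := by
  cases r with
  | zero => exact differentiable_const _
  | succ r =>
    intro s
    have h := (decayingFamilyAt_desRec r (σ := fun (p : Fin (r + 1) → ℂ) i => p i.castSucc)
      (by fun_prop) s).weyl (σ := fun p => p (Fin.last r)) (by fun_prop)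
    obtain ⟨U, -, hs, hd, -⟩ := h
    exact DifferentiableAt.comp (f := fun p : Fin (r + 1) → ℂ => (p, (0 : ℂ))) s
      (hd s hs 0 (zero_mem_strip one_pos))
      (by fun_prop)

/-! ### Hankel integrals in several variables -/

/-- The sum `tⱼ + ⋯ + tᵣ` of points of the Hankel contour. -/
def tailSum {r : ℕ} (ε : ℝ) (u : Fin r → ℝ) (j : Fin r) : ℂ :=
  ∑ k ∈ Finset.Ici j, hankelPath ε (u k)

theorem measurable_tailSum {r : ℕ} (ε : ℝ) (j : Fin r) :
    Measurable fun u : Fin r → ℝ => tailSum ε u j :=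
  Finset.measurable_sum _ fun k _ => (measurable_hankelPath ε).comp (measurable_pi_apply k)

theorem tailSum_eq_add {r : ℕ} (ε : ℝ) (u : Fin r → ℝ) (j : Fin r) :
    tailSum ε u j = hankelPath ε (u j) + ∑ k ∈ Finset.Ioi j, hankelPath ε (u k) := by
  rw [tailSum, ← Finset.Ioi_insert, Finset.sum_insert Finset.notMem_Ioi_self]

theorem sum_re_ge {r : ℕ} {ε : ℝ} (hε : 0 < ε) (u : Fin r → ℝ) (S : Finset (Fin r)) :
    -(r * ε) ≤ (∑ k ∈ S, hankelPath ε (u k)).re := by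
  rw [Complex.re_sum]
  have h1 := Finset.sum_le_sum fun k (_ : k ∈ S) => (hankelPath_bounds hε (u k)).1
  have h2 : (S.card : ℝ) ≤ r := by
    exact_mod_cast (Finset.card_le_univ S).trans_eq (Fintype.card_fin r)
  rw [Finset.sum_const, nsmul_eq_mul] at h1
  nlinarith

theorem sum_im_le {r : ℕ} {ε : ℝ} (hε : 0 < ε) (u : Fin r → ℝ) (S : Finset (Fin r)) :
    |(∑ k ∈ S, hankelPath ε (u k)).im| ≤ r * ε := by
  rw [Complex.im_sum]
  have h1 := (Finset.abs_sum_le_sum_abs _ _).trans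
    (Finset.sum_le_sum fun k (_ : k ∈ S) => (hankelPath_bounds hε (u k)).2)
  have h2 : (S.card : ℝ) ≤ r := by
    exact_mod_cast (Finset.card_le_univ S).trans_eq (Fintype.card_fin r)
  rw [Finset.sum_const, nsmul_eq_mul] at h1
  nlinarith

theorem add_tailSum_mem {r : ℕ} {ε η : ℝ} (hε : 0 < ε) {x : ℂ} (hx : x ∈ strip η)
    (u : Fin r → ℝ) (j : Fin r) : x + tailSum ε u j ∈ strip (η + r * ε) :=
  add_mem_strip hx (sum_re_ge hε u _) (sum_im_le hε u _)

theorem tailSum_mem {r : ℕ} {ε η : ℝ} (hε : 0 < ε) (hη : r * ε < η) (u : Fin r → ℝ) (j : Fin r) :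
    tailSum ε u j ∈ strip η :=
  ⟨by linarith [sum_re_ge hε u (Finset.Ici j), show (tailSum ε u j).re =
    (∑ k ∈ Finset.Ici j, hankelPath ε (u k)).re from rfl], (sum_im_le hε u _).trans_lt hη⟩

/-- The other terms of the sum lower the real part by at most `r ε`. Decay in `tⱼ + ⋯ + tᵣ`
therefore implies decay in `tⱼ` alone, which makes a product of one-variable functions available as
a dominating function. -/
theorem le_re_tailSum {r : ℕ} {ε : ℝ} (hε : 0 < ε) (u : Fin r → ℝ) (j : Fin r) :
    (hankelPath ε (u j)).re - r * ε ≤ (tailSum ε u j).re := by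
  rw [tailSum_eq_add, Complex.add_re]
  linarith [sum_re_ge hε u (Finset.Ioi j)]

/-- A dominating function for integrals over products of Hankel contours. -/
def hankelBound {r : ℕ} (s : Fin r → ℂ) (ε a C : ℝ) (u : Fin r → ℝ) : ℝ :=
  ∏ k, C * (Real.exp (-(a * (hankelPath ε (u k)).re)) * ‖hankelWeight (s k) ε (u k)‖)

theorem integrable_hankelBound {r : ℕ} (s : Fin r → ℂ) {ε a : ℝ} (hε : 0 < ε) (ha : 0 < a)
    (C : ℝ) : Integrable (hankelBound s ε a C) :=
  Integrable.fintype_prod (f := fun k v =>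
    C * (Real.exp (-(a * (hankelPath ε v).re)) * ‖hankelWeight (s k) ε v‖))
    fun k => (integrable_exp_mul_hankelWeight hε ha (s k)).const_mul C

theorem norm_prod_mul_le_hankelBound {r : ℕ} (s : Fin r → ℂ) {ε a C : ℝ} {u : Fin r → ℝ}
    {Φ : Fin r → ℂ} (h : ∀ j, ‖Φ j‖ ≤ C * Real.exp (-(a * (hankelPath ε (u j)).re))) :
    ‖(∏ j, Φ j) * ∏ k, hankelWeight (s k) ε (u k)‖ ≤ hankelBound s ε a C u := by
  rw [← Finset.prod_mul_distrib, norm_prod]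
  refine Finset.prod_le_prod (fun k _ => norm_nonneg _) fun k _ => ?_
  rw [norm_mul, ← mul_assoc]
  exact mul_le_mul_of_nonneg_right (h k) (norm_nonneg _)

theorem measurable_prod_hankelWeight {r : ℕ} (s : Fin r → ℂ) (ε : ℝ) :
    Measurable fun u : Fin r → ℝ => ∏ k, hankelWeight (s k) ε (u k) :=
  Finset.measurable_prod _ fun k _ => (measurable_hankelWeight (s k) ε).comp (measurable_pi_apply k)

/-- The integrand that is obtained in the limit `c → 1`. -/
def limIntegrand (r : ℕ) (s : Fin r → ℂ) (ε : ℝ) (x : ℂ) (u : Fin r → ℝ) : ℂ :=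
  (∏ j, desG (x + tailSum ε u j)) * ∏ k, hankelWeight (s k) ε (u k)

theorem integrable_limIntegrand {r : ℕ} (s : Fin r → ℂ) {ε η : ℝ} (hε : 0 < ε)
    (hη : η + r * ε < 1) {x : ℂ} (hx : x ∈ strip η) : Integrable (limIntegrand r s ε x) := by
  obtain ⟨C, hC⟩ := decaying_desG.bound _ hη
  refine Integrable.mono' (integrable_hankelBound s hε (a := 1 / 2) (by norm_num)
    (|C| * Real.exp ((η + r * ε) / 2))) ?_ (Eventually.of_forall fun u =>
      norm_prod_mul_le_hankelBound s fun j => ?_)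
  · refine (Measurable.mul (Finset.measurable_prod _ fun j _ => measurable_desG.comp
      ((measurable_tailSum ε j).const_add x)) (measurable_prod_hankelWeight s ε)).aestronglyMeasurable
  · refine (hC _ (add_tailSum_mem hε hx u j)).trans ?_
    rw [mul_assoc, ← Real.exp_add]
    refine mul_le_mul (le_abs_self C) (Real.exp_le_exp.2 ?_) (Real.exp_nonneg _) (abs_nonneg _)
    rw [Complex.add_re]
    linarith [le_re_tailSum hε u j, hx.1]

theorem tailSum_snoc_castSucc {r : ℕ} (ε : ℝ) (u : Fin r → ℝ) (v : ℝ) (j : Fin r) :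
    tailSum ε (Fin.snoc u v : Fin (r + 1) → ℝ) j.castSucc = tailSum ε u j + hankelPath ε v := by
  have h : ∀ (m : ℕ) (w : Fin m → ℝ) (i : Fin m),
      tailSum ε w i = ∑ k, if i ≤ k then hankelPath ε (w k) else 0 := by
    intro m w i
    rw [tailSum, ← Finset.sum_filter]
    congr 1
    ext k; simp
  rw [h, h, Fin.sum_univ_castSucc]
  simp [Fin.snoc_castSucc, Fin.snoc_last, Fin.le_last]

theorem tailSum_snoc_last {r : ℕ} (ε : ℝ) (u : Fin r → ℝ) (v : ℝ) :
    tailSum ε (Fin.snoc u v : Fin (r + 1) → ℝ) (Fin.last r) = hankelPath ε v := by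
  rw [tailSum, ← Fin.top_eq_last, Finset.Ici_top, Finset.sum_singleton, Fin.top_eq_last,
    Fin.snoc_last]

/-- The last variable occurs in every tail sum. Fixing it only moves the base point of the integrand
in the remaining variables, which is the reason for carrying the base point `x`. -/
theorem limIntegrand_snoc {r : ℕ} (s : Fin (r + 1) → ℂ) (ε : ℝ) (x : ℂ) (u : Fin r → ℝ) (v : ℝ) :
    limIntegrand (r + 1) s ε x (Fin.snoc u v : Fin (r + 1) → ℝ) =
      desG (x + hankelPath ε v) * hankelWeight (s (Fin.last r)) ε v *
        limIntegrand r (fun i => s i.castSucc) ε (x + hankelPath ε v) u := by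
  simp only [limIntegrand, Fin.prod_univ_castSucc, tailSum_snoc_castSucc, tailSum_snoc_last,
    Fin.snoc_castSucc, Fin.snoc_last]
  simp only [add_comm (tailSum _ _ _), add_assoc]
  ring

/-- Fubini with the last variable outside: the inner integral is the case of depth `r` at the base
point `x + t`, and the outer one is a Hankel integral that applies `J^{sᵣ₊₁}`. The condition on `η`
is preserved, since each step trades one `ε` of the budget for a base point in `strip (η + ε)`. -/
theorem integral_limIntegrand (r : ℕ) : ∀ (s : Fin r → ℂ) (_ : ∀ k, ∀ n : ℤ, s k ≠ n) {ε η : ℝ}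
    (_ : 0 < ε) (_ : η + r * ε < 1) {x : ℂ} (_ : x ∈ strip η), ∫ u, limIntegrand r s ε x u =
      (∏ k, (Complex.exp (2 * Real.pi * Complex.I * s k) - 1) * Complex.Gamma (s k)) *
        desRec r s x := by
  induction r with
  | zero =>
    intro s _ ε η _ _ x _
    simp [limIntegrand, desRec, volume_pi, Measure.real]
  | succ r ih =>
    intro s hs ε η hε hη x hx
    push_cast at hη
    have hr : 0 ≤ r * ε := by positivity
    have hmp := (volume_preserving_piFinSuccAbove (fun _ : Fin (r + 1) => ℝ) (Fin.last r)).symm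
    have hint := integrable_limIntegrand s hε (by push_cast; exact hη) hx
    rw [← hmp.integral_comp' (limIntegrand (r + 1) s ε x)]
    have hint' : Integrable (fun q : ℝ × (Fin r → ℝ) => limIntegrand (r + 1) s ε x
        ((MeasurableEquiv.piFinSuccAbove (fun _ : Fin (r + 1) => ℝ) (Fin.last r)).symm q))
        (volume.prod volume) :=
      (hmp.integrable_comp_emb (MeasurableEquiv.measurableEmbedding _)).2 hint
    rw [Measure.volume_eq_prod, integral_prod _ hint']
    have hsn : ∀ (v : ℝ) (u : Fin r → ℝ), (MeasurableEquiv.piFinSuccAbove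
        (fun _ : Fin (r + 1) => ℝ) (Fin.last r)).symm (v, u) = (Fin.snoc u v : Fin (r + 1) → ℝ) :=
      fun v u => Fin.insertNth_last' v u
    have hinner : ∀ v : ℝ, ∫ u : Fin r → ℝ, limIntegrand (r + 1) s ε x
        ((MeasurableEquiv.piFinSuccAbove (fun _ : Fin (r + 1) => ℝ) (Fin.last r)).symm (v, u)) =
        (∏ k : Fin r, (Complex.exp (2 * Real.pi * Complex.I * s k.castSucc) - 1) *
          Complex.Gamma (s k.castSucc)) *
        ((desG * desRec r fun i => s i.castSucc) (x + hankelPath ε v) *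
          hankelWeight (s (Fin.last r)) ε v) := by
      intro v
      have hb := hankelPath_bounds hε v
      simp only [hsn, limIntegrand_snoc]
      rw [integral_const_mul, ih (fun i => s i.castSucc) (fun k => hs k.castSucc) hε
        (show (η + ε) + r * ε < 1 by linarith) (add_mem_strip hx hb.1 hb.2), Pi.mul_apply]
      ring
    simp only [hinner]
    rw [integral_const_mul, integral_hankel (decaying_desG_mul_desRec r _) hε (by linarith) hx
      (hs (Fin.last r)), Fin.prod_univ_castSucc]
    simp only [desRec]
    ring

/-! ### The contour meets the poles in a null set -/

/-- The contour runs through the ray twice, but its logarithm does not: the imaginary part tells the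
pieces apart, and the real part gives the position on the ray. -/
theorem hankelLog_injective {ε : ℝ} (hε : 0 < ε) : Function.Injective (hankelLog ε) := by
  have key : ∀ u, (u ≤ 0 ∧ (hankelLog ε u).im = 0 ∧ Real.exp (hankelLog ε u).re = ε - u) ∨
      (0 < u ∧ u ≤ 2 * Real.pi ∧ (hankelLog ε u).im = u ∧ Real.exp (hankelLog ε u).re = ε) ∨
      (2 * Real.pi < u ∧ (hankelLog ε u).im = 2 * Real.pi ∧
        Real.exp (hankelLog ε u).re = ε + (u - 2 * Real.pi)) := by
    intro u
    rw [hankelLog]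
    split_ifs with h1 h2
    · left; simp [h1, Real.exp_log (by linarith : 0 < ε - u)]
    · right; left; simp [not_le.1 h1, h2, Real.exp_log hε]
    · right; right
      simp [not_le.1 h2, Real.exp_log (by linarith [not_le.1 h2] : 0 < ε + (u - 2 * Real.pi))]
  intro u v huv
  have h1 := key u
  have h2 := key v
  rw [huv] at h1
  have := Real.two_pi_pos
  rcases h1 with ⟨a1, a2, a3⟩ | ⟨a0, a1, a2, a3⟩ | ⟨a1, a2, a3⟩ <;>
  rcases h2 with ⟨b1, b2, b3⟩ | ⟨b0, b1, b2, b3⟩ | ⟨b1, b2, b3⟩ <;> linarith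

theorem countable_hankelPath_eq {ε : ℝ} (hε : 0 < ε) (w : ℂ) :
    {u : ℝ | hankelPath ε u = w}.Countable := by
  have h : {z : ℂ | Complex.exp z = w}.Countable := by
    rcases Set.eq_empty_or_nonempty {z : ℂ | Complex.exp z = w} with h | ⟨z₀, hz₀⟩
    · rw [h]; exact Set.countable_empty
    · refine (Set.countable_range fun n : ℤ => z₀ + n * (2 * Real.pi * Complex.I)).mono ?_
      intro z hz
      obtain ⟨n, hn⟩ := Complex.exp_eq_exp_iff_exists_int.1 (Eq.trans hz (Eq.symm hz₀))
      exact ⟨n, hn.symm⟩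
  exact h.preimage_of_injOn (f := hankelLog ε) (hankelLog_injective hε).injOn

/-- With the other variables fixed, the sum vanishes only if the contour point in the variable `j`
has one prescribed value. This happens for countably many parameters, and Fubini concludes. -/
theorem ae_tailSum_ne_zero {r : ℕ} {ε : ℝ} (hε : 0 < ε) (j : Fin r) :
    ∀ᵐ u : Fin r → ℝ, tailSum ε u j ≠ 0 := by
  cases r with
  | zero => exact j.elim0
  | succ r =>
    have hmp := (volume_preserving_piFinSuccAbove (fun _ : Fin (r + 1) => ℝ) j).symm
    have hmeas : MeasurableSet {u : Fin (r + 1) → ℝ | tailSum ε u j = 0} :=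
      measurableSet_eq_fun (measurable_tailSum ε j) measurable_const
    rw [ae_iff]
    simp only [ne_eq, not_not]
    rw [← hmp.measure_preimage hmeas.nullMeasurableSet, Measure.volume_eq_prod,
      Measure.prod_apply_symm (hmp.measurable hmeas)]
    refine (lintegral_congr fun u => ?_).trans lintegral_zero
    refine Set.Countable.measure_zero ((countable_hankelPath_eq hε
      (-∑ k ∈ Finset.Ioi j, hankelPath ε ((j.insertNth 0 u : Fin (r + 1) → ℝ) k))).mono ?_) _
    intro v hv
    have hv' : tailSum ε (j.insertNth v u : Fin (r + 1) → ℝ) j = 0 := hv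
    rw [tailSum_eq_add, Fin.insertNth_apply_same] at hv'
    rw [Set.mem_ofPred_eq, eq_neg_iff_add_eq_zero, ← hv']
    congr 1
    refine Finset.sum_congr rfl fun k hk => ?_
    obtain ⟨i, rfl⟩ := Fin.exists_succAbove_eq (Finset.mem_Ioi.1 hk).ne'
    rw [Fin.insertNth_apply_succAbove, Fin.insertNth_apply_succAbove]

/-! ### Existence of the desingularized multiple zeta function -/

theorem desIntegrand_eq (r : ℕ) (s : Fin r → ℂ) (c ε : ℝ) (u : Fin r → ℝ) :
    desIntegrand r s c ε u =
      (∏ j, genFactor c (tailSum ε u j)) * ∏ k, hankelWeight (s k) ε (u k) := rfl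

theorem measurable_genFactor (c : ℝ) : Measurable (genFactor c) := by
  unfold genFactor
  fun_prop

/-- Dominated convergence as `c → 1`, followed by the evaluation of the limit integral at the base
point `0`. -/
theorem isDesMZF_desRec (r : ℕ) : IsDesMZF r fun s => desRec r s 0 := by
  refine ⟨differentiable_desRec r, ?_⟩
  -- This smallness of `ε` does not depend on `s`, and it keeps all tail sums in `strip (1/4)`,
  -- where the bound for the factors is valid.
  have hev : ∀ᶠ ε in 𝓝[>] (0 : ℝ), 0 < ε ∧ (r : ℝ) * ε < 1 / 4 := by
    have h1 : Tendsto (fun ε : ℝ => (r : ℝ) * ε) (𝓝[>] 0) (𝓝 0) := by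
      have : Tendsto (fun ε : ℝ => (r : ℝ) * ε) (𝓝 0) (𝓝 (r * 0)) := tendsto_id.const_mul _
      rw [mul_zero] at this
      exact this.mono_left nhdsWithin_le_nhds
    filter_upwards [self_mem_nhdsWithin, h1.eventually_lt_const (by norm_num : (0 : ℝ) < 1 / 4)]
      with ε h1 h2 using ⟨h1, h2⟩
  filter_upwards [hev] with ε ⟨hε, hr⟩ s hs
  obtain ⟨C, hC0, hC⟩ := exists_norm_genFactor_le
  have hc : ∀ᶠ c in 𝓝[≠] (1 : ℝ), c ∈ Set.Ioo (1 / 2 : ℝ) 2 ∧ c ≠ 1 := by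
    filter_upwards [nhdsWithin_le_nhds (Ioo_mem_nhds (by norm_num : (1 / 2 : ℝ) < 1)
      (by norm_num : (1 : ℝ) < 2)), self_mem_nhdsWithin] with c h1 h2 using ⟨h1, h2⟩
  have hbound : ∀ c ∈ Set.Ioo (1 / 2 : ℝ) 2, ∀ (u : Fin r → ℝ) j, ‖genFactor c (tailSum ε u j)‖ ≤
      C * Real.exp (1 / 4) * |1 - c| * Real.exp (-(1 / 4 * (hankelPath ε (u j)).re)) := by
    intro c hc u j
    refine (hC c hc _ (tailSum_mem hε hr u j)).trans ?_
    have h1 : Real.exp (-(tailSum ε u j).re / 4) ≤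
        Real.exp (1 / 4) * Real.exp (-(1 / 4 * (hankelPath ε (u j)).re)) := by
      rw [← Real.exp_add]
      refine Real.exp_le_exp.2 ?_
      linarith [le_re_tailSum hε u j]
    calc _ ≤ C * (Real.exp (1 / 4) * Real.exp (-(1 / 4 * (hankelPath ε (u j)).re))) * |1 - c| := by
          gcongr
      _ = _ := by ring
  have hmeas : ∀ c : ℝ, Measurable fun u : Fin r → ℝ => desIntegrand r s c ε u := fun c =>
    Measurable.mul (Finset.measurable_prod _ fun j _ => (measurable_genFactor c).comp
      (measurable_tailSum ε j)) (measurable_prod_hankelWeight s ε)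
  refine ⟨?_, ?_⟩
  · filter_upwards [hc] with c hc
    exact Integrable.mono' (integrable_hankelBound s hε (a := 1 / 4) (by norm_num) _)
      (hmeas c).aestronglyMeasurable (Eventually.of_forall fun u =>
        norm_prod_mul_le_hankelBound s (hbound c hc.1 u))
  -- For non-integral exponents neither `e^{2πisₖ} - 1` nor `Γ(sₖ)` vanishes, so the prefactor
  -- inverts the constants produced by the Hankel integrals.
  · have hZ : desRec r s 0 = desCoeff r s * ∫ u, limIntegrand r s ε 0 u := by
      rw [integral_limIntegrand r s hs hε (η := 1 / 4) (by linarith)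
        (zero_mem_strip (by norm_num)), desCoeff,
        ← mul_assoc, ← Finset.prod_mul_distrib, Finset.prod_eq_one, one_mul]
      intro k _
      have h1 : Complex.exp (2 * Real.pi * Complex.I * s k) - 1 ≠ 0 := by
        intro h
        obtain ⟨n, hn⟩ := Complex.exp_eq_one_iff.1 (sub_eq_zero.1 h)
        refine hs k n (mul_left_cancel₀ Complex.two_pi_I_ne_zero ?_)
        rw [hn]; ring
      have h2 : Complex.Gamma (s k) ≠ 0 :=
        Complex.Gamma_ne_zero fun m e => hs k (-m) (by rw [e]; push_cast; rfl)
      field_simp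
    have hlim : Tendsto (fun c : ℝ => ∫ u, (1 / (1 - (c : ℂ))) ^ r * desIntegrand r s c ε u)
        (𝓝[≠] 1) (𝓝 (∫ u, limIntegrand r s ε 0 u)) := by
      -- Each of the `r` factors receives one `1/(1 - c)`.
      have hprod : ∀ (c : ℝ) (u : Fin r → ℝ), (1 / (1 - (c : ℂ))) ^ r * desIntegrand r s c ε u =
          (∏ j, 1 / (1 - (c : ℂ)) * genFactor c (tailSum ε u j)) *
            ∏ k, hankelWeight (s k) ε (u k) := by
        intro c u
        rw [desIntegrand_eq, Finset.prod_mul_distrib, Finset.prod_const, Finset.card_univ,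
          Fintype.card_fin, mul_assoc]
      refine tendsto_integral_filter_of_dominated_convergence
        (hankelBound s ε (1 / 4) (C * Real.exp (1 / 4)))
        (Eventually.of_forall fun c => ((hmeas c).const_mul _).aestronglyMeasurable) ?_
        (integrable_hankelBound s hε (by norm_num) _) ?_
      · filter_upwards [hc] with c hc
        refine Eventually.of_forall fun u => ?_
        rw [hprod]
        refine norm_prod_mul_le_hankelBound s fun j => ?_
        have h1 : 0 < |1 - c| := abs_pos.2 (sub_ne_zero.2 hc.2.symm)
        have h2 : ‖1 - (c : ℂ)‖ = |1 - c| := by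
          rw [← Complex.ofReal_one, ← Complex.ofReal_sub, Complex.norm_real, Real.norm_eq_abs]
        rw [norm_mul, norm_div, norm_one, h2, one_div, inv_mul_le_iff₀ h1]
        refine (hbound c hc.1 u j).trans (le_of_eq ?_)
        ring
      · have hne : ∀ᵐ u : Fin r → ℝ, ∀ j, tailSum ε u j ≠ 0 :=
          ae_all_iff.2 fun j => ae_tailSum_ne_zero hε j
        filter_upwards [hne] with u hu
        simp only [hprod]
        refine Tendsto.mul_const _ (tendsto_finsetProd _ fun j _ => ?_)
        rw [zero_add]
        exact tendsto_genFactor (tailSum_mem hε (hr.trans (by norm_num)) u j) (hu j)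
    change Tendsto _ _ (𝓝 (desRec r s 0))
    rw [hZ]
    refine (hlim.const_mul (desCoeff r s)).congr fun c => ?_
    rw [integral_const_mul, one_div, one_div, inv_pow]
    ring

theorem isDesMZF_desMZF (r : ℕ) : IsDesMZF r (desMZF r) := by
  have h : ∃ Z, IsDesMZF r Z := ⟨_, isDesMZF_desRec r⟩
  rw [desMZF, dif_pos h]
  exact h.choose_spec

theorem desMZF_eq (r : ℕ) (s : Fin r → ℂ) : desMZF r s = desRec r s 0 :=
  congrFun ((isDesMZF_desMZF r).unique (isDesMZF_desRec r)) s

/-! ### The functions `L^des` -/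

/-- The real function `f` on `(0, 1)` corresponds to `F` under the substitution `t = exp(-z)`. -/
def Represents (F : ℂ → ℂ) (f : ℝ → ℝ) : Prop :=
  ∀ t ∈ Set.Ioo (0 : ℝ) 1, (f t : ℂ) = F (-Real.log t : ℝ)

theorem neg_log_mem_strip {t : ℝ} (ht : t ∈ Set.Ioo (0 : ℝ) 1) {η : ℝ} (hη : 0 < η) :
    ((-Real.log t : ℝ) : ℂ) ∈ strip η :=
  ofReal_mem_strip hη (by linarith [Real.log_neg ht.1 ht.2])

theorem Represents.congr {F F' : ℂ → ℂ} {f : ℝ → ℝ} (h : Represents F f)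
    (hF : Set.EqOn F F' (strip 1)) : Represents F' f := fun t ht => by
  rw [h t ht, hF (neg_log_mem_strip ht one_pos)]

theorem Represents.mul {F F' : ℂ → ℂ} {f f' : ℝ → ℝ} (h : Represents F f)
    (h' : Represents F' f') : Represents (F * F') (fun t => f t * f' t) := fun t ht => by
  rw [Complex.ofReal_mul, h t ht, h' t ht, Pi.mul_apply]

/-- As `t → 1-0`, `z = -log t` tends to `0`, an interior point of the domain of holomorphy. The
value there is real because it is a limit of real numbers. -/
theorem Represents.tendsto {F : ℂ → ℂ} {f : ℝ → ℝ} (h : Represents F f) (hF : ContinuousAt F 0) :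
    (F 0).im = 0 ∧ Tendsto f (𝓝[<] 1) (𝓝 (F 0).re) := by
  have h1 : Tendsto (fun t : ℝ => ((-Real.log t : ℝ) : ℂ)) (𝓝[<] 1) (𝓝 0) := by
    have : ContinuousAt (fun t : ℝ => ((-Real.log t : ℝ) : ℂ)) 1 :=
      Complex.continuous_ofReal.continuousAt.comp (Real.continuousAt_log one_ne_zero).neg
    have h2 := this.tendsto
    simp only [Real.log_one, neg_zero, Complex.ofReal_zero] at h2
    exact h2.mono_left nhdsWithin_le_nhds
  have h2 : Tendsto (fun t => (f t : ℂ)) (𝓝[<] 1) (𝓝 (F 0)) := by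
    refine (hF.tendsto.comp h1).congr' ?_
    filter_upwards [Ioo_mem_nhdsLT one_pos] with t ht using (h t ht).symm
  have h3 := (Complex.continuous_re.tendsto _).comp h2
  have h4 := (Complex.continuous_im.tendsto _).comp h2
  simp only [Function.comp_def, Complex.ofReal_re, Complex.ofReal_im] at h3 h4
  exact ⟨tendsto_nhds_unique h4 tendsto_const_nhds, h3⟩

theorem represents_desLiZero : Represents desG desLiZero := fun t ht => by
  have h1 := neg_log_mem_strip ht one_pos
  have h0 : ((-Real.log t : ℝ) : ℂ) ≠ 0 := by
    rw [Complex.ofReal_ne_zero]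
    linarith [Real.log_neg ht.1 ht.2]
  have ht0 : (t : ℂ) ≠ 0 := by exact_mod_cast ht.1.ne'
  have ht1 : 1 - (t : ℂ) ≠ 0 := by
    rw [sub_ne_zero]; exact_mod_cast ht.2.ne'
  have he : Complex.exp ((-Real.log t : ℝ) : ℂ) = (t : ℂ)⁻¹ := by
    rw [← Complex.ofReal_exp, Real.exp_neg, Real.exp_log ht.1, Complex.ofReal_inv]
  rw [desG_of_ne h1 h0, he, desLiZero]
  push_cast
  have h2 : (t : ℂ)⁻¹ - 1 = (1 - t) / t := by field_simp
  rw [h2]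
  field_simp
  ring

theorem hasDerivAt_comp_neg_log {F : ℂ → ℂ} (hF : Decaying F) {t : ℝ}
    (ht : t ∈ Set.Ioo (0 : ℝ) 1) : HasDerivAt (fun t : ℝ => F (-Real.log t : ℝ))
      (negDeriv F (-Real.log t : ℝ) / t) t := by
  have h1 := (hF.differentiableAt (neg_log_mem_strip ht one_pos)).hasDerivAt
  have h2 : HasDerivAt (fun t : ℝ => ((-Real.log t : ℝ) : ℂ)) ((-t⁻¹ : ℝ) : ℂ) t :=
    (Real.hasDerivAt_log ht.1.ne').neg.ofReal_comp
  refine (HasDerivAt.comp (h₂ := F) (h := fun t : ℝ => ((-Real.log t : ℝ) : ℂ)) t h1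
    h2).congr_deriv ?_
  rw [negDeriv]
  push_cast
  ring

theorem Represents.opD {F : ℂ → ℂ} {f : ℝ → ℝ} (h : Represents F f) (hF : Decaying F) :
    Represents (negDeriv F) (opD f) := fun t ht => by
  have h1 := hasDerivAt_comp_neg_log hF ht
  have h2 : (fun t : ℝ => F (-Real.log t : ℝ)) =ᶠ[𝓝 t] fun t => (f t : ℂ) := by
    filter_upwards [Ioo_mem_nhds ht.1 ht.2] with v hv using (h v hv).symm
  have h3 := (h1.congr_of_eventuallyEq h2.symm)
  -- The derivative is first known for the complex-valued copy of `f`; its real part is the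
  -- derivative of `f` itself.
  have h4 : HasDerivAt f (negDeriv F (-Real.log t : ℝ) / t).re t := by
    have := Complex.reCLM.hasFDerivAt.comp_hasDerivAt t h3
    simpa [Function.comp_def] using this
  have h5 := h4.ofReal_comp.unique h3
  have ht0 : (t : ℂ) ≠ 0 := by exact_mod_cast ht.1.ne'
  rw [DesMZV.opD, h4.deriv, Complex.ofReal_mul, h5, mul_div_cancel₀ _ ht0]

/-- The function `weyl 1 F (-log v)` is an antiderivative of `f(v)/v` on `(0, t)` and tends to `0`
as `v → 0`, that is, as `z → ∞`. The decay of `F` reads `|f(v)| ≤ C v^{1/2}`, so `f(v)/v` is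
integrable at `0`. -/
theorem Represents.opJ {F : ℂ → ℂ} {f : ℝ → ℝ} (h : Represents F f) (hF : Decaying F) :
    Represents (weyl 1 F) (opJ f) := fun t ht => by
  have hlog : Tendsto (fun v : ℝ => -Real.log v) (𝓝[>] 0) atTop :=
    tendsto_neg_atBot_atTop.comp Real.tendsto_log_nhdsGT_zero
  have h0 : ∀ {v : ℝ}, v ∈ Set.Ioo 0 t → v ∈ Set.Ioo (0 : ℝ) 1 := fun hv =>
    ⟨hv.1, hv.2.trans ht.2⟩
  have hd : ∀ v ∈ Set.Ioo 0 t, HasDerivAt (fun v : ℝ => weyl 1 F (-Real.log v : ℝ))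
      ((f v : ℂ) / v) v := fun v hv => by
    have := hasDerivAt_comp_neg_log (hF.weyl 1) (h0 hv)
    rwa [negDeriv_weyl_one hF (neg_log_mem_strip (h0 hv) one_pos), ← h v (h0 hv)] at this
  have hint : IntervalIntegrable (fun v => (f v : ℂ) / v) volume 0 t := by
    rw [intervalIntegrable_iff_integrableOn_Ioo_of_le ht.1.le]
    obtain ⟨C, hC⟩ := hF.bound (1 / 2) (by norm_num)
    have hr : IntegrableOn (fun v : ℝ => C * v ^ (-(1 / 2) : ℝ)) (Set.Ioo 0 t) := by
      rw [← intervalIntegrable_iff_integrableOn_Ioo_of_le ht.1.le]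
      exact (intervalIntegral.intervalIntegrable_rpow' (by norm_num)).const_mul C
    refine Integrable.mono' hr ?_ (ae_restrict_of_forall_mem measurableSet_Ioo fun v hv => ?_)
    · refine (ContinuousOn.congr (f := fun v : ℝ => F (-Real.log v : ℝ) / v) ?_
        fun v hv => by simp only [h v (h0 hv)]).aestronglyMeasurable measurableSet_Ioo
      refine ContinuousOn.div (fun v hv => ?_) (by fun_prop)
        fun v hv => by exact_mod_cast hv.1.ne'
      exact (hasDerivAt_comp_neg_log hF (h0 hv)).continuousAt.continuousWithinAt
    · rw [h v (h0 hv), norm_div, Complex.norm_real, Real.norm_of_nonneg hv.1.le,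
        div_le_iff₀ hv.1]
      refine (hC _ (neg_log_mem_strip (h0 hv) (by norm_num))).trans (le_of_eq ?_)
      rw [mul_assoc, ← Real.rpow_add_one hv.1.ne', Complex.ofReal_re,
        Real.rpow_def_of_pos hv.1]
      ring_nf
  have hz : Tendsto (fun v : ℝ => weyl 1 F (-Real.log v : ℝ)) (𝓝[>] 0) (𝓝 0) := by
    have := ((hF.weyl 1).tendsto_zero (zero_mem_strip one_pos) 0).comp hlog
    simpa [Function.comp_def] using this
  have ht1 : Tendsto (fun v : ℝ => weyl 1 F (-Real.log v : ℝ)) (𝓝[<] t)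
      (𝓝 (weyl 1 F (-Real.log t : ℝ))) :=
    (hasDerivAt_comp_neg_log (hF.weyl 1) ht).continuousAt.tendsto.mono_left nhdsWithin_le_nhds
  have := intervalIntegral.integral_eq_sub_of_hasDerivAt_of_tendsto ht.1 hd hint hz ht1
  rw [sub_zero] at this
  rw [← this, DesMZV.opJ, ← intervalIntegral.integral_ofReal]
  simp only [Complex.ofReal_div]

theorem Represents.opJPow {F : ℂ → ℂ} {f : ℝ → ℝ} (h : Represents F f) (hF : Decaying F) (k : ℤ) :
    Represents (weyl k F) (opJPow k f) := by
  have hJ : ∀ n : ℕ, Represents (weyl n F) (DesMZV.opJ^[n] f) := by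
    intro n
    induction n with
    | zero => exact h.congr (by rw [Nat.cast_zero]; exact (weyl_zero hF).symm)
    | succ n ih =>
      rw [Function.iterate_succ_apply', Nat.cast_succ]
      exact (ih.opJ (hF.weyl n)).congr (weyl_one_weyl hF n)
  have hD : ∀ n : ℕ, Represents (weyl (-n : ℂ) F) (DesMZV.opD^[n] f) := by
    intro n
    induction n with
    | zero => exact h.congr (by rw [Nat.cast_zero, neg_zero]; exact (weyl_zero hF).symm)
    | succ n ih =>
      rw [Function.iterate_succ_apply', Nat.cast_succ, neg_add, ← sub_eq_add_neg]
      exact (ih.opD (hF.weyl _)).congr (negDeriv_weyl_eq hF _)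
  cases k with
  | ofNat n => simpa [DesMZV.opJPow] using hJ n
  | negSucc n =>
    have := hD (n + 1)
    rw [Int.cast_negSucc]
    exact this

/-- The function of `z` that corresponds to `desLiAux`. -/
def desFun : List ℤ → ℂ → ℂ
  | [] => 1
  | m :: l => weyl m (desG * desFun l)

theorem decaying_desG_mul_desFun (l : List ℤ) : Decaying (desG * desFun l) := by
  induction l with
  | nil => simpa only [desFun, mul_one] using decaying_desG
  | cons m l ih => exact decaying_desG.mul (ih.weyl m)

theorem decaying_desFun_cons (m : ℤ) (l : List ℤ) : Decaying (desFun (m :: l)) :=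
  (decaying_desG_mul_desFun l).weyl m

theorem represents_desLiAux (l : List ℤ) : Represents (desFun l) (desLiAux l) := by
  induction l with
  | nil => intro t _; simp [desFun, desLiAux]
  | cons m l ih => exact (represents_desLiZero.mul ih).opJPow (decaying_desG_mul_desFun l) m

theorem continuousAt_desFun (l : List ℤ) : ContinuousAt (desFun l) 0 := by
  cases l with
  | nil => exact continuousAt_const
  | cons m l =>
    exact ((decaying_desFun_cons m l).differentiableAt (zero_mem_strip one_pos)).continuousAt

theorem desFun_im (l : List ℤ) : (desFun l 0).im = 0 :=
  ((represents_desLiAux l).tendsto (continuousAt_desFun l)).1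

theorem tendsto_desLi (k : List ℤ) :
    Tendsto (desLi k) (𝓝[<] 1) (𝓝 (desFun k.reverse 0).re) :=
  ((represents_desLiAux k.reverse).tendsto (continuousAt_desFun _)).2

/-- `desRec` applies the exponent with the last index outermost, `desFun` the head of its list;
hence the reversal. -/
theorem desRec_intCast (r : ℕ) : ∀ k : Fin r → ℤ,
    desRec r (fun i => (k i : ℂ)) = desFun (List.ofFn k).reverse := by
  induction r with
  | zero => intro k; simp [desRec, desFun]
  | succ r ih =>
    intro k
    rw [List.ofFn_succ', List.concat_eq_append, List.reverse_append]
    change weyl (k (Fin.last r)) (desG * desRec r fun i => (k i.castSucc : ℂ)) = _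
    rw [ih fun i => k i.castSucc]
    rfl

theorem desZeta_eq (k : List ℤ) : desZeta k = desFun k.reverse 0 := by
  rw [desZeta, desMZF_eq, desRec_intCast, List.ofFn_get]

/-! ### Words as functions -/

theorem Word.exponents_ofList (l : List ℤ) : (Word.ofList l).exponents = l := by
  induction l with
  | nil => rfl
  | cons k l ih => exact congrArg (k :: ·) ih

theorem Word.ofList_exponents {w : Word} (hw : w.last = 0) : Word.ofList w.exponents = w := by
  induction w with
  | pow k => exact congrArg Word.pow (Eq.symm hw)
  | powY k w ih => exact congrArg (Word.powY k) (ih hw)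

/-- The linear extension of the map that sends a word to the corresponding function. -/
def evalFun : QDJY →ₗ[ℚ] (ℂ → ℂ) :=
  (Finsupp.linearCombination ℚ fun w : Word => desFun w.exponents).comp coeffs

/-- `exponents` forgets the last power of `j`, so the function attached to a word is the intended
one only if the word is `1` or ends in `y`. -/
theorem evalFun_wd (w : Word) : evalFun (wd w) = desFun w.exponents := by
  have h : coeffs (wd w) = Finsupp.single w 1 := rfl
  rw [evalFun, LinearMap.comp_apply, h, Finsupp.linearCombination_single, one_smul]

theorem evalFun_apply (x : QDJY) (z : ℂ) :
    evalFun x z = (coeffs x).sum fun w c => (c : ℂ) * desFun w.exponents z := by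
  rw [evalFun, LinearMap.comp_apply, Finsupp.linearCombination_apply, Finsupp.sum, Finsupp.sum,
    Finset.sum_apply]
  refine Finset.sum_congr rfl fun w _ => ?_
  rw [Pi.smul_apply, Rat.smul_def]

theorem evalFun_zero_im (x : QDJY) : (evalFun x 0).im = 0 := by
  rw [evalFun_apply, Finsupp.sum, Complex.im_sum]
  refine Finset.sum_eq_zero fun w _ => ?_
  rw [Complex.mul_im, desFun_im, Complex.ratCast_im, mul_zero, zero_mul, add_zero]

theorem ratCast_smul_fun (c : ℚ) (F : ℂ → ℂ) : c • F = fun z => (c : ℂ) * F z := by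
  funext z
  rw [Pi.smul_apply, Rat.smul_def]

theorem decaying_desFun_word {w : Word} (hw : w.depth ≠ 0) : Decaying (desFun w.exponents) := by
  cases w with
  | pow k => exact absurd rfl hw
  | powY k w => exact decaying_desFun_cons k _

theorem decaying_evalFun {x : QDJY} (hx : x ∈ endsInYSpan) : Decaying (evalFun x) := by
  induction hx using Submodule.span_induction with
  | mem x hx =>
    obtain ⟨w, hw, rfl⟩ := hx
    rw [evalFun_wd]
    exact decaying_desFun_word hw.1
  | zero => rw [map_zero]; exact decaying_zero
  | add x z _ _ hx hz => rw [map_add]; exact hx.add hz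
  | smul c x _ hx => rw [map_smul, ratCast_smul_fun]; exact hx.const_mul _

/-- The word must contain a `y`: the word `d` itself is sent to the constant `1`, not to the
derivative `0` of that constant. -/
theorem desFun_d_mul {w : Word} (hw : w.depth ≠ 0) :
    Set.EqOn (desFun (Word.d * w).exponents) (negDeriv (desFun w.exponents)) (strip 1) := by
  cases w with
  | pow k => exact absurd rfl hw
  | powY k w =>
    have h := negDeriv_weyl_eq (decaying_desG_mul_desFun w.exponents) (k : ℂ)
    have e : ((-1 + k : ℤ) : ℂ) = k - 1 := by push_cast; ring
    change Set.EqOn (weyl ((-1 + k : ℤ) : ℂ) _) (negDeriv (weyl (k : ℂ) _)) _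
    rw [e]
    exact h.symm

theorem negDeriv_desFun_j_mul {w : Word} (hw : w.depth ≠ 0) :
    Set.EqOn (negDeriv (desFun (Word.j * w).exponents)) (desFun w.exponents) (strip 1) := by
  have := desFun_d_mul (w := Word.j * w) (by rwa [Word.depth_mul_j])
  rw [← mul_assoc, Word.d_mul_j, one_mul] at this
  exact this.symm

theorem evalFun_y_mul (x : QDJY) :
    Set.EqOn (evalFun (wd Word.y * x)) (desG * evalFun x) (strip 1) := by
  induction x using MonoidAlgebra.induction_linear with
  | zero => intro z _; simp
  | add x x' hx hx' =>
    intro z hz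
    rw [mul_add, map_add, map_add, mul_add, Pi.add_apply, Pi.add_apply, hx hz, hx' hz]
  | single w c =>
    have : MonoidAlgebra.single w c = c • wd w := by simp [wd]
    intro z hz
    rw [this, mul_smul_comm, map_smul, map_smul, wd_mul, evalFun_wd, evalFun_wd, mul_smul_comm,
      Pi.smul_apply, Pi.smul_apply, Word.y, Word.powY_mul, one_mul]
    change c • weyl ((0 : ℤ) : ℂ) (desG * desFun w.exponents) z = _
    rw [Int.cast_zero, weyl_zero (decaying_desG_mul_desFun _) hz]

theorem negDeriv_add {F F' : ℂ → ℂ} (h : Decaying F) (h' : Decaying F') :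
    Set.EqOn (negDeriv (F + F')) (negDeriv F + negDeriv F') (strip 1) := fun z hz => by
  rw [Pi.add_apply, negDeriv, deriv_add (h.differentiableAt hz) (h'.differentiableAt hz), negDeriv,
    negDeriv]
  ring

theorem negDeriv_mul {F F' : ℂ → ℂ} (h : Decaying F) (h' : Decaying F') :
    Set.EqOn (negDeriv (F * F')) (negDeriv F * F' + F * negDeriv F') (strip 1) := fun z hz => by
  rw [Pi.add_apply, Pi.mul_apply, Pi.mul_apply, negDeriv,
    deriv_mul (h.differentiableAt hz) (h'.differentiableAt hz), negDeriv, negDeriv]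
  ring

theorem negDeriv_const_mul {F : ℂ → ℂ} (c : ℂ) :
    negDeriv (fun z => c * F z) = fun z => c * negDeriv F z := by
  funext z
  rw [negDeriv, negDeriv, deriv_const_mul_field]
  ring

theorem evalFun_d_mul {x : QDJY} (hx : x ∈ endsInYSpan) :
    Set.EqOn (evalFun (wd Word.d * x)) (negDeriv (evalFun x)) (strip 1) := by
  induction hx using Submodule.span_induction with
  | mem x hx =>
    obtain ⟨w, hw, rfl⟩ := hx
    rw [wd_mul, evalFun_wd, evalFun_wd]
    exact desFun_d_mul hw.1
  | zero => intro z _; simp [negDeriv, show (0 : ℂ → ℂ) = fun _ => 0 from rfl]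
  | add x x' hx hx' ih ih' =>
    intro z hz
    rw [mul_add, map_add, map_add, Pi.add_apply, ih hz, ih' hz,
      negDeriv_add (decaying_evalFun hx) (decaying_evalFun hx') hz, Pi.add_apply]
  | smul c x _ ih =>
    intro z hz
    rw [mul_smul_comm, map_smul, map_smul, ratCast_smul_fun, ratCast_smul_fun, negDeriv_const_mul]
    simp only [ih hz]

/-- Follows from the rule for `d`: apply `J` to `D(jx) = x` and use that `J D` is the identity on
decaying functions. -/
theorem evalFun_j_mul {x : QDJY} (hx : x ∈ endsInYSpan) :
    Set.EqOn (evalFun (wd Word.j * x)) (weyl 1 (evalFun x)) (strip 1) := by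
  have hj : wd Word.j * x ∈ endsInYSpan := pow_mul_mem 1 hx
  have h := evalFun_d_mul hj
  rw [← mul_assoc, wd_mul, Word.d_mul_j, show wd (1 : Word) = 1 from rfl, one_mul] at h
  exact ((weyl_congr 1 h).trans (weyl_one_negDeriv (decaying_evalFun hj))).symm

/-- The product `⧢₀` corresponds to the product of functions. -/
theorem evalFun_shWord (U V : Word) : U.last = 0 → V.last = 0 →
    Set.EqOn (evalFun (shWord U V)) (desFun U.exponents * desFun V.exponents) (strip 1) := by
  induction U, V using shWord.induct with
  | case1 V k hk =>
    intro hU hV z hz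
    rw [shWord, dif_pos hk, evalFun_wd]
    simp [Word.exponents, desFun]
  | case2 V k u hk ih =>
    intro hU hV z hz
    have hk' : k = 0 := hk
    rw [shWord, dif_pos hk, evalFun_y_mul _ hz, Pi.mul_apply, ih hU hV hz, Pi.mul_apply,
      Pi.mul_apply, Word.exponents, hk']
    change _ = weyl ((0 : ℤ) : ℂ) _ z * _
    rw [Int.cast_zero, weyl_zero (decaying_desG_mul_desFun _) hz, Pi.mul_apply, mul_assoc]
  | case3 U hU0 k hk =>
    intro hU hV z hz
    rw [shWord, dif_neg hU0, dif_pos hk, evalFun_wd]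
    simp [Word.exponents, desFun]
  | case4 U hU0 k v hk ih =>
    intro hU hV z hz
    have hk' : k = 0 := hk
    rw [shWord, dif_neg hU0, dif_pos hk, evalFun_y_mul _ hz, Pi.mul_apply, ih hU hV hz,
      Pi.mul_apply, Pi.mul_apply, Word.exponents.eq_2 k v, hk']
    change _ = _ * weyl ((0 : ℤ) : ℂ) _ z
    rw [Int.cast_zero, weyl_zero (decaying_desG_mul_desFun _) hz, Pi.mul_apply, mul_left_comm]
  | case5 U V hU0 hV0 hU1 hV1 ih1 ih2 =>
    intro hU hV
    have dU := Word.depth_ne_zero hU hU0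
    have dV := Word.depth_ne_zero hV hV0
    have lU := (Word.last_shift (-1) dU).trans hU
    have lV := (Word.last_shift (-1) dV).trans hV
    have m1 := (shWord_mem (Word.d * U) V lU hV).2 (Or.inr dV)
    have m2 := (shWord_mem U (Word.d * V) hU lV).2 (Or.inl dU)
    rw [shWord, dif_neg hU0, dif_neg hV0, dif_pos hU1, dif_pos hV1, ← mul_add]
    -- The sum inside is `Df · g + f · Dg = D(fg)`, and `J D(fg) = fg`.
    refine (evalFun_j_mul (add_mem m1 m2)).trans (Set.EqOn.trans (weyl_congr 1 fun z hz => ?_)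
      (weyl_one_negDeriv ((decaying_desFun_word dU).mul (decaying_desFun_word dV))))
    rw [negDeriv_mul (decaying_desFun_word dU) (decaying_desFun_word dV) hz, map_add, Pi.add_apply,
      ih1 lU hV hz, ih2 hU lV hz, Pi.mul_apply, Pi.mul_apply, desFun_d_mul dU hz,
      desFun_d_mul dV hz]
    rfl
  | case6 U V hU0 hV0 hU1 hV1 ih1 ih2 =>
    intro hU hV z hz
    have dU := Word.depth_ne_zero hU hU0
    have dV := Word.depth_ne_zero hV hV0
    have dV' : (Word.j * V).depth ≠ 0 := by rwa [Word.depth_mul_j]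
    have lU := (Word.last_shift (-1) dU).trans hU
    have lV := (Word.last_shift 1 dV).trans hV
    -- Here the rule says `D(f · Jg) - Df · Jg = f · g`.
    rw [shWord, dif_neg hU0, dif_neg hV0, dif_pos hU1, dif_neg hV1, map_sub, Pi.sub_apply,
      ih2 lU lV hz, evalFun_d_mul ((shWord_mem U (Word.j * V) hU lV).2 (Or.inl dU)) hz,
      negDeriv_congr (ih1 hU lV) hz,
      negDeriv_mul (decaying_desFun_word dU) (decaying_desFun_word dV') hz, Pi.add_apply,
      Pi.mul_apply, Pi.mul_apply, Pi.mul_apply, Pi.mul_apply, desFun_d_mul dU hz,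
      negDeriv_desFun_j_mul dV hz]
    ring
  | case7 U V hU0 hV0 hU1 ih1 ih2 =>
    intro hU hV z hz
    have dU := Word.depth_ne_zero hU hU0
    have dV := Word.depth_ne_zero hV hV0
    have dU' : (Word.j * U).depth ≠ 0 := by rwa [Word.depth_mul_j]
    have lU := (Word.last_shift 1 dU).trans hU
    have lV := (Word.last_shift (-1) dV).trans hV
    -- The mirror image: `D(Jf · g) - Jf · Dg = f · g`, whatever the sign of the leading exponent of
    -- `V`.
    rw [shWord, dif_neg hU0, dif_neg hV0, dif_neg hU1, map_sub, Pi.sub_apply,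
      ih2 lU lV hz, evalFun_d_mul ((shWord_mem (Word.j * U) V lU hV).2 (Or.inr dV)) hz,
      negDeriv_congr (ih1 lU hV) hz,
      negDeriv_mul (decaying_desFun_word dU') (decaying_desFun_word dV) hz, Pi.add_apply,
      Pi.mul_apply, Pi.mul_apply, Pi.mul_apply, Pi.mul_apply, desFun_d_mul dV hz,
      negDeriv_desFun_j_mul dU hz]
    ring

theorem evalFun_sh {x x' : QDJY} (hx : x ∈ admissible) (hx' : x' ∈ admissible) :
    Set.EqOn (evalFun (sh x x')) (evalFun x * evalFun x') (strip 1) := by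
  intro z hz
  induction hx using Submodule.span_induction with
  | mem x hx =>
    obtain ⟨u, hu, rfl⟩ := hx
    induction hx' using Submodule.span_induction with
    | mem x' hx' =>
      obtain ⟨v, hv, rfl⟩ := hx'
      rw [sh_wd, evalFun_wd, evalFun_wd]
      exact evalFun_shWord u v ((Word.eq_one_or_endsInY_iff u).1 hu)
        ((Word.eq_one_or_endsInY_iff v).1 hv) hz
    | zero => simp
    | add a b _ _ ha hb =>
      rw [map_add, map_add, map_add, mul_add, Pi.add_apply, Pi.add_apply, ha, hb]
    | smul c a _ ha =>
      rw [map_smul, map_smul, map_smul, mul_smul_comm, Pi.smul_apply, Pi.smul_apply, ha]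
  | zero => simp
  | add a b _ _ ha hb =>
    rw [map_add, LinearMap.add_apply, map_add, map_add, add_mul, Pi.add_apply, Pi.add_apply, ha, hb]
  | smul c a _ ha =>
    rw [map_smul, LinearMap.smul_apply, map_smul, map_smul, smul_mul_assoc, Pi.smul_apply,
      Pi.smul_apply, ha]

/-! ### The homomorphism on `𝓗` -/

/-- Both `J` and `D` preserve the zero function. Vanishing at the single point `z = 0` would not
survive them, so the ideal has to be treated on the level of functions. -/
theorem evalFun_pow_mul_eq_zero {x : QDJY} (hx : x ∈ endsInYSpan)
    (h : Set.EqOn (evalFun x) 0 (strip 1)) (k : ℤ) :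
    Set.EqOn (evalFun (wd (.pow k) * x)) 0 (strip 1) := by
  induction k using Int.induction_on with
  | zero =>
    change Set.EqOn (evalFun (1 * x)) 0 (strip 1)
    rwa [one_mul]
  | succ k ih =>
    have e : wd (.pow (k + 1)) * x = wd .j * (wd (.pow k) * x) := by
      rw [← mul_assoc, wd_mul, Word.j, Word.pow_mul, Word.shift, add_comm]
    intro z hz
    rw [e, evalFun_j_mul (pow_mul_mem _ hx) hz, weyl_congr 1 ih hz, weyl_one_eq decaying_zero hz]
    simp
  | pred k ih =>
    have e : wd (.pow (-k - 1)) * x = wd .d * (wd (.pow (-k)) * x) := by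
      rw [← mul_assoc, wd_mul, Word.d, Word.pow_mul, Word.shift, sub_eq_add_neg, add_comm]
    intro z hz
    rw [e, evalFun_d_mul (pow_mul_mem _ hx) hz, negDeriv_congr ih hz]
    simp [negDeriv, show (0 : ℂ → ℂ) = fun _ => 0 from rfl]

/-- Under `⧢₀ ↦` pointwise product and `d ↦ D` this is exactly the product rule. -/
theorem evalFun_leibniz {u v : Word} (hu : u.EndsInY) (hv : v.EndsInY) :
    Set.EqOn (evalFun (wd .d * sh (wd u) (wd v) - sh (wd .d * wd u) (wd v) -
      sh (wd u) (wd .d * wd v))) 0 (strip 1) := by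
  intro z hz
  have lu := (Word.last_shift (-1) hu.1).trans hu.2
  have lv := (Word.last_shift (-1) hv.1).trans hv.2
  rw [wd_mul, wd_mul, sh_wd, sh_wd, sh_wd, map_sub, map_sub, Pi.sub_apply, Pi.sub_apply,
    evalFun_d_mul ((shWord_mem u v hu.2 hv.2).2 (Or.inl hu.1)) hz,
    negDeriv_congr (evalFun_shWord u v hu.2 hv.2) hz,
    negDeriv_mul (decaying_desFun_word hu.1) (decaying_desFun_word hv.1) hz,
    evalFun_shWord (Word.d * u) v lu hv.2 hz, evalFun_shWord u (Word.d * v) hu.2 lv hz,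
    Pi.add_apply, Pi.mul_apply, Pi.mul_apply, Pi.mul_apply, Pi.mul_apply, desFun_d_mul hu.1 hz,
    desFun_d_mul hv.1 hz, Pi.zero_apply]
  ring

theorem leibniz_mem {u v : Word} (hu : u.EndsInY) (hv : v.EndsInY) :
    wd .d * sh (wd u) (wd v) - sh (wd .d * wd u) (wd v) - sh (wd u) (wd .d * wd v)
      ∈ endsInYSpan := by
  have lu := (Word.last_shift (-1) hu.1).trans hu.2
  have lv := (Word.last_shift (-1) hv.1).trans hv.2
  rw [wd_mul, wd_mul, sh_wd, sh_wd, sh_wd]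
  exact sub_mem (sub_mem (pow_mul_mem (-1) ((shWord_mem u v hu.2 hv.2).2 (Or.inl hu.1)))
    ((shWord_mem (Word.d * u) v lu hv.2).2 (Or.inr hv.1)))
    ((shWord_mem u (Word.d * v) hu.2 lv).2 (Or.inl hu.1))

/-- The algebra homomorphism from `(admissible, ⧢₀)` to the functions on the half strip. -/
def Adm.evalHom : Adm →+* (strip 1 → ℂ) where
  toFun x z := evalFun x.val z
  map_zero' := by
    funext z
    change evalFun 0 z = 0
    rw [map_zero, Pi.zero_apply]
  map_one' := by
    funext z
    change evalFun (wd 1) z = 1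
    rw [evalFun_wd]
    rfl
  map_add' x x' := by
    funext z
    change evalFun (x.val + x'.val) z = _
    rw [map_add]
    rfl
  map_mul' x x' := by
    funext z
    exact evalFun_sh x.2 x'.2 z.2

/-- The kernel of a ring homomorphism is a two-sided ideal, so only the generators need to be
checked. -/
theorem L_le_ker : L.ringCon ≤ RingCon.ker Adm.evalHom := by
  have h : L ≤ TwoSidedIdeal.ker Adm.evalHom := by
    refine TwoSidedIdeal.span_le.2 ?_
    rintro x ⟨k, u, v, hu, hv, hx⟩
    refine (TwoSidedIdeal.mem_ker _).2 ?_
    funext z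
    change evalFun x.val z = 0
    rw [hx]
    exact evalFun_pow_mul_eq_zero (leibniz_mem hu hv) (evalFun_leibniz hu hv) k z.2
  exact TwoSidedIdeal.ringCon_le_iff.1 h

/-- The value at `z = 0`, that is, at `t = 1`, as a homomorphism on `𝓗`. -/
def H.evalHom : H →+* ℂ :=
  (Pi.evalRingHom (fun _ : strip 1 => ℂ) ⟨0, zero_mem_strip one_pos⟩).comp
    (L.ringCon.lift Adm.evalHom L_le_ker)

theorem H.evalHom_coe (x : Adm) : H.evalHom (x : H) = evalFun x.val 0 := rfl

theorem H.evalHom_im (x : H) : (H.evalHom x).im = 0 := by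
  induction x using Quotient.inductionOn' with
  | h x => exact evalFun_zero_im x.val

theorem H.evalHom_word (k : List ℤ) : H.evalHom (H.word k) = desFun k.reverse 0 := by
  rw [H.word, H.evalHom_coe]
  change evalFun (wd (Word.ofList k.reverse)) 0 = _
  rw [evalFun_wd, Word.exponents_ofList]

/-- The map `ζ^des` on `𝓗`. -/
def H.zeta : H →ₗ[ℚ] ℝ :=
  (Complex.reAddGroupHom.comp (H.evalHom : H →+ ℂ)).toRatLinearMap

theorem H.zeta_apply (x : H) : H.zeta x = (H.evalHom x).re := rfl

theorem H.ofReal_zeta (x : H) : (H.zeta x : ℂ) = H.evalHom x :=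
  Complex.ext rfl (H.evalHom_im x).symm

/-- The words `j^{kᵣ} y ⋯ j^{k₁} y` with `r ≥ 0`, including `1`, span the admissible part, hence
also its quotient. -/
theorem H.linearMap_ext {f g : H →ₗ[ℚ] ℝ} (h : ∀ k, f (H.word k) = g (H.word k)) : f = g := by
  have key : ∀ (x : QDJY) (hx : x ∈ admissible),
      f (L.ringCon.mk' ⟨x, hx⟩) = g (L.ringCon.mk' ⟨x, hx⟩) := by
    intro x hx
    induction hx using Submodule.span_induction with
    | mem x hx =>
      obtain ⟨w, hw, rfl⟩ := hx
      have e := h w.exponents.reverse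
      have hw' := Word.ofList_exponents ((Word.eq_one_or_endsInY_iff w).1 hw)
      simp only [H.word, Adm.word, List.reverse_reverse, hw'] at e
      exact e
    | zero => exact (map_zero f).trans (map_zero g).symm
    | add a b ha hb iha ihb =>
      exact (map_add f _ _).trans ((congrArg₂ (· + ·) iha ihb).trans (map_add g _ _).symm)
    | smul c a ha iha =>
      exact (map_smul f c _).trans ((congrArg (c • ·) iha).trans (map_smul g c _).symm)
  ext x
  induction x using Quotient.inductionOn' with
  | h x => exact key x.1 x.2

theorem desZeta_mul_desZeta (k l : List ℤ) : desZeta k * desZeta l =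
    (coeffs (shWord (Word.ofList k.reverse) (Word.ofList l.reverse))).sum
      fun w c => (c : ℂ) * desZeta w.exponents.reverse := by
  have h := evalFun_shWord (Word.ofList k.reverse) (Word.ofList l.reverse) (Word.last_ofList _)
    (Word.last_ofList _) (zero_mem_strip one_pos)
  rw [evalFun_apply, Word.exponents_ofList, Word.exponents_ofList, Pi.mul_apply] at h
  rw [desZeta_eq, desZeta_eq, ← h]
  simp only [desZeta_eq, List.reverse_reverse]

end DesMZV

end

open DesMZV in
/-- The linear map `𝓗 → ℝ` with `1 ↦ 1` and
`j^{kᵣ} y ⋯ j^{k₁} y ↦ lim_{t → 1-0} L^des(k₁, …, kᵣ)(t) = ζ^des_r(k₁, …, kᵣ)` exists, is unique and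
is a homomorphism of `ℚ`-algebras; hence the shuffle type formula for the values `ζ^des_r`. -/
theorem mainTheorem1 :
    (∀ r : ℕ, IsDesMZF r (desMZF r)) ∧
    (∃ f : H →ₗ[ℚ] ℝ,
      (f 1 = 1 ∧ ∀ k : List ℤ, Tendsto (desLi k) (𝓝[<] 1) (𝓝 (f (H.word k)))) ∧
      (∀ g : H →ₗ[ℚ] ℝ,
        (g 1 = 1 ∧ ∀ k : List ℤ, Tendsto (desLi k) (𝓝[<] 1) (𝓝 (g (H.word k)))) → g = f) ∧
      (∀ k : List ℤ, (f (H.word k) : ℂ) = desZeta k) ∧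
      (∀ x z : H, f (x * z) = f x * f z)) ∧
    (∀ k l : List ℤ,
      desZeta k * desZeta l =
        (coeffs (shWord (Word.ofList k.reverse) (Word.ofList l.reverse))).sum
          fun w c => (c : ℂ) * desZeta w.exponents.reverse) := by
  have hlim : ∀ k : List ℤ, Tendsto (desLi k) (𝓝[<] 1) (𝓝 (H.zeta (H.word k))) := fun k => by
    rw [H.zeta_apply, H.evalHom_word]
    exact tendsto_desLi k
  refine ⟨isDesMZF_desMZF, ⟨H.zeta, ⟨?_, hlim⟩, fun g hg => ?_, fun k => ?_, fun x z => ?_⟩,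
    desZeta_mul_desZeta⟩
  · rw [H.zeta_apply, map_one, Complex.one_re]
  -- Uniqueness of limits forces the values on all words.
  · exact H.linearMap_ext fun k => tendsto_nhds_unique (hg.2 k) (hlim k)
  · rw [H.ofReal_zeta, H.evalHom_word, desZeta_eq]
  -- Taking real parts is multiplicative here because all values of `H.evalHom` are real.
  · rw [H.zeta_apply, map_mul, Complex.mul_re, H.evalHom_im, H.evalHom_im, mul_zero, sub_zero]
    rfl
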